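/- **Conventions.** For a congruence subgroup $\Gamma\subset \mathrm{SL}_2(\mathbb Z)$ let $X_\Gamma=\Gamma\backslash\mathbb H$ be the corresponding complex modular curve (an affine algebraic curve), with quotient map $\pi_\Gamma:\mathbb H\to X_\Gamma$. The point $\pi_\Gamma(\tau)$ corresponds to the elliptic curve $E_\tau=\mathbb C/(\mathbb Z+\mathbb Z\tau)$ (with level structure), and is a *CM point* if $\mathrm{End}(E_\tau)\neq\mathbb Z$. Products $X_S=\prod_{s\in S}X_{\Gamma_s}$ ($S$ a finite set, $\Gamma_s$ congruence subgroups) are regarded as complex algebraic varieties with the Zariski topology. A closed irreducible subvariety $Z$ of $X_S$ is *special* if $S$ has a partition $(S_1,\dots,S_r)$ such that $Z=Z_1\times\dots\times Z_r$ with $Z_i\subset X_{S_i}$ of one of the following forms: (a) $|S_i|=1$ and $Z_i$ is a CM point; (b) $Z_i$ is the image of $\mathbb H$ under $\tau\mapsto(\pi_{\Gamma_s}(g_s\tau))_{s\in S_i}$ for some $g_s\in\mathrm{GL}_2(\mathbb Q)$ with positive determinant. Let $n\ge 0$, let $X=X_1\times\dots\times X_n$ be a product of modular curves $X_i=X_{\Gamma_i}$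 and, for $I\subset\{1,\dots,n\}$, let $p_I:X\to X_I=\prod_{i\in I}X_i$ be the projection. For $Z\subset X$ closed and irreducible, $I$ is *minimal for $Z$* if $\dim p_I(Z)<|I|$ but $\dim p_J(Z)=|J|$ for all $J\subsetneq I$. **Proposition.** 1. Let $Z\subset X$ be a closed irreducible subvariety. Then $Z$ is special if and only if for every subset $I\subset\{1,\dots,n\}$ that is minimal for $Z$ we have $|I|\le 2$ and the Zariski closure $\overline{p_I(Z)}$ is special in $X_I$. 2. Let $Z\subset X$ be a closed irreducible subvariety. Then $Z$ is special if and only if (i) for all $I$ with $|I|\in\{1,2\}$ the image $p_I(Z)$ is special in $X_I$, and (ii) $Z$ is an irreducible component of $\bigcap_{|I|\in\{1,2\}}p_I^{-1}(p_I(Z))$. 3. The special subvarieties of $X$ are precisely the irreducible components of the loci in $X$ defined by a collection of conditions, each of the form "$x_i=c$" with $c$ a CM point of $X_i$, or "there is an isogeny of degree $d$ between the elliptic curves corresponding to $x_i$ and $x_j$" with $i\neq j$ and $d\ge 1$ given. -/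

import Mathlib

open scoped MatrixGroups Manifold
open UpperHalfPlane

noncomputable section

namespace ModularProducts

/-- The open modular curve `Γ \ ℍ`, as the set of its complex points. -/
def ModularCurve (Γ : Subgroup SL(2, ℤ)) : Type :=
  MulAction.orbitRel.Quotient Γ ℍ

/-- The quotient map `π_Γ` from `ℍ` to `Γ \ ℍ`. -/
def quotMap (Γ : Subgroup SL(2, ℤ)) (τ : ℍ) : ModularCurve Γ :=
  Quotient.mk (MulAction.orbitRel Γ ℍ) τ

/-- A regular (algebraic) function on the affine algebraic curve `Γ \ ℍ`: its pull-back to `ℍ` is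
holomorphic, and meromorphic at every cusp. The latter says that for all `γ` in `SL₂(ℤ)` the
function `f (γ τ)` is, for `Im τ` large, bounded by a constant times `exp (c * Im τ)` for some `c`,
that is, by a constant times a negative power of `|q|`. -/
def IsRegularFunction {Γ : Subgroup SL(2, ℤ)} (f : ModularCurve Γ → ℂ) : Prop :=
  MDifferentiable 𝓘(ℂ) 𝓘(ℂ) (fun τ : ℍ => f (quotMap Γ τ)) ∧
    ∀ γ : SL(2, ℤ), ∃ c : ℝ,
      (fun τ : ℍ => f (quotMap Γ (γ • τ))) =O[atImInfty] fun τ : ℍ => Real.exp (c * τ.im)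

variable {ι : Type*}

/-- The set of complex points of the product of the modular curves `Γ i \ ℍ`. -/
def ModularProduct (Γ : ι → Subgroup SL(2, ℤ)) : Type _ :=
  ∀ i, ModularCurve (Γ i)

/-- The coordinate ring of the affine variety `∏ i, Γ i \ ℍ`: the algebra of functions generated by
the pull-backs of the regular functions on the factors (the image of the tensor product of the
coordinate rings of the factors). -/
def coordRing (Γ : ι → Subgroup SL(2, ℤ)) : Subalgebra ℂ (ModularProduct Γ → ℂ) :=
  Algebra.adjoin ℂ {F | ∃ (i : ι) (f : ModularCurve (Γ i) → ℂ),
    IsRegularFunction f ∧ F = fun x => f (x i)}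

/-- The set of common zeros of a set of functions. -/
def zeroSet {Γ : ι → Subgroup SL(2, ℤ)} (A : Set (ModularProduct Γ → ℂ)) :
    Set (ModularProduct Γ) :=
  {x | ∀ F ∈ A, F x = 0}

/-- The Zariski topology on a product of modular curves: the closed sets are the sets of common
zeros of sets of regular functions. -/
instance zariskiTopology (Γ : ι → Subgroup SL(2, ℤ)) : TopologicalSpace (ModularProduct Γ) :=
  TopologicalSpace.ofClosed
    {Z | ∃ A : Set (ModularProduct Γ → ℂ), A ⊆ (coordRing Γ : Set _) ∧ Z = zeroSet A}
    (by
      refine ⟨{1}, ?_, ?_⟩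
      · rintro F rfl
        exact one_mem _
      · ext x
        simp [zeroSet])
    (by
      intro T hT
      refine ⟨{F | F ∈ coordRing Γ ∧ ∃ Z ∈ T, ∀ x ∈ Z, F x = 0}, fun F hF => hF.1, ?_⟩
      ext x
      constructor
      · rintro hx F ⟨-, Z, hZ, hF⟩
        exact hF x (hx Z hZ)
      · intro hx Z hZ
        obtain ⟨A, hA, rfl⟩ := hT hZ
        exact fun F hF => hx F ⟨hA hF, _, hZ, fun y hy => hy F hF⟩)
    (by
      rintro _ ⟨A, hA, rfl⟩ _ ⟨B, hB, rfl⟩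
      refine ⟨{H | ∃ F ∈ A, ∃ G ∈ B, H = F * G}, ?_, ?_⟩
      · rintro _ ⟨F, hF, G, hG, rfl⟩
        exact mul_mem (hA hF) (hB hG)
      · ext x
        constructor
        · rintro (hx | hx) _ ⟨F, hF, G, hG, rfl⟩
          · simp [hx F hF]
          · simp [hx G hG]
        · intro hx
          by_contra hn
          simp only [zeroSet, Set.mem_union, Set.mem_ofPred_eq, not_or, not_forall] at hn
          obtain ⟨⟨F, hF, hFx⟩, G, hG, hGx⟩ := hn
          exact mul_ne_zero hFx hGx (hx _ ⟨F, hF, G, hG, rfl⟩))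

/-- The projection `p_I` to the product of the factors with index in `I`. -/
def proj {Γ : ι → Subgroup SL(2, ℤ)} (I : Set ι) (x : ModularProduct Γ) :
    ModularProduct (fun i : I => Γ i) :=
  fun i => x i

/-- The lattice `ℤ + ℤ τ`; the complex elliptic curve `E_τ` is `ℂ / (ℤ + ℤ τ)`. -/
def lattice (τ : ℍ) : AddSubgroup ℂ :=
  AddSubgroup.closure {1, (τ : ℂ)}

/-- The endomorphism ring of `E_τ`: the complex numbers that map the lattice into itself. -/
def endRing (τ : ℍ) : Subring ℂ where
  carrier := {a | ∀ z ∈ lattice τ, a * z ∈ lattice τ}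
  mul_mem' := fun {a b} ha hb z hz => by
    rw [mul_assoc]
    exact ha _ (hb z hz)
  one_mem' := fun z hz => by rwa [one_mul]
  add_mem' := fun {a b} ha hb z hz => by
    rw [add_mul]
    exact add_mem (ha z hz) (hb z hz)
  zero_mem' := fun z _ => by
    rw [zero_mul]
    exact zero_mem _
  neg_mem' := fun {a} ha z hz => by
    rw [neg_mul]
    exact neg_mem (ha z hz)

/-- A point of `Γ \ ℍ` is a CM point if the endomorphism ring of the corresponding elliptic curve
is strictly larger than `ℤ`. (Elliptic curves `E_τ` with `τ` in one `SL₂(ℤ)`-orbit are isomorphic,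
so the choice of `τ` does not matter.) -/
def IsCMPoint {Γ : Subgroup SL(2, ℤ)} (x : ModularCurve Γ) : Prop :=
  ∃ τ : ℍ, quotMap Γ τ = x ∧ endRing τ ≠ ⊥

/-- There is an isogeny of degree `d` from `E_τ` to `E_τ'`: multiplication by some nonzero complex
number `a` with `a (ℤ + ℤ τ)` a subgroup of index `d` of `ℤ + ℤ τ'`. -/
def ExistsIsogeny (d : ℕ) (τ τ' : ℍ) : Prop :=
  ∃ a : ℂ, a ≠ 0 ∧ (lattice τ).map (AddMonoidHom.mulLeft a) ≤ lattice τ' ∧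
    ((lattice τ).map (AddMonoidHom.mulLeft a)).relIndex (lattice τ') = d

/-- The elliptic curves corresponding to the points `x` and `y` of two modular curves are related
by an isogeny of degree `d`. -/
def AreIsogenous {Γ Γ' : Subgroup SL(2, ℤ)} (d : ℕ) (x : ModularCurve Γ) (y : ModularCurve Γ') :
    Prop :=
  ∃ τ τ' : ℍ, quotMap Γ τ = x ∧ quotMap Γ' τ' = y ∧ ExistsIsogeny d τ τ'

/-- First basic form: there is just one factor, and `V` is a CM point. -/
def IsCMFactor (Γ : ι → Subgroup SL(2, ℤ)) (V : Set (ModularProduct Γ)) : Prop :=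
  ∃ i : ι, (∀ j, j = i) ∧ ∃ x : ModularProduct Γ, IsCMPoint (x i) ∧ V = {x}

/-- Second basic form: `V` is the image of `ℍ` under `τ ↦ (π (g i τ))_i`, for some rational
matrices `g i` with positive determinant. -/
def IsHeckeFactor (Γ : ι → Subgroup SL(2, ℤ)) (V : Set (ModularProduct Γ)) : Prop :=
  ∃ g : ι → GL (Fin 2) ℚ, (∀ i, 0 < (g i).det.val) ∧
    V = Set.range fun (τ : ℍ) (i : ι) =>
      quotMap (Γ i) (Matrix.GeneralLinearGroup.map (Rat.castHom ℝ) (g i) • τ)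

/-- A special subvariety of a product of modular curves: a closed irreducible subset that is, for
some partition `P` of the index set, the product over the blocks `T` of `P` of subsets `V T` of the
partial products, each of one of the two basic forms. -/
def IsSpecial {Γ : ι → Subgroup SL(2, ℤ)} (Z : Set (ModularProduct Γ)) : Prop :=
  IsClosed Z ∧ IsIrreducible Z ∧
    ∃ P : Set (Set ι), Setoid.IsPartition P ∧
      ∃ V : ∀ T : Set ι, Set (ModularProduct fun i : T => Γ i),
        (∀ T ∈ P, IsCMFactor (fun i : T => Γ i) (V T) ∨ IsHeckeFactor (fun i : T => Γ i) (V T)) ∧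
          Z = {x | ∀ T ∈ P, proj T x ∈ V T}

/-- The dimension of the image `p_I Z`, that is, the Krull dimension of its Zariski closure. -/
def dimProj {Γ : ι → Subgroup SL(2, ℤ)} (I : Set ι) (Z : Set (ModularProduct Γ)) : WithBot ℕ∞ :=
  topologicalKrullDim (closure (proj I '' Z))

/-- `I` is minimal for `Z`: the dimension of `p_I Z` is less than `|I|`, but the dimension of
`p_J Z` is `|J|` for all `J` strictly contained in `I`. -/
def IsMinimalFor {Γ : ι → Subgroup SL(2, ℤ)} (I : Set ι) (Z : Set (ModularProduct Γ)) : Prop :=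
  dimProj I Z < (I.ncard : WithBot ℕ∞) ∧ ∀ J, J ⊂ I → dimProj J Z = (J.ncard : WithBot ℕ∞)

/-- `Z` is an irreducible component of the subset `W`. -/
def IsIrredComponentOf {X : Type*} [TopologicalSpace X] (Z W : Set X) : Prop :=
  Maximal (fun V => IsIrreducible V ∧ V ⊆ W) Z

/-- The locus defined by a collection `C` of conditions `x i = c` on single coordinates and a
collection `D` of conditions on pairs of coordinates, where `(i, j, d)` demands the existence of an
isogeny of degree `d` between the elliptic curves corresponding to `x i` and `x j`. -/
def conditionLocus {Γ : ι → Subgroup SL(2, ℤ)} (C : Set (Σ i, ModularCurve (Γ i)))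
    (D : Set (ι × ι × ℕ)) : Set (ModularProduct Γ) :=
  {x | (∀ c ∈ C, x c.1 = c.2) ∧ ∀ e ∈ D, AreIsogenous e.2.2 (x e.1) (x e.2.1)}

end ModularProducts

end

open ModularProducts

/-!
The regular functions on a modular curve `Γ \ ℍ` are the `Γ`-invariant elements of the algebra
`congFun` of modular functions of arbitrary level with poles at the cusps. Two facts about this
algebra carry the geometry. It is integral over the ring of regular functions of each curve, hence
over `ℂ[j]`, since the product of `X - f ∘ γ` over the finitely many conjugates of a modular function
has invariant coefficients (`isIntegral_invFun`, `invFun_top_le`). And regular functions separate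
points (`exists_isRegularFunction_separating`); this is shown with Eisenstein series of all weights
and levels, whose values are power sums of the inverses of lattice points and therefore determine
the lattice together with its level structure.

Separation and norms show that Hecke correspondences are Zariski closed
(`exists_separating_heckeOn`). So the special subvarieties are the sets `heckeSet A c b g`: the
coordinates in `A` are CM points `c i`, and the other coordinates are `g i • t (b i)` with one free
parameter in `ℍ` for each value of `b`. These sets are irreducible as images of powers of `ℍ` under
maps that are analytic in each variable. By integrality, a function on such a set that vanishes on a
subset vanishes everywhere, as soon as the subset has dense projection to one coordinate for each
parameter (`eq_zero_of_dominant`). Integrality over polynomials in the `j`-invariants of the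
coordinates also gives the dimension of the product, so that a projection has full dimension if and
only if it is dense.

Isogenies of a given degree `d` are given by integral matrices of determinant `d`, of which there are
finitely many modulo a congruence subgroup. An irreducible set `Z` on which coordinates are
isogenous of constant degree is therefore contained in a single Hecke correspondence. With its
constant coordinates and the equivalence relation of isogeny between its coordinates, `Z` is thus
contained in some `heckeSet A c b g` (`exists_subset_heckeSet_isogenyClass`), and each of the three
conditions implies that it is equal to it, by density for the first one and by maximality for the
others. Conversely the sets of a given shape do not strictly contain each other
(`heckeSet_subset_of_subset`), which shows that they are components of the loci they satisfy. For
loci defined by isogenies and CM points, a constant coordinate that is not a CM point could be moved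
together with all coordinates isogenous to it, against maximality
(`isCMPoint_of_isIrredComponentOf`).
-/

namespace ModularProducts

open Matrix Filter Asymptotics CongruenceSubgroup

noncomputable section

/-! ### The action of rational matrices -/

/-- Rational matrices act on `ℍ` through the action of real matrices. -/
instance ratAction : MulAction (GL (Fin 2) ℚ) ℍ :=
  MulAction.compHom ℍ (GeneralLinearGroup.map (Rat.castHom ℝ))

lemma glPos_smul_eq (g : GL(2, ℚ)⁺) (τ : ℍ) :
    g • τ = GeneralLinearGroup.map (Rat.castHom ℝ) (g : GL (Fin 2) ℚ) • τ := rfl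

lemma map_det_pos (g : GL(2, ℚ)⁺) :
    0 < (GeneralLinearGroup.map (Rat.castHom ℝ) (g : GL (Fin 2) ℚ)).det.val := by
  have h : (0 : ℚ) < (g : GL (Fin 2) ℚ).det.val := g.2
  rw [GeneralLinearGroup.map_det]
  simpa using h

/-- The inclusion of `SL₂(ℤ)` in the group of rational matrices with positive determinant. -/
def ofSL : SL(2, ℤ) →* GL(2, ℚ)⁺ :=
  SpecialLinearGroup.toGLPos.comp (SpecialLinearGroup.map (Int.castRingHom ℚ))

lemma ofSL_apply (γ : SL(2, ℤ)) (i j : Fin 2) :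
    ((ofSL γ : GL(2, ℚ)⁺) : GL (Fin 2) ℚ) i j = (γ i j : ℚ) := rfl

lemma ofSL_coe (γ : SL(2, ℤ)) :
    ((ofSL γ : GL(2, ℚ)⁺) : GL (Fin 2) ℚ) = SpecialLinearGroup.mapGL ℚ γ := by
  ext i j; rfl

lemma coe_glPos_smul (g : GL(2, ℚ)⁺) (τ : ℍ) :
    ((g • τ : ℍ) : ℂ) = (((g : GL (Fin 2) ℚ) 0 0 : ℚ) * (τ : ℂ) + ((g : GL (Fin 2) ℚ) 0 1 : ℚ)) /
      (((g : GL (Fin 2) ℚ) 1 0 : ℚ) * (τ : ℂ) + ((g : GL (Fin 2) ℚ) 1 1 : ℚ)) := by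
  rw [glPos_smul_eq, coe_smul_of_det_pos (map_det_pos g)]
  simp [num, denom]

lemma ofSL_smul (γ : SL(2, ℤ)) (τ : ℍ) : ofSL γ • τ = γ • τ := by
  apply UpperHalfPlane.ext
  rw [coe_glPos_smul, coe_specialLinearGroup_apply]
  simp [ofSL_apply]

lemma mdifferentiable_glPos_smul (g : GL(2, ℚ)⁺) :
    MDifferentiable 𝓘(ℂ) 𝓘(ℂ) (fun τ : ℍ => g • τ) :=
  mdifferentiable_smul (map_det_pos g)

/-- Every rational matrix of positive determinant is the product of an element of `SL₂(ℤ)` and an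
upper triangular matrix. -/
lemma exists_eq_ofSL_mul (g : GL(2, ℚ)⁺) :
    ∃ (γ : SL(2, ℤ)) (u : GL(2, ℚ)⁺), g = ofSL γ * u ∧ (u : GL (Fin 2) ℚ) 1 0 = 0 := by
  set a : ℚ := (g : GL (Fin 2) ℚ) 0 0 with ha
  set c : ℚ := (g : GL (Fin 2) ℚ) 1 0 with hc
  -- the first column is proportional to the integral vector `(x, y)`
  set x : ℤ := a.num * c.den with hx
  set y : ℤ := c.num * a.den with hy
  have hxq : (x : ℚ) = a * (a.den * c.den) := by
    rw [hx]; push_cast; rw [← mul_assoc, Rat.mul_den_eq_num]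
  have hyq : (y : ℚ) = c * (a.den * c.den) := by
    rw [hy]; push_cast; rw [mul_comm (a.den : ℚ), ← mul_assoc, Rat.mul_den_eq_num]
  have hden : ((a.den : ℚ) * c.den) ≠ 0 := by positivity
  have hne : ¬ (a = 0 ∧ c = 0) := by
    rintro ⟨h1, h2⟩
    have h : (0 : ℚ) < (g : GL (Fin 2) ℚ).det.val := g.2
    rw [GeneralLinearGroup.val_det_apply, Matrix.det_fin_two] at h
    have e1 : (g : GL (Fin 2) ℚ).val 0 0 = 0 := h1
    have e2 : (g : GL (Fin 2) ℚ).val 1 0 = 0 := h2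
    rw [e1, e2] at h
    simp at h
  have hgcd : 0 < Int.gcd x y := by
    apply Int.gcd_pos_iff.2
    by_contra! h
    apply hne
    constructor
    · have := hxq; rw [h.1] at this; simpa [hden, eq_comm] using this
    · have := hyq; rw [h.2] at this; simpa [hden, eq_comm] using this
  obtain ⟨p, q, hpq, hxp, hyq'⟩ := Int.exists_gcd_one hgcd
  obtain ⟨γ, h0, h1⟩ := (Int.isCoprime_iff_gcd_eq_one.2 hpq).exists_SL2_col 0
  refine ⟨γ, ofSL γ⁻¹ * g, by rw [← mul_assoc, ← map_mul]; simp, ?_⟩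
  have : ((ofSL γ⁻¹ * g : GL(2, ℚ)⁺) : GL (Fin 2) ℚ) 1 0 = -(q : ℚ) * a + p * c := by
    have e : ((ofSL γ⁻¹ * g : GL(2, ℚ)⁺) : GL (Fin 2) ℚ) =
      ((ofSL γ⁻¹ : GL(2, ℚ)⁺) : GL (Fin 2) ℚ) * (g : GL (Fin 2) ℚ) := rfl
    rw [e, GeneralLinearGroup.coe_mul, Matrix.mul_apply, Fin.sum_univ_two]
    rw [show (((ofSL γ⁻¹ : GL(2, ℚ)⁺) : GL (Fin 2) ℚ) : Matrix (Fin 2) (Fin 2) ℚ) 1 0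
      = ((γ⁻¹ 1 0 : ℤ) : ℚ) from rfl,
      show (((ofSL γ⁻¹ : GL(2, ℚ)⁺) : GL (Fin 2) ℚ) : Matrix (Fin 2) (Fin 2) ℚ) 1 1
      = ((γ⁻¹ 1 1 : ℤ) : ℚ) from rfl]
    simp only [SpecialLinearGroup.SL2_inv_expl γ]
    simp [h0, h1, ha, hc]
  rw [this]
  have hg0 : ((Int.gcd x y : ℤ) : ℚ) ≠ 0 := by exact_mod_cast hgcd.ne'
  have e1 : (x : ℚ) = p * (Int.gcd x y : ℤ) := by exact_mod_cast hxp
  have e2 : (y : ℚ) = q * (Int.gcd x y : ℤ) := by exact_mod_cast hyq'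
  have : (-(q : ℚ) * a + p * c) * ((Int.gcd x y : ℤ) * (a.den * c.den)) = 0 := by
    calc _ = -((q : ℚ) * (Int.gcd x y : ℤ)) * (a * (a.den * c.den)) +
          (p * (Int.gcd x y : ℤ)) * (c * (a.den * c.den)) := by ring
      _ = 0 := by rw [← e1, ← e2, ← hxq, ← hyq]; ring
  rcases mul_eq_zero.1 this with h | h
  · exact h
  · exact absurd h (mul_ne_zero hg0 hden)

/-! ### Modular functions of all levels -/

/-- The growth condition at `i∞` used for modular functions: `f` is `O(exp (c * Im τ))` for
some `c`. -/
def ExpGrowth (f : ℍ → ℂ) : Prop :=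
  ∃ c : ℝ, f =O[atImInfty] fun τ : ℍ => Real.exp (c * τ.im)

lemma isBigO_exp_of_le {c d : ℝ} (h : c ≤ d) :
    (fun τ : ℍ => Real.exp (c * τ.im)) =O[atImInfty] fun τ : ℍ => Real.exp (d * τ.im) := by
  refine IsBigO.of_bound 1 (Eventually.of_forall fun τ => ?_)
  rw [one_mul, Real.norm_of_nonneg (Real.exp_pos _).le, Real.norm_of_nonneg (Real.exp_pos _).le]
  exact Real.exp_le_exp.2 (mul_le_mul_of_nonneg_right h τ.im_pos.le)

lemma ExpGrowth.const (a : ℂ) : ExpGrowth fun _ => a :=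
  ⟨0, by simpa using isBigO_const_const a (one_ne_zero' ℝ) _⟩

lemma ExpGrowth.add {f g : ℍ → ℂ} (hf : ExpGrowth f) (hg : ExpGrowth g) : ExpGrowth (f + g) := by
  obtain ⟨c, hc⟩ := hf
  obtain ⟨d, hd⟩ := hg
  exact ⟨max c d, (hc.trans (isBigO_exp_of_le (le_max_left c d))).add
    (hd.trans (isBigO_exp_of_le (le_max_right c d)))⟩

lemma ExpGrowth.mul {f g : ℍ → ℂ} (hf : ExpGrowth f) (hg : ExpGrowth g) : ExpGrowth (f * g) := by
  obtain ⟨c, hc⟩ := hf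
  obtain ⟨d, hd⟩ := hg
  refine ⟨c + d, ?_⟩
  have := hc.mul hd
  simp only [← Real.exp_add, ← add_mul] at this
  exact this

/-- Growth is preserved by precomposition with an upper triangular matrix. -/
lemma ExpGrowth.comp_smul {f : ℍ → ℂ} (hf : ExpGrowth f) {u : GL(2, ℚ)⁺}
    (hu : (u : GL (Fin 2) ℚ) 1 0 = 0) : ExpGrowth fun τ => f (u • τ) := by
  obtain ⟨c, hc⟩ := hf
  set v := GeneralLinearGroup.map (Rat.castHom ℝ) (u : GL (Fin 2) ℚ) with hv
  have hv0 : v 1 0 = 0 := by simp [hv, hu]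
  have ht : Tendsto (fun τ : ℍ => v • τ) atImInfty atImInfty := tendsto_smul_atImInfty hv0
  refine ⟨c * |v 0 0 / v 1 1|, ?_⟩
  have := hc.comp_tendsto ht
  refine this.congr_right fun τ => ?_
  have him : (v • τ).im = |v 0 0 / v 1 1| * τ.im := by
    simp [im_smul, num, denom, hv0, abs_div, abs_mul, abs_of_pos τ.im_pos, mul_div_right_comm]
  simp only [Function.comp_apply, him]
  ring_nf

/-- The algebra of holomorphic functions on `ℍ` that have at most exponential growth at all
cusps. It is stable under the action of rational matrices. -/
def modFun : Subalgebra ℂ (ℍ → ℂ) where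
  carrier := {f | MDifferentiable 𝓘(ℂ) 𝓘(ℂ) f ∧ ∀ g : GL(2, ℚ)⁺, ExpGrowth fun τ => f (g • τ)}
  mul_mem' hf hg := ⟨hf.1.mul hg.1, fun g => (hf.2 g).mul (hg.2 g)⟩
  add_mem' hf hg := ⟨hf.1.add hg.1, fun g => (hf.2 g).add (hg.2 g)⟩
  algebraMap_mem' a := ⟨mdifferentiable_const, fun _ => ExpGrowth.const a⟩

lemma comp_smul_mem_modFun {f : ℍ → ℂ} (hf : f ∈ modFun) (g : GL(2, ℚ)⁺) :
    (fun τ => f (g • τ)) ∈ modFun :=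
  ⟨hf.1.comp (mdifferentiable_glPos_smul g), fun h => by simpa [mul_smul] using hf.2 (g * h)⟩

lemma mem_modFun_of_SL {f : ℍ → ℂ} (hf : MDifferentiable 𝓘(ℂ) 𝓘(ℂ) f)
    (h : ∀ γ : SL(2, ℤ), ExpGrowth fun τ => f (γ • τ)) : f ∈ modFun := by
  refine ⟨hf, fun g => ?_⟩
  obtain ⟨γ, u, rfl, hu⟩ := exists_eq_ofSL_mul g
  simpa [mul_smul, ofSL_smul] using (h γ).comp_smul hu

lemma Gamma_le_of_dvd {N M : ℕ} (h : N ∣ M) : Gamma M ≤ Gamma N := by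
  intro γ hγ
  rw [Gamma_mem] at hγ ⊢
  have key (a : ℤ) : ((a : ZMod M).cast : ZMod N) = (a : ZMod N) := ZMod.cast_intCast h a
  have h1 : ((1 : ZMod M).cast : ZMod N) = 1 := ZMod.cast_one h
  have h0 : ((0 : ZMod M).cast : ZMod N) = 0 := ZMod.cast_zero
  refine ⟨?_, ?_, ?_, ?_⟩
  · rw [← key, hγ.1, h1]
  · rw [← key, hγ.2.1, h0]
  · rw [← key, hγ.2.2.1, h0]
  · rw [← key, hγ.2.2.2, h1]

/-- The algebra of modular functions of all levels: the functions in `modFun` that are invariant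
under some principal congruence subgroup. -/
def congFun : Subalgebra ℂ (ℍ → ℂ) where
  carrier := {f | f ∈ modFun ∧ ∃ N : ℕ, N ≠ 0 ∧ ∀ γ ∈ Gamma N, ∀ τ : ℍ, f (γ • τ) = f τ}
  mul_mem' := by
    rintro f g ⟨hf, N, hN, hfN⟩ ⟨hg, M, hM, hgM⟩
    refine ⟨mul_mem hf hg, N * M, mul_ne_zero hN hM, fun γ hγ τ => ?_⟩
    change f _ * g _ = f _ * g _
    rw [hfN γ (Gamma_le_of_dvd (dvd_mul_right N M) hγ),
      hgM γ (Gamma_le_of_dvd (dvd_mul_left M N) hγ)]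
  add_mem' := by
    rintro f g ⟨hf, N, hN, hfN⟩ ⟨hg, M, hM, hgM⟩
    refine ⟨add_mem hf hg, N * M, mul_ne_zero hN hM, fun γ hγ τ => ?_⟩
    change f _ + g _ = f _ + g _
    rw [hfN γ (Gamma_le_of_dvd (dvd_mul_right N M) hγ),
      hgM γ (Gamma_le_of_dvd (dvd_mul_left M N) hγ)]
  algebraMap_mem' a := ⟨algebraMap_mem _ a, 1, one_ne_zero, fun _ _ _ => rfl⟩

end

noncomputable section

/-! ### Modular functions and regular functions on modular curves -/

/-- For a rational matrix `g`, a principal congruence subgroup of sufficiently high level is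
conjugated by `g` into a given one. -/
lemma exists_Gamma_conj (g : GL(2, ℚ)⁺) {N : ℕ} (hN : N ≠ 0) :
    ∃ M : ℕ, M ≠ 0 ∧ ∀ x ∈ Gamma M, ∃ y ∈ Gamma N, g * ofSL x = ofSL y * g := by
  have : NeZero N := ⟨hN⟩
  obtain ⟨M, hM, h⟩ := exists_Gamma_le_conj (g : GL (Fin 2) ℚ) N
  refine ⟨M, hM, fun x hx => ?_⟩
  obtain ⟨y, hy, hxy⟩ := h x hx
  refine ⟨y, hy, Subtype.ext ?_⟩
  rw [Subgroup.coe_mul, Subgroup.coe_mul, ofSL_coe, ofSL_coe, hxy]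
  group

lemma comp_smul_mem_congFun {f : ℍ → ℂ} (hf : f ∈ congFun) (g : GL(2, ℚ)⁺) :
    (fun τ => f (g • τ)) ∈ congFun := by
  obtain ⟨hf, N, hN, hfN⟩ := hf
  obtain ⟨M, hM, h⟩ := exists_Gamma_conj g hN
  refine ⟨comp_smul_mem_modFun hf g, M, hM, fun x hx τ => ?_⟩
  obtain ⟨y, hy, hxy⟩ := h x hx
  change f (g • x • τ) = f (g • τ)
  rw [← ofSL_smul, ← mul_smul, hxy, mul_smul, ofSL_smul, hfN y hy]

lemma comp_SL_mem_congFun {f : ℍ → ℂ} (hf : f ∈ congFun) (γ : SL(2, ℤ)) :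
    (fun τ => f (γ • τ)) ∈ congFun := by
  simpa only [ofSL_smul] using comp_smul_mem_congFun hf (ofSL γ)

lemma quotMap_eq_iff {Γ : Subgroup SL(2, ℤ)} {τ τ' : ℍ} :
    quotMap Γ τ = quotMap Γ τ' ↔ ∃ γ ∈ Γ, γ • τ' = τ := by
  constructor
  · intro h
    obtain ⟨γ, hγ⟩ := Quotient.exact h
    exact ⟨γ, γ.2, hγ⟩
  · rintro ⟨γ, hγ, rfl⟩
    exact Quotient.sound ⟨⟨γ, hγ⟩, rfl⟩

lemma quotMap_smul {Γ : Subgroup SL(2, ℤ)} {γ : SL(2, ℤ)} (hγ : γ ∈ Γ) (τ : ℍ) :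
    quotMap Γ (γ • τ) = quotMap Γ τ :=
  quotMap_eq_iff.2 ⟨γ, hγ, rfl⟩

lemma quotMap_surjective (Γ : Subgroup SL(2, ℤ)) : Function.Surjective (quotMap Γ) :=
  Quotient.mk_surjective

lemma IsRegularFunction.mem_congFun {Γ : Subgroup SL(2, ℤ)} (hΓ : IsCongruenceSubgroup Γ)
    {f : ModularCurve Γ → ℂ} (hf : IsRegularFunction f) :
    (fun τ => f (quotMap Γ τ)) ∈ congFun := by
  obtain ⟨N, hN, hle⟩ := hΓ
  exact ⟨mem_modFun_of_SL hf.1 hf.2, N, hN, fun γ hγ τ => congrArg f (quotMap_smul (hle hγ) τ)⟩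

/-- The modular functions that are invariant under `Γ`. -/
def invFun (Γ : Subgroup SL(2, ℤ)) : Subalgebra ℂ (ℍ → ℂ) where
  carrier := {f | f ∈ congFun ∧ ∀ γ ∈ Γ, ∀ τ : ℍ, f (γ • τ) = f τ}
  mul_mem' := by
    rintro f g ⟨hf, hfN⟩ ⟨hg, hgM⟩
    refine ⟨mul_mem hf hg, fun γ hγ τ => ?_⟩
    change f _ * g _ = f _ * g _
    rw [hfN γ hγ, hgM γ hγ]
  add_mem' := by
    rintro f g ⟨hf, hfN⟩ ⟨hg, hgM⟩
    refine ⟨add_mem hf hg, fun γ hγ τ => ?_⟩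
    change f _ + g _ = f _ + g _
    rw [hfN γ hγ, hgM γ hγ]
  algebraMap_mem' a := ⟨algebraMap_mem _ a, fun _ _ _ => rfl⟩

lemma exists_isRegularFunction {Γ : Subgroup SL(2, ℤ)} {f : ℍ → ℂ} (hf : f ∈ invFun Γ) :
    ∃ F : ModularCurve Γ → ℂ, IsRegularFunction F ∧ ∀ τ, F (quotMap Γ τ) = f τ := by
  obtain ⟨⟨hf, -⟩, hinv⟩ := hf
  refine ⟨Quotient.lift f ?_, ⟨hf.1, fun γ => ?_⟩, fun τ => rfl⟩
  · rintro a b ⟨γ, rfl⟩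
    exact hinv γ γ.2 b
  · have := hf.2 (ofSL γ)
    simp only [ofSL_smul] at this
    exact this

lemma finite_orbit {f : ℍ → ℂ} (hf : f ∈ congFun) (Γ : Subgroup SL(2, ℤ)) :
    {h : ℍ → ℂ | ∃ γ ∈ Γ, h = fun τ => f (γ • τ)}.Finite := by
  obtain ⟨hf, N, hN, hfN⟩ := hf
  have : NeZero N := ⟨hN⟩
  refine Set.Finite.subset (s := Set.range fun (γ : SL(2, ℤ)) (τ : ℍ) => f (γ • τ)) ?_ ?_
  · choose! pre hpre using fun (h : ℍ → ℂ)
      (hh : h ∈ Set.range fun (γ : SL(2, ℤ)) (τ : ℍ) => f (γ • τ)) => hh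
    refine Set.Finite.of_finite_image (f := fun h =>
      SpecialLinearGroup.map (Int.castRingHom (ZMod N)) (pre h)) (Set.toFinite _) ?_
    intro h₁ hh₁ h₂ hh₂ heq
    rw [← hpre h₁ hh₁, ← hpre h₂ hh₂]
    ext τ
    have hmem : pre h₁ * (pre h₂)⁻¹ ∈ Gamma N := by
      rw [Gamma_mem', map_mul, map_inv]
      exact mul_inv_eq_one.2 heq
    have := hfN _ hmem (pre h₂ • τ)
    rwa [← mul_smul, inv_mul_cancel_right] at this
  · rintro _ ⟨γ, -, rfl⟩
    exact ⟨γ, rfl⟩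

open Polynomial in
/-- The product of `X - f ∘ γ` over the finitely many conjugates `f ∘ γ` of a modular function `f`
under `Γ` has coefficients that are invariant under `Γ`. -/
lemma exists_normPoly {f : ℍ → ℂ} (hf : f ∈ congFun) (Γ : Subgroup SL(2, ℤ)) :
    ∃ P : (invFun Γ)[X], P.Monic ∧
      P.map (algebraMap (invFun Γ) (ℍ → ℂ)) = ∏ h ∈ (finite_orbit hf Γ).toFinset, (X - C h) := by
  set S := (finite_orbit hf Γ).toFinset with hS
  have hSmem (h : ℍ → ℂ) : h ∈ S ↔ ∃ γ ∈ Γ, h = fun τ => f (γ • τ) := by simp [hS]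
  set p : (ℍ → ℂ)[X] := ∏ h ∈ S, (X - C h) with hp
  have hmonic : p.Monic := monic_prod_of_monic _ _ fun h _ => monic_X_sub_C h
  have hcong : p ∈ lifts (algebraMap congFun (ℍ → ℂ)) := by
    refine prod_mem fun h hh => ?_
    obtain ⟨γ, -, rfl⟩ := (hSmem h).1 hh
    refine ⟨X - C ⟨_, comp_SL_mem_congFun hf γ⟩, ?_⟩
    simp
  have hinv : ∀ δ ∈ Γ, p.map (RingHom.pi fun τ : ℍ => Pi.evalRingHom (fun _ : ℍ => ℂ) (δ • τ)) = p := by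
    intro δ hδ
    rw [hp, Polynomial.map_prod]
    refine Finset.prod_nbij' (fun h τ => h (δ • τ)) (fun h τ => h (δ⁻¹ • τ)) ?_ ?_ ?_ ?_ ?_
    · intro h hh
      obtain ⟨γ, hγ, rfl⟩ := (hSmem h).1 hh
      exact (hSmem _).2 ⟨γ * δ, mul_mem hγ hδ, by simp [mul_smul]⟩
    · intro h hh
      obtain ⟨γ, hγ, rfl⟩ := (hSmem h).1 hh
      exact (hSmem _).2 ⟨γ * δ⁻¹, mul_mem hγ (inv_mem hδ), by simp [mul_smul]⟩
    · intro h _; simp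
    · intro h _; simp
    · intro h _
      simp only [Polynomial.map_sub, map_X, map_C]
      rfl
  have hlift : p ∈ lifts (algebraMap (invFun Γ) (ℍ → ℂ)) := by
    rw [lifts_iff_coeff_lifts]
    intro n
    obtain ⟨c, hc⟩ := (lifts_iff_coeff_lifts p).1 hcong n
    refine ⟨⟨p.coeff n, by rw [← hc]; exact c.2, fun γ hγ τ => ?_⟩, rfl⟩
    have := congrArg (fun q : (ℍ → ℂ)[X] => q.coeff n τ) (hinv γ hγ)
    simp only [coeff_map] at this
    exact this
  obtain ⟨P, hP, -, hPm⟩ := lifts_and_natDegree_eq_and_monic hlift hmonic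
  exact ⟨P, hPm, hP⟩

lemma isIntegral_invFun {f : ℍ → ℂ} (hf : f ∈ congFun) (Γ : Subgroup SL(2, ℤ)) :
    IsIntegral (invFun Γ) f := by
  obtain ⟨P, hP, hmap⟩ := exists_normPoly hf Γ
  refine ⟨P, hP, ?_⟩
  rw [← Polynomial.eval_map, hmap, Polynomial.eval_prod]
  exact Finset.prod_eq_zero (i := f) (by simpa using ⟨1, one_mem _, by simp⟩) (by simp)

end

noncomputable section

/-! ### Quotients of modular forms by powers of the discriminant -/

/-- Holomorphic functions that transform like modular forms of weight `k` under `Γ(N)` and are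
bounded at all cusps. -/
def IsModForm (N : ℕ) (k : ℤ) (f : ℍ → ℂ) : Prop :=
  MDifferentiable 𝓘(ℂ) 𝓘(ℂ) f ∧ (∀ γ : SL(2, ℤ), IsBoundedAtImInfty (SlashAction.map k γ f)) ∧
    ∀ γ ∈ Gamma N, SlashAction.map k γ f = f

lemma IsModForm.mul {N : ℕ} {k l : ℤ} {f g : ℍ → ℂ} (hf : IsModForm N k f)
    (hg : IsModForm N l g) : IsModForm N (k + l) (f * g) := by
  refine ⟨hf.1.mul hg.1, fun γ => ?_, fun γ hγ => ?_⟩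
  · rw [ModularForm.mul_slash_SL2]
    exact (hf.2.1 γ).mul (hg.2.1 γ)
  · rw [ModularForm.mul_slash_SL2, hf.2.2 γ hγ, hg.2.2 γ hγ]

lemma IsModForm.one (N : ℕ) : IsModForm N 0 1 := by
  refine ⟨mdifferentiable_const, fun γ => ?_, fun γ _ => ModularForm.is_invariant_one γ⟩
  rw [ModularForm.is_invariant_one]
  exact isBigO_const_const _ one_ne_zero _

lemma IsModForm.pow {N : ℕ} {k : ℤ} {f : ℍ → ℂ} (hf : IsModForm N k f) (n : ℕ) :
    IsModForm N (n * k) (f ^ n) := by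
  induction n with
  | zero => simpa using IsModForm.one N
  | succ n ih =>
    rw [pow_succ, show ((n + 1 : ℕ) : ℤ) * k = n * k + k by push_cast; ring]
    exact ih.mul hf

lemma isModForm_of_levelOne {k : ℤ} (f : ModularForm 𝒮ℒ k) (N : ℕ) : IsModForm N k f := by
  have hinv (γ : SL(2, ℤ)) : SlashAction.map k γ (f : ℍ → ℂ) = f := f.slash_action_eq' _ ⟨γ, rfl⟩
  refine ⟨f.holo', fun γ => ?_, fun γ _ => hinv γ⟩
  rw [hinv]
  exact ModularFormClass.bdd_at_infty f

lemma isModForm_eisensteinSeries {N : ℕ} [NeZero N] {k : ℤ} (hk : 3 ≤ k) (a : Fin 2 → ZMod N) :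
    IsModForm N k (eisensteinSeries a k) := by
  refine ⟨(ModularForm.eisensteinSeriesMF hk a).holo',
    fun γ => EisensteinSeries.isBoundedAtImInfty_eisensteinSeriesSIF a hk γ, fun γ hγ => ?_⟩
  rw [EisensteinSeries.eisensteinSeries_slash_apply, Gamma_mem'.mp hγ]
  simp

local notation "Δ" => ModularForm.discriminant

lemma discriminant_slash (γ : SL(2, ℤ)) : SlashAction.map (12 : ℤ) γ Δ = Δ :=
  CuspForm.discriminant.slash_action_eq' _ ⟨γ, rfl⟩

lemma expGrowth_inv_discriminant : ExpGrowth fun τ => (Δ τ)⁻¹ := by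
  refine ⟨2 * Real.pi, ?_⟩
  have := ModularForm.exp_isBigO_discriminant.inv_rev
    (Eventually.of_forall fun τ h => absurd h (Real.exp_pos _).ne')
  refine this.congr_right fun τ => ?_
  rw [← Real.exp_neg]
  ring_nf

lemma div_discriminant_pow_smul (f : ℍ → ℂ) (m : ℕ)
    (γ : SL(2, ℤ)) (τ : ℍ) :
    f (γ • τ) / Δ (γ • τ) ^ m = (SlashAction.map (m * 12 : ℤ) γ f) τ / Δ τ ^ m := by
  have h := congrFun (discriminant_slash γ) τ
  rw [ModularForm.SL_slash_apply] at h ⊢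
  have hd : denom γ τ ≠ 0 := denom_ne_zero _ _
  have e : (denom γ τ ^ (-12 : ℤ)) ^ m = denom γ τ ^ (-(m * 12 : ℤ)) := by
    rw [← zpow_natCast, ← _root_.zpow_mul]
    ring_nf
  rw [← h, mul_pow, e, mul_div_mul_right _ _ (zpow_ne_zero _ hd)]

lemma IsModForm.div_discriminant_pow_mem {N : ℕ} (hN : N ≠ 0) {f : ℍ → ℂ} {m : ℕ}
    (hf : IsModForm N (m * 12) f) : (fun τ => f τ / Δ τ ^ m) ∈ invFun (Gamma N) := by
  have hinv : ∀ γ ∈ Gamma N, ∀ τ : ℍ, f (γ • τ) / Δ (γ • τ) ^ m = f τ / Δ τ ^ m :=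
    fun γ hγ τ => by rw [div_discriminant_pow_smul f m, hf.2.2 γ hγ]
  have hΔ : MDifferentiable 𝓘(ℂ) 𝓘(ℂ) Δ := CuspForm.discriminant.holo'
  refine ⟨⟨mem_modFun_of_SL (hf.1.div (hΔ.pow m) fun τ =>
    pow_ne_zero _ (ModularForm.discriminant_ne_zero τ)) fun γ => ?_, N, hN, hinv⟩, hinv⟩
  simp only [div_discriminant_pow_smul f m γ]
  have h1 : ExpGrowth (SlashAction.map (m * 12 : ℤ) γ f) := ⟨0, by
    simpa only [zero_mul, Real.exp_zero] using! hf.2.1 γ⟩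
  have h2 : ExpGrowth fun τ => ((Δ τ)⁻¹) ^ m := by
    clear hinv h1 hf
    induction m with
    | zero => simpa using ExpGrowth.const 1
    | succ n ih => simpa only [pow_succ] using! ih.mul expGrowth_inv_discriminant
  simp only [div_eq_mul_inv, ← inv_pow]
  exact h1.mul h2

/-! ### Modular functions of level one -/

/-- The `j`-function. -/
def jFun (τ : ℍ) : ℂ := ModularForm.E₄ τ ^ 3 / Δ τ

lemma jFun_mem : jFun ∈ invFun ⊤ := by
  have h : IsModForm 1 ((1 : ℕ) * 12) (ModularForm.E₄ ^ 3 : ℍ → ℂ) := by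
    have := (isModForm_of_levelOne ModularForm.E₄ 1).pow 3
    norm_num at this ⊢
    exact this
  have := h.div_discriminant_pow_mem one_ne_zero
  rw [Gamma_one_top] at this
  simpa using! this

lemma coeff_zero_qExpansion_pow {k : ℤ} (f : ModularForm 𝒮ℒ k) (n : ℕ) :
    (qExpansion 1 ((f : ℍ → ℂ) ^ n)).coeff 0 = (qExpansion 1 f).coeff 0 ^ n := by
  induction n with
  | zero => simp [qExpansion_one]
  | succ n ih =>
    rw [pow_succ, pow_succ, qExpansion_mul_coeff_zero, ih]
    · have := (ModularFormClass.analyticAt_cuspFunction_zero (f.pow n) one_pos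
        one_mem_strictPeriods_SL).continuousAt
      simpa using this
    · exact (ModularFormClass.analyticAt_cuspFunction_zero f one_pos
        one_mem_strictPeriods_SL).continuousAt

lemma modularForm_div_mem_adjoin (m : ℕ) {k : ℤ} (hk : k = 12 * m) (F : ModularForm 𝒮ℒ k) :
    (fun τ => F τ / Δ τ ^ m) ∈ Algebra.adjoin ℂ {jFun} := by
  induction m generalizing k with
  | zero =>
    obtain rfl : k = 0 := by simpa using hk
    obtain ⟨c, hc⟩ := ModularFormClass.levelOne_weight_zero_const F
    simp only [hc, pow_zero, div_one, Function.const_apply]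
    exact algebraMap_mem _ c
  | succ m ih =>
    -- subtract a multiple of `E₄ ^ (3 * (m + 1))` to obtain a cusp form, and divide it by `Δ`
    set c := (qExpansion 1 F).coeff 0 with hc
    let E : ModularForm 𝒮ℒ k := ModularForm.mcast (by rw [hk]; push_cast; ring)
      (ModularForm.E₄.pow (3 * (m + 1)))
    have hE : (E : ℍ → ℂ) = (ModularForm.E₄ : ℍ → ℂ) ^ (3 * (m + 1)) := by
      rw [ModularForm.coe_mcast]
      exact ModularForm.coe_pow _ _
    have hG : (qExpansion 1 (F - c • E : ModularForm 𝒮ℒ k)).coeff 0 = 0 := by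
      have e1 : ((F - c • E : ModularForm 𝒮ℒ k) : ℍ → ℂ) = F - c • (E : ℍ → ℂ) := rfl
      have e2 : qExpansion 1 (F - c • (E : ℍ → ℂ)) = qExpansion 1 F - c • qExpansion 1 E := by
        rw [← ModularForm.qExpansion_smul one_pos one_mem_strictPeriods_SL c E]
        exact ModularForm.qExpansion_sub one_pos one_mem_strictPeriods_SL F (c • E)
      rw [e1, e2, map_sub, ← hc, PowerSeries.coeff_smul, hE, coeff_zero_qExpansion_pow,
        EisensteinSeries.E_qExpansion_coeff_zero _ ⟨2, rfl⟩]
      simp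
    set H := CuspForm.discriminantEquiv (ModularForm.toCuspForm _ hG) with hH
    have hHval (τ : ℍ) : F τ = c * ModularForm.E₄ τ ^ (3 * (m + 1)) + Δ τ * H τ := by
      rw [hH, ModularForm.discriminant_mul_discriminantEquiv_apply, ModularForm.toCuspForm_apply]
      change F τ = _ + (F τ - c • E τ)
      rw [hE]
      simp
    have hmem := ih (by rw [hk]; push_cast; ring) H
    have heq : (fun τ => F τ / Δ τ ^ (m + 1)) =
        algebraMap ℂ (ℍ → ℂ) c * jFun ^ (m + 1) + fun τ => H τ / Δ τ ^ m := by
      ext τ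
      have := ModularForm.discriminant_ne_zero τ
      simp only [Pi.add_apply, Pi.mul_apply, Pi.pow_apply, Pi.algebraMap_apply,
        Algebra.algebraMap_self, RingHom.id_apply, jFun, hHval τ, div_pow, ← pow_mul]
      field_simp
      ring
    rw [heq]
    have hj : jFun ^ (m + 1) ∈ Algebra.adjoin ℂ {jFun} :=
      pow_mem (Algebra.subset_adjoin (Set.mem_singleton _)) _
    exact Subalgebra.add_mem _ (Subalgebra.mul_mem _ (Subalgebra.algebraMap_mem _ c) hj) hmem

/-- The modular functions of level one are the polynomials in the `j`-function: a power of `Δ`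
removes the pole at the cusp and gives a modular form of level one. -/
lemma invFun_top_le : invFun ⊤ ≤ Algebra.adjoin ℂ {jFun} := by
  rintro f ⟨⟨hf, -⟩, hinv⟩
  obtain ⟨c, hc⟩ := hf.2 1
  simp only [one_smul] at hc
  obtain ⟨m, hm⟩ := exists_nat_ge (c / (2 * Real.pi))
  have hΔ : MDifferentiable 𝓘(ℂ) 𝓘(ℂ) Δ := CuspForm.discriminant.holo'
  have hslash (γ : SL(2, ℤ)) :
      SlashAction.map (12 * m : ℤ) γ (fun τ => f τ * Δ τ ^ m) = fun τ => f τ * Δ τ ^ m := by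
    ext τ
    have h := congrFun (discriminant_slash γ) τ
    rw [ModularForm.SL_slash_apply] at h ⊢
    have e : (denom γ τ ^ (-12 : ℤ)) ^ m = denom γ τ ^ (-(12 * m : ℤ)) := by
      rw [← zpow_natCast, ← _root_.zpow_mul]
      ring_nf
    simp only [hinv γ trivial]
    rw [← h, mul_pow, e, mul_assoc]
  have hbdd : IsBoundedAtImInfty fun τ => f τ * Δ τ ^ m := by
    have h1 : Δ =O[atImInfty] fun τ => Real.exp (-2 * Real.pi * τ.im) := by
      simpa using! CuspFormClass.exp_decay_atImInfty (h := 1) CuspForm.discriminant one_pos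
        one_mem_strictPeriods_SL
    have h2 := hc.mul (h1.pow m)
    refine h2.trans (IsBigO.of_bound 1 (Eventually.of_forall fun τ => ?_))
    rw [← Real.exp_nat_mul, ← Real.exp_add, Real.norm_of_nonneg (Real.exp_pos _).le]
    simp only [Pi.one_apply, norm_one, mul_one, Real.exp_le_one_iff]
    have : c ≤ m * (2 * Real.pi) := (div_le_iff₀ Real.two_pi_pos).1 hm
    nlinarith [τ.im_pos]
  let F : ModularForm 𝒮ℒ (12 * m) :=
    { toFun := fun τ => f τ * Δ τ ^ m
      slash_action_eq' := by rintro _ ⟨γ, rfl⟩; exact hslash γ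
      holo' := hf.1.mul (hΔ.pow m)
      bdd_at_cusps' := by
        intro c hc
        rw [Subgroup.IsArithmetic.isCusp_iff_isCusp_SL2Z] at hc
        rw [OnePoint.isBoundedAt_iff_forall_SL2Z hc]
        intro γ _
        rw [hslash γ]
        exact hbdd }
  have := modularForm_div_mem_adjoin m rfl F
  convert this using 1
  ext τ
  exact (mul_div_cancel_right₀ _ (pow_ne_zero _ (ModularForm.discriminant_ne_zero τ))).symm

end

noncomputable section

/-! ### Power sums determine a discrete set -/

open Topology in
lemma tendsto_cesaro_pow {x : ℂ} (hx : ‖x‖ ≤ 1) :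
    Tendsto (fun n : ℕ => (n : ℂ)⁻¹ * ∑ k ∈ Finset.range n, x ^ k) atTop
      (𝓝 (if x = 1 then 1 else 0)) := by
  split_ifs with h
  · subst h
    refine tendsto_const_nhds.congr' ?_
    filter_upwards [eventually_ne_atTop 0] with n hn
    have : (n : ℂ) ≠ 0 := by exact_mod_cast hn
    simp [this]
  · have hb : ∀ n : ℕ, ‖∑ k ∈ Finset.range n, x ^ k‖ ≤ 2 / ‖x - 1‖ := by
      intro n
      rw [geom_sum_eq h, norm_div]
      gcongr
      calc ‖x ^ n - 1‖ ≤ ‖x ^ n‖ + ‖(1 : ℂ)‖ := norm_sub_le _ _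
        _ ≤ 1 + 1 := by
          rw [norm_pow, norm_one]
          gcongr
          exact pow_le_one₀ (norm_nonneg _) hx
        _ = 2 := by norm_num
    have h0 : Tendsto (fun n : ℕ => (n : ℂ)⁻¹) atTop (𝓝 0) := tendsto_inv_atTop_nhds_zero_nat
    exact h0.zero_mul_isBoundedUnder_le (isBoundedUnder_of ⟨_, hb⟩)

lemma norm_cesaro_pow_le {x : ℂ} (hx : ‖x‖ ≤ 1) (n : ℕ) :
    ‖(n : ℂ)⁻¹ * ∑ k ∈ Finset.range n, x ^ k‖ ≤ 1 := by
  rcases eq_or_ne n 0 with rfl | hn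
  · simp
  rw [norm_mul, norm_inv, Complex.norm_natCast]
  have hn' : (0 : ℝ) < n := by positivity
  rw [inv_mul_le_iff₀ hn', mul_one]
  calc _ ≤ ∑ k ∈ Finset.range n, ‖x ^ k‖ := norm_sum_le _ _
    _ ≤ ∑ k ∈ Finset.range n, 1 := Finset.sum_le_sum fun k _ => by
        rw [norm_pow]; exact pow_le_one₀ (norm_nonneg _) hx
    _ = n := by simp

/-- A discrete weight on the nonzero complex numbers is determined by its power sums
`∑ w(x) x⁻ᵏ` for `k ≥ 3`: the Cesàro means of the power sums, normalised at an element `x₀` of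
smallest absolute value in the support, converge to `w(x₀)`. -/
lemma eq_zero_of_powerSums {w : ℂ → ℂ} (h0 : w 0 = 0) (hw : ∀ x, w x ≠ 0 → 1 ≤ ‖w x‖)
    (hs : Summable fun x => ‖w x‖ * (‖x‖ ^ 3)⁻¹)
    (hk : ∀ k : ℕ, 3 ≤ k → ∑' x, w x * (x ^ k)⁻¹ = 0) : w = 0 := by
  by_contra hne
  obtain ⟨x₁, hx₁⟩ : ∃ x, w x ≠ 0 := by
    by_contra! h
    exact hne (funext h)
  have hnz (x : ℂ) (hx : w x ≠ 0) : 0 < ‖x‖ := norm_pos_iff.2 fun h => hx (h ▸ h0)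
  have hfin : {x | w x ≠ 0 ∧ ‖x‖ ≤ ‖x₁‖}.Finite := by
    have hpos : 0 < (‖x₁‖ ^ 3)⁻¹ := inv_pos.2 (pow_pos (hnz x₁ hx₁) 3)
    have h := hs.tendsto_cofinite_zero.eventually (gt_mem_nhds hpos)
    refine Set.Finite.subset h fun x hx => ?_
    rw [Set.mem_compl_iff, Set.mem_ofPred_eq, not_lt]
    calc (‖x₁‖ ^ 3)⁻¹ ≤ (‖x‖ ^ 3)⁻¹ := by
          have := hnz x hx.1
          have := hx.2
          gcongr
      _ = 1 * (‖x‖ ^ 3)⁻¹ := (one_mul _).symm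
      _ ≤ _ := by
          gcongr
          exact hw x hx.1
  obtain ⟨x₀, hx₀, hmin⟩ := hfin.exists_minimalFor (fun x => ‖x‖) _ ⟨x₁, hx₁, le_rfl⟩
  have hmin' (x : ℂ) (hx : w x ≠ 0) : ‖x₀‖ ≤ ‖x‖ := by
    rcases le_total ‖x‖ ‖x₁‖ with h | h
    · by_contra! hlt
      exact absurd (hmin ⟨hx, h⟩ hlt.le) (not_le.2 hlt)
    · exact hx₀.2.trans h
  have hx₀pos := hnz x₀ hx₀.1
  have hquot (x : ℂ) (hx : w x ≠ 0) : ‖x₀ / x‖ ≤ 1 := by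
    rw [norm_div]
    exact div_le_one_of_le₀ (hmin' x hx) (norm_nonneg _)
  set F : ℕ → ℂ → ℂ := fun n x =>
    (w x * (x₀ / x) ^ 3) * ((n : ℂ)⁻¹ * ∑ k ∈ Finset.range n, (x₀ / x) ^ k) with hF
  have hsum (k : ℕ) : Summable fun x => w x * (x ^ (k + 3))⁻¹ := by
    refine Summable.of_norm_bounded (hs.mul_left ((‖x₀‖ ^ k)⁻¹)) fun x => ?_
    by_cases hx : w x = 0
    · simp [hx]
    rw [norm_mul, norm_inv, norm_pow, pow_add, mul_inv]
    have := hmin' x hx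
    have h3 : (‖x‖ ^ k)⁻¹ ≤ (‖x₀‖ ^ k)⁻¹ := by gcongr
    have h4 : 0 ≤ ‖w x‖ * (‖x‖ ^ 3)⁻¹ := by positivity
    nlinarith [mul_le_mul_of_nonneg_right h3 h4]
  have hFsum (n : ℕ) : ∑' x, F n x = 0 := by
    have e : ∀ x, F n x = ∑ k ∈ Finset.range n,
        ((n : ℂ)⁻¹ * x₀ ^ (k + 3)) * (w x * (x ^ (k + 3))⁻¹) := by
      intro x
      simp only [hF, Finset.mul_sum]
      refine Finset.sum_congr rfl fun k _ => ?_
      rw [div_pow, div_pow, pow_add, pow_add, mul_inv, div_eq_mul_inv, div_eq_mul_inv]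
      ring
    simp only [e]
    rw [Summable.tsum_finsetSum fun k _ => (hsum k).mul_left _]
    refine Finset.sum_eq_zero fun k _ => ?_
    rw [tsum_mul_left, hk _ (by omega), mul_zero]
  have hlim := tendsto_tsum_of_dominated_convergence (𝓕 := atTop) (f := F)
    (g := fun x => (w x * (x₀ / x) ^ 3) * (if x₀ / x = 1 then 1 else 0))
    (bound := fun x => ‖x₀‖ ^ 3 * (‖w x‖ * (‖x‖ ^ 3)⁻¹)) (hs.mul_left _) ?_ ?_
  · simp only [hFsum] at hlim
    have h1 := tendsto_nhds_unique hlim tendsto_const_nhds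
    rw [tsum_eq_single x₀] at h1
    · have hx0 : x₀ ≠ 0 := norm_pos_iff.1 hx₀pos
      simp [hx0] at h1
      exact hx₀.1 h1
    · intro x hx
      by_cases hwx : w x = 0
      · simp [hwx]
      have hxz : x ≠ 0 := norm_pos_iff.1 (hnz x hwx)
      rw [if_neg, mul_zero]
      rw [div_eq_one_iff_eq hxz]
      exact fun h => hx h.symm
  · intro x
    by_cases hwx : w x = 0
    · simp [hF, hwx]
    exact (tendsto_cesaro_pow (hquot x hwx)).const_mul _
  · refine Eventually.of_forall fun n x => ?_
    by_cases hwx : w x = 0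
    · simp [hF, hwx]
    calc ‖F n x‖ ≤ ‖w x * (x₀ / x) ^ 3‖ * 1 := by
          rw [hF, norm_mul]
          gcongr
          exact norm_cesaro_pow_le (hquot x hwx) n
      _ = _ := by
          rw [mul_one, norm_mul, norm_pow, norm_div, div_pow]
          ring

lemma eq_of_powerSums {A B : Set ℂ} (hA0 : (0 : ℂ) ∉ A) (hB0 : (0 : ℂ) ∉ B)
    (hA : Summable fun x : A => (‖(x : ℂ)‖ ^ 3)⁻¹) (hB : Summable fun x : B => (‖(x : ℂ)‖ ^ 3)⁻¹)
    (h : ∀ k : ℕ, 3 ≤ k → ∑' x : A, ((x : ℂ) ^ k)⁻¹ = ∑' x : B, ((x : ℂ) ^ k)⁻¹) : A = B := by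
  classical
  set w : ℂ → ℂ := A.indicator 1 - B.indicator 1 with hw
  have hdecay {C : Set ℂ} (hC0 : (0 : ℂ) ∉ C) (hC : Summable fun x : C => (‖(x : ℂ)‖ ^ 3)⁻¹)
      (k : ℕ) (hk : 3 ≤ k) : Summable fun x : C => ((x : ℂ) ^ k)⁻¹ := by
    have hev : ∀ᶠ x : C in cofinite, ‖((x : ℂ) ^ k)⁻¹‖ ≤ (‖(x : ℂ)‖ ^ 3)⁻¹ := by
      filter_upwards [hC.tendsto_cofinite_zero.eventually (gt_mem_nhds one_pos)] with x hx
      have hx0 : 0 < ‖(x : ℂ)‖ := norm_pos_iff.2 fun h => hC0 (h ▸ x.2)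
      have hx1 : 1 ≤ ‖(x : ℂ)‖ := by
        by_contra! hlt
        have : ‖(x : ℂ)‖ ^ 3 ≤ 1 := pow_le_one₀ hx0.le hlt.le
        exact absurd hx (not_lt.2 (one_le_inv₀ (pow_pos hx0 3) |>.2 this))
      rw [norm_inv, norm_pow]
      gcongr
    exact Summable.of_norm_bounded_eventually hC hev
  have hind (C : Set ℂ) (f : ℂ → ℂ) (x : ℂ) :
      C.indicator 1 x * f x = C.indicator f x := by
    by_cases hx : x ∈ C <;> simp [hx]
  have hw0 : w = 0 := by
    refine eq_zero_of_powerSums ?_ ?_ ?_ ?_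
    · simp [hw, hA0, hB0]
    · intro x hx
      by_cases h1 : x ∈ A <;> by_cases h2 : x ∈ B <;> simp [hw, h1, h2] at hx ⊢
    · have e1 : Summable (A.indicator fun x : ℂ => (‖x‖ ^ 3)⁻¹) :=
        summable_subtype_iff_indicator.1 hA
      have e2 : Summable (B.indicator fun x : ℂ => (‖x‖ ^ 3)⁻¹) :=
        summable_subtype_iff_indicator.1 hB
      refine (e1.add e2).of_nonneg_of_le (fun x => by positivity) fun x => ?_
      have : 0 ≤ (‖x‖ ^ 3)⁻¹ := by positivity
      by_cases h1 : x ∈ A <;> by_cases h2 : x ∈ B <;> simp [hw, h1, h2]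
    · intro k hk
      have e1 : Summable (A.indicator fun x : ℂ => (x ^ k)⁻¹) :=
        summable_subtype_iff_indicator.1 (hdecay hA0 hA k hk)
      have e2 : Summable (B.indicator fun x : ℂ => (x ^ k)⁻¹) :=
        summable_subtype_iff_indicator.1 (hdecay hB0 hB k hk)
      simp only [hw, Pi.sub_apply, sub_mul, hind A fun x => (x ^ k)⁻¹,
        hind B fun x => (x ^ k)⁻¹]
      rw [e1.tsum_sub e2, ← tsum_subtype A fun x => (x ^ k)⁻¹, ← tsum_subtype B fun x => (x ^ k)⁻¹,
        h k hk, sub_self]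
  ext x
  have := congrFun hw0 x
  by_cases h1 : x ∈ A <;> by_cases h2 : x ∈ B <;> simp [hw, h1, h2] at this ⊢

end

noncomputable section

open EisensteinSeries

/-! ### Separation of points by modular functions -/

/-- The primitive elements `m τ + n` of the lattice `ℤ + ℤ τ` with `(m, n)` in a given residue class
modulo `N`. -/
def primitiveClass {N : ℕ} (v : Fin 2 → ZMod N) (τ : ℍ) : Set ℂ :=
  (fun u : Fin 2 → ℤ => (u 0 : ℂ) * τ + u 1) '' gammaSet N 1 v

lemma linear_injective (τ : ℍ) :
    Function.Injective fun u : Fin 2 → ℤ => (u 0 : ℂ) * τ + u 1 := by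
  intro u v h
  have him := congrArg Complex.im h
  have hre := congrArg Complex.re h
  simp at him hre
  have h0 : u 0 = v 0 := by
    rcases him with h | h
    · exact_mod_cast h
    · exact absurd h τ.im_ne_zero
  have h1 : u 1 = v 1 := by
    rw [h0] at hre
    simpa using hre
  ext i
  fin_cases i
  · exact h0
  · exact h1

lemma linear_ne_zero' (τ : ℍ) {u : Fin 2 → ℤ} (hu : u ≠ 0) : (u 0 : ℂ) * τ + u 1 ≠ 0 := by
  intro h
  exact hu (linear_injective τ (by simpa using h))

lemma ne_zero_of_mem_gammaSet {N : ℕ} {v : Fin 2 → ZMod N} {u : Fin 2 → ℤ}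
    (hu : u ∈ gammaSet N 1 v) : u ≠ 0 := by
  rintro rfl
  simpa using hu.2

lemma zero_notMem_primitiveClass {N : ℕ} (v : Fin 2 → ZMod N) (τ : ℍ) :
    (0 : ℂ) ∉ primitiveClass v τ := by
  rintro ⟨u, hu, h⟩
  exact linear_ne_zero' τ (ne_zero_of_mem_gammaSet hu) h

lemma summable_lattice (τ : ℍ) :
    Summable fun u : Fin 2 → ℤ => (‖(u 0 : ℂ) * τ + u 1‖ ^ 3)⁻¹ := by
  have := summable_norm_eisSummand (k := 3) le_rfl τ
  refine this.congr fun u => ?_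
  rw [eisSummand, norm_zpow, _root_.zpow_neg]
  norm_cast

/-- The bijection between a residue class of primitive vectors and the lattice elements. -/
def primitiveClassEquiv {N : ℕ} (v : Fin 2 → ZMod N) (τ : ℍ) :
    gammaSet N 1 v ≃ primitiveClass v τ :=
  Equiv.Set.image _ _ (linear_injective τ)

lemma summable_primitiveClass {N : ℕ} (v : Fin 2 → ZMod N) (τ : ℍ) :
    Summable fun x : primitiveClass v τ => (‖(x : ℂ)‖ ^ 3)⁻¹ := by
  rw [← (primitiveClassEquiv v τ).summable_iff]
  exact (summable_lattice τ).subtype _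

lemma eisensteinSeries_eq_tsum {N : ℕ} (v : Fin 2 → ZMod N) (k : ℕ) (τ : ℍ) :
    eisensteinSeries v k τ = ∑' x : primitiveClass v τ, ((x : ℂ) ^ k)⁻¹ := by
  rw [← (primitiveClassEquiv v τ).tsum_eq]
  refine tsum_congr fun u => ?_
  rw [eisSummand, _root_.zpow_neg, zpow_natCast]
  rfl

lemma smul_primitiveClass_eq {N : ℕ} {τ τ' : ℍ} {c : ℂ} (hc : c ≠ 0) (v : Fin 2 → ZMod N)
    (h : ∀ k : ℕ, 3 ≤ k → eisensteinSeries v k τ = c ^ k * eisensteinSeries v k τ') :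
    (fun x => c * x) '' primitiveClass v τ = primitiveClass v τ' := by
  let e : primitiveClass v τ ≃ (fun x => c * x) '' primitiveClass v τ :=
    Equiv.Set.image _ _ (mul_right_injective₀ hc)
  refine eq_of_powerSums ?_ (zero_notMem_primitiveClass v τ') ?_ (summable_primitiveClass v τ') ?_
  · rintro ⟨x, hx, h0⟩
    rcases mul_eq_zero.1 h0 with h | h
    · exact hc h
    · exact zero_notMem_primitiveClass v τ (h ▸ hx)
  · rw [← e.summable_iff]
    refine ((summable_primitiveClass v τ).mul_left (‖c‖ ^ 3)⁻¹).congr fun x => ?_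
    change _ = (‖c * (x : ℂ)‖ ^ 3)⁻¹
    rw [norm_mul, mul_pow, mul_inv]
  · intro k hk
    rw [← e.tsum_eq, ← eisensteinSeries_eq_tsum]
    have : ∀ x : primitiveClass v τ, (((e x : ℂ)) ^ k)⁻¹ = (c ^ k)⁻¹ * ((x : ℂ) ^ k)⁻¹ := by
      intro x
      change ((c * (x : ℂ)) ^ k)⁻¹ = _
      rw [mul_pow, mul_inv]
    simp only [this]
    rw [tsum_mul_left, ← eisensteinSeries_eq_tsum, h k hk, inv_mul_cancel_left₀ (pow_ne_zero _ hc)]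

/-- Two points of `ℍ` whose Eisenstein series of level `N` agree up to scaling are equivalent under
`Γ(N)`: the Eisenstein series determine the lattice with its level structure up to scaling. -/
lemma exists_Gamma_smul_of_eisensteinSeries {N : ℕ} {τ τ' : ℍ} {c : ℂ} (hc : c ≠ 0)
    (h : ∀ (v : Fin 2 → ZMod N) (k : ℕ), 3 ≤ k →
      eisensteinSeries v k τ = c ^ k * eisensteinSeries v k τ') :
    ∃ γ ∈ Gamma N, γ • τ' = τ := by
  have hcl := fun v => smul_primitiveClass_eq hc v (h v)
  have key : ∀ (a b : ℤ), Int.gcd a b = 1 → ∃ p q : ℤ, (p : ZMod N) = a ∧ (q : ZMod N) = b ∧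
      c * ((a : ℂ) * τ + b) = p * τ' + q := by
    intro a b hab
    have : c * ((a : ℂ) * τ + b) ∈ primitiveClass (N := N) (fun i => ((![a, b] i : ℤ) : ZMod N)) τ' := by
      rw [← hcl]
      exact ⟨_, ⟨![a, b], ⟨rfl, by simpa using hab⟩, rfl⟩, by simp⟩
    obtain ⟨u, ⟨hu, -⟩, hu'⟩ := this
    exact ⟨u 0, u 1, by simpa using congrFun hu 0, by simpa using congrFun hu 1, hu'.symm⟩
  have key' : ∀ (a b : ℤ), Int.gcd a b = 1 → ∃ p q : ℤ, (a : ℂ) * τ' + b = c * (p * τ + q) := by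
    intro a b hab
    have : (a : ℂ) * τ' + b ∈ (fun x => c * x) ''
        primitiveClass (N := N) (fun i => ((![a, b] i : ℤ) : ZMod N)) τ := by
      rw [hcl]
      exact ⟨![a, b], ⟨rfl, by simpa using hab⟩, by simp⟩
    obtain ⟨_, ⟨u, -, rfl⟩, hu'⟩ := this
    exact ⟨u 0, u 1, hu'.symm⟩
  obtain ⟨r, s, hr, hs, e1⟩ := key 1 0 (by simp)
  obtain ⟨p, q, hp, hq, e2⟩ := key 0 1 (by simp)
  obtain ⟨r', s', e3⟩ := key' 1 0 (by simp)
  obtain ⟨p', q', e4⟩ := key' 0 1 (by simp)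
  simp only [Int.cast_one, Int.cast_zero, one_mul, zero_mul, add_zero, zero_add, mul_one]
    at e1 e2 e3 e4 hr hs hp hq
  -- the two coordinate changes are inverse to each other
  have f1 : (![r' * r + s' * p, r' * s + s' * q] : Fin 2 → ℤ) = ![1, 0] := by
    apply linear_injective τ'
    simp only [cons_val_zero, cons_val_one]
    push_cast
    linear_combination -e3 - r' * e1 - s' * e2
  have f2 : (![p' * r + q' * p, p' * s + q' * q] : Fin 2 → ℤ) = ![0, 1] := by
    apply linear_injective τ'
    simp only [cons_val_zero, cons_val_one]
    push_cast
    linear_combination -e4 - p' * e1 - q' * e2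
  have g1 : r' * r + s' * p = 1 := by simpa using congrFun f1 0
  have g2 : r' * s + s' * q = 0 := by simpa using congrFun f1 1
  have g3 : p' * r + q' * p = 0 := by simpa using congrFun f2 0
  have g4 : p' * s + q' * q = 1 := by simpa using congrFun f2 1
  have hdet : (r' * q' - s' * p') * (r * q - s * p) = 1 := by
    calc _ = (r' * r + s' * p) * (p' * s + q' * q) - (r' * s + s' * q) * (p' * r + q' * p) := by ring
      _ = 1 := by rw [g1, g2, g3, g4]; norm_num
  have hden : (p : ℂ) * τ' + q ≠ 0 := by rw [← e2]; exact hc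
  have hτ : (τ : ℂ) = (r * τ' + s) / (p * τ' + q) := by
    rw [eq_div_iff hden, ← e1, ← e2, mul_comm]
  have him : 0 < ((r * q - s * p : ℤ) : ℝ) := by
    have h1 : τ.im = ((r * q - s * p : ℤ) : ℝ) * τ'.im / Complex.normSq (p * τ' + q) := by
      rw [← UpperHalfPlane.coe_im, hτ, Complex.div_im]
      simp
      ring
    by_contra! hle
    have : τ.im ≤ 0 := by
      rw [h1]
      exact div_nonpos_of_nonpos_of_nonneg (mul_nonpos_of_nonpos_of_nonneg hle τ'.im_pos.le)
        (Complex.normSq_nonneg _)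
    exact absurd τ.im_pos (not_lt.2 this)
  have hdet1 : r * q - s * p = 1 := by
    have hpos : 0 < r * q - s * p := by exact_mod_cast him
    rcases Int.eq_one_or_neg_one_of_mul_eq_one' hdet with h | h
    · exact h.2
    · omega
  obtain ⟨γ, hγ⟩ : ∃ γ : SL(2, ℤ), γ.1 = !![r, s; p, q] :=
    ⟨⟨!![r, s; p, q], by rw [det_fin_two_of]; exact hdet1⟩, rfl⟩
  have h00 : γ 0 0 = r := congrFun (congrFun hγ 0) 0
  have h01 : γ 0 1 = s := congrFun (congrFun hγ 0) 1
  have h10 : γ 1 0 = p := congrFun (congrFun hγ 1) 0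
  have h11 : γ 1 1 = q := congrFun (congrFun hγ 1) 1
  refine ⟨γ, ?_, ?_⟩
  · rw [Gamma_mem, h00, h01, h10, h11]
    exact ⟨hr, hs, hp, hq⟩
  · apply UpperHalfPlane.ext
    rw [coe_specialLinearGroup_apply, hτ, h00, h01, h10, h11]
    simp

open Topology in
/-- If `u` is a nonzero vector that gives a shortest element of the lattice `ℤ + ℤ τ`, then for
`N ≥ 3` it is the only shortest element in its class modulo `N`. Hence the Eisenstein series of
large weight that belongs to this class does not vanish at `τ`. -/
lemma exists_eisensteinSeries_ne_zero {N : ℕ} (hN : 3 ≤ N) (τ : ℍ) :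
    ∃ v : Fin 2 → ZMod N, ∀ᶠ k : ℕ in atTop, eisensteinSeries v k τ ≠ 0 := by
  set l : (Fin 2 → ℤ) → ℂ := fun u => (u 0 : ℂ) * τ + u 1 with hl
  have hlsmul (n : ℤ) (u : Fin 2 → ℤ) : l (n • u) = n * l u := by
    simp [hl]; ring
  have hladd (u w : Fin 2 → ℤ) : l (u + w) = l u + l w := by
    simp [hl]; ring
  have hpos (u : Fin 2 → ℤ) (hu : u ≠ 0) : 0 < ‖l u‖ := norm_pos_iff.2 (linear_ne_zero' τ hu)
  have he : (![1, 0] : Fin 2 → ℤ) ≠ 0 := fun h => by simpa using congrFun h 0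
  have hfin : {u : Fin 2 → ℤ | u ≠ 0 ∧ ‖l u‖ ≤ ‖l ![1, 0]‖}.Finite := by
    have h := (summable_lattice τ).tendsto_cofinite_zero.eventually
      (gt_mem_nhds (inv_pos.2 (pow_pos (hpos _ he) 3)))
    refine Set.Finite.subset h fun u hu => ?_
    rw [Set.mem_compl_iff, Set.mem_ofPred_eq, not_lt]
    have h1 := hpos u hu.1
    have h2 := hu.2
    gcongr
  obtain ⟨u, hu, hmin⟩ := hfin.exists_minimalFor (fun u => ‖l u‖) _ ⟨![1, 0], he, le_rfl⟩
  have hmin' (w : Fin 2 → ℤ) (hw : w ≠ 0) : ‖l u‖ ≤ ‖l w‖ := by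
    rcases le_total ‖l w‖ ‖l ![1, 0]‖ with h | h
    · by_contra! hlt
      exact absurd (hmin ⟨hw, h⟩ hlt.le) (not_le.2 hlt)
    · exact hu.2.trans h
  have hu0 := hpos u hu.1
  -- a shortest vector is primitive
  have hgcd : Int.gcd (u 0) (u 1) = 1 := by
    set g := Int.gcd (u 0) (u 1) with hg
    obtain ⟨a, ha⟩ : (g : ℤ) ∣ u 0 := Int.gcd_dvd_left ..
    obtain ⟨b, hb⟩ : (g : ℤ) ∣ u 1 := Int.gcd_dvd_right ..
    have hug : u = (g : ℤ) • ![a, b] := by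
      ext i; fin_cases i <;> simp [ha, hb]
    have hw : (![a, b] : Fin 2 → ℤ) ≠ 0 := by
      intro h
      rw [h, smul_zero] at hug
      exact hu.1 hug
    have h1 := hmin' _ hw
    have h2 : ‖l u‖ = g * ‖l ![a, b]‖ := by
      conv_lhs => rw [hug, hlsmul, norm_mul]
      simp
    have h3 : (g : ℝ) ≤ 1 := by
      have := hpos _ hw
      by_contra! h
      nlinarith
    have h4 : g ≤ 1 := by exact_mod_cast h3
    have h5 : g ≠ 0 := by
      intro h
      rw [h] at hug
      exact hu.1 (by simpa using hug)
    omega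
  set v : Fin 2 → ZMod N := fun i => (u i : ZMod N) with hv
  have humem : u ∈ gammaSet N 1 v := ⟨rfl, hgcd⟩
  refine ⟨v, ?_⟩
  have hfar (w : Fin 2 → ℤ) (hw : w ∈ gammaSet N 1 v) (hne : w ≠ u) : 2 * ‖l u‖ ≤ ‖l w‖ := by
    have hd (i : Fin 2) : (N : ℤ) ∣ w i - u i := by
      have h := congrFun hw.1 i
      rw [← ZMod.intCast_eq_intCast_iff_dvd_sub]
      exact h.symm
    choose x hx using hd
    have hwx : w = u + (N : ℤ) • x := by
      ext i
      have := hx i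
      simp only [Pi.add_apply, Pi.smul_apply, smul_eq_mul]
      linarith
    have hx0 : x ≠ 0 := by
      rintro rfl
      exact hne (by simpa using hwx)
    have h1 := hmin' x hx0
    have h2 : ‖(N : ℂ) * l x‖ ≤ ‖l w‖ + ‖l u‖ := by
      have : (N : ℂ) * l x = l w - l u := by
        rw [hwx, hladd, hlsmul]
        push_cast
        ring
      rw [this]
      exact norm_sub_le _ _
    rw [norm_mul, Complex.norm_natCast] at h2
    have h3 : (3 : ℝ) ≤ N := by exact_mod_cast hN
    nlinarith
  have hlim := tendsto_tsum_of_dominated_convergence (𝓕 := atTop)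
    (f := fun (k : ℕ) (w : gammaSet N 1 v) => (l u / l w) ^ k)
    (g := fun w => if (w : Fin 2 → ℤ) = u then 1 else 0)
    (bound := fun w => ‖l u‖ ^ 3 * (‖l w‖ ^ 3)⁻¹) (((summable_lattice τ).subtype _).mul_left _)
    ?_ ?_
  · rw [tsum_eq_single (⟨u, humem⟩ : gammaSet N 1 v)] at hlim
    · rw [if_pos rfl] at hlim
      filter_upwards [hlim.eventually_ne one_ne_zero] with k hk h0
      apply hk
      have : ∀ w : gammaSet N 1 v, (l u / l w) ^ k = (l u) ^ k * eisSummand k w τ := by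
        intro w
        rw [eisSummand, _root_.zpow_neg, zpow_natCast, div_pow, div_eq_mul_inv]
      simp only [this]
      rw [tsum_mul_left]
      change _ * eisensteinSeries v k τ = 0
      rw [h0, mul_zero]
    · intro w hw
      rw [if_neg]
      exact fun h => hw (Subtype.ext h)
  · intro w
    split_ifs with h
    · have : l u ≠ 0 := norm_pos_iff.1 hu0
      simp [h, this]
    · refine tendsto_pow_atTop_nhds_zero_of_norm_lt_one ?_
      have h2 := hfar w w.2 h
      rw [norm_div, div_lt_one (by linarith)]
      linarith
  · filter_upwards [eventually_ge_atTop 3] with k hk w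
    have hw := hmin' w (ne_zero_of_mem_gammaSet w.2)
    rw [norm_pow, ← div_eq_mul_inv, ← div_pow, norm_div]
    exact pow_le_pow_of_le_one (by positivity) (div_le_one_of_le₀ hw (norm_nonneg _)) hk

end

noncomputable section

open EisensteinSeries

local notation "Δ" => ModularForm.discriminant

/-- The modular functions of level `N ≥ 3` separate the orbits of `Γ(N)`: quotients of products of
Eisenstein series by powers of `Δ` show that the Eisenstein series of level `N` at `τ` and `τ'` agree
up to scaling. -/
lemma exists_Gamma_smul_of_forall_invFun {N : ℕ} (hN : 3 ≤ N) {τ τ' : ℍ}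
    (h : ∀ f ∈ invFun (Gamma N), f τ = f τ') : ∃ γ ∈ Gamma N, γ • τ' = τ := by
  have hN0 : N ≠ 0 := by omega
  have : NeZero N := ⟨hN0⟩
  have hmod {f : ℍ → ℂ} {k : ℤ} (m : ℕ) (hk : k = m * 12) (hf : IsModForm N k f) :
      f τ / Δ τ ^ m = f τ' / Δ τ' ^ m :=
    h _ ((hk ▸ hf : IsModForm N (m * 12) f).div_discriminant_pow_mem hN0)
  obtain ⟨v₀, hv₀⟩ := exists_eisensteinSeries_ne_zero hN τ'
  obtain ⟨K, hK⟩ := eventually_atTop.1 hv₀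
  -- an Eisenstein series `E` of weight `12 m + 1` that does not vanish at `τ'`, hence not at `τ`
  set m := K + 1 with hm
  set E : ℍ → ℂ := eisensteinSeries v₀ ((12 * m + 1 : ℕ) : ℤ) with hE
  have hEmod : IsModForm N ((12 * m + 1 : ℕ) : ℤ) E :=
    isModForm_eisensteinSeries (by push_cast; omega) v₀
  have hE' : E τ' ≠ 0 := hK (12 * m + 1) (by omega)
  have hΔ := ModularForm.discriminant_ne_zero τ
  have hΔ' := ModularForm.discriminant_ne_zero τ'
  have hEτ : E τ ≠ 0 := by
    intro h0
    have := hmod (12 * m + 1) (by push_cast; ring) (hEmod.pow 12)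
    simp only [Pi.pow_apply, h0] at this
    rw [zero_pow (by norm_num), zero_div, eq_comm, div_eq_zero_iff] at this
    rcases this with h | h
    · exact hE' (pow_eq_zero_iff (by norm_num) |>.1 h)
    · exact hΔ' (pow_eq_zero_iff (by norm_num) |>.1 h)
  -- `E_k * E ^ (11 k)` has weight `12 (k + 11 k m)`
  set c : ℂ := (E τ' / E τ) ^ 11 * (Δ τ / Δ τ') ^ (1 + 11 * m) with hc
  refine exists_Gamma_smul_of_eisensteinSeries (c := c)
    (mul_ne_zero (pow_ne_zero _ (div_ne_zero hE' hEτ)) (pow_ne_zero _ (div_ne_zero hΔ hΔ')))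
    fun v k hk => ?_
  have := hmod (k + 11 * k * m) (by push_cast; ring)
    ((isModForm_eisensteinSeries (k := k) (by exact_mod_cast hk) v).mul (hEmod.pow (11 * k)))
  simp only [Pi.mul_apply, Pi.pow_apply] at this
  rw [div_eq_div_iff (pow_ne_zero _ hΔ) (pow_ne_zero _ hΔ')] at this
  rw [hc, mul_pow, ← pow_mul, ← pow_mul, div_pow, div_pow,
    show (1 + 11 * m) * k = k + 11 * k * m by ring]
  field_simp
  linear_combination this

/-- The product of the finitely many conjugates of a modular function `f` under `Γ` is a
`Γ`-invariant modular function that vanishes exactly on the `Γ`-orbits of the zeros of `f`. -/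
lemma exists_norm {f : ℍ → ℂ} (hf : f ∈ congFun) (Γ : Subgroup SL(2, ℤ)) :
    ∃ G ∈ invFun Γ, ∀ τ, G τ = 0 ↔ ∃ γ ∈ Γ, f (γ • τ) = 0 := by
  obtain ⟨P, -, hmap⟩ := exists_normPoly hf Γ
  refine ⟨P.coeff 0, (P.coeff 0).2, fun τ => ?_⟩
  have h0 : ((P.coeff 0 : invFun Γ) : ℍ → ℂ) = ∏ h ∈ (finite_orbit hf Γ).toFinset, -h := by
    have := congrArg (Polynomial.eval 0) hmap
    rw [← Polynomial.coeff_zero_eq_eval_zero, Polynomial.coeff_map, Polynomial.eval_prod] at this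
    simpa using this
  rw [h0, Finset.prod_apply, Finset.prod_eq_zero_iff]
  constructor
  · rintro ⟨h, hh, h0⟩
    obtain ⟨γ, hγ, rfl⟩ : ∃ γ ∈ Γ, h = fun τ => f (γ • τ) := by simpa using hh
    exact ⟨γ, hγ, by simpa using h0⟩
  · rintro ⟨γ, hγ, h0⟩
    exact ⟨fun τ => f (γ • τ), by simpa using ⟨γ, hγ, rfl⟩, by simpa using h0⟩

/-- Finitely many elements of `Γ` represent its classes modulo `Γ(N)`. -/
lemma exists_finset_reps {N : ℕ} (hN : N ≠ 0) (Γ : Subgroup SL(2, ℤ)) :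
    ∃ S : Finset SL(2, ℤ), (∀ γ ∈ S, γ ∈ Γ) ∧ ∀ γ ∈ Γ, ∃ δ ∈ S, ∃ ε ∈ Gamma N, γ = ε * δ := by
  classical
  have : NeZero N := ⟨hN⟩
  choose! pre hpre using fun (q : SpecialLinearGroup (Fin 2) (ZMod N))
    (hq : ∃ γ ∈ Γ, SpecialLinearGroup.map (Int.castRingHom (ZMod N)) γ = q) => hq
  refine ⟨(Set.toFinite {q : SpecialLinearGroup (Fin 2) (ZMod N) |
    ∃ γ ∈ Γ, SpecialLinearGroup.map (Int.castRingHom (ZMod N)) γ = q}).toFinset.image pre, ?_, ?_⟩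
  · intro γ hγ
    obtain ⟨q, hq, rfl⟩ := Finset.mem_image.1 hγ
    exact (hpre q (by simpa using hq)).1
  · intro γ hγ
    have hq := hpre (SpecialLinearGroup.map (Int.castRingHom (ZMod N)) γ) ⟨γ, hγ, rfl⟩
    refine ⟨_, Finset.mem_image.2 ⟨_, by simpa using ⟨γ, hγ, rfl⟩, rfl⟩,
      γ * (pre (SpecialLinearGroup.map (Int.castRingHom (ZMod N)) γ))⁻¹, ?_, by group⟩
    rw [Gamma_mem', map_mul, map_inv, hq.2, mul_inv_cancel]

/-- The regular functions on `Γ \ ℍ` separate points: functions of high level separate a point `τ`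
from each of the finitely many classes of points of the orbit of `τ'`; combining them gives a
function that is `0` at `τ` and `1` on the orbit of `τ'`, and one takes its norm. -/
lemma exists_isRegularFunction_separating {Γ : Subgroup SL(2, ℤ)} (hΓ : IsCongruenceSubgroup Γ)
    {x y : ModularCurve Γ} (hxy : x ≠ y) :
    ∃ f : ModularCurve Γ → ℂ, IsRegularFunction f ∧ f x = 0 ∧ f y ≠ 0 := by
  obtain ⟨τ, rfl⟩ := quotMap_surjective Γ x
  obtain ⟨τ', rfl⟩ := quotMap_surjective Γ y
  obtain ⟨N, hN, hle⟩ := hΓ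
  have hN3 : 3 * N ≠ 0 := by omega
  have hle3 : Gamma (3 * N) ≤ Γ := (Gamma_le_of_dvd (dvd_mul_left N 3)).trans hle
  have hsep : ∀ γ ∈ Γ, ∃ f ∈ invFun (Gamma (3 * N)), f τ = 0 ∧ f (γ • τ') = 1 := by
    intro γ hγ
    have : ∃ f ∈ invFun (Gamma (3 * N)), f τ ≠ f (γ • τ') := by
      by_contra! hall
      obtain ⟨δ, hδ, h⟩ := exists_Gamma_smul_of_forall_invFun (by omega) hall
      exact hxy (quotMap_eq_iff.2 ⟨δ * γ, mul_mem (hle3 hδ) hγ, by rw [mul_smul, h]⟩)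
    obtain ⟨f, hf, hne⟩ := this
    have hne' : f (γ • τ') - f τ ≠ 0 := sub_ne_zero.2 hne.symm
    refine ⟨algebraMap ℂ _ (f (γ • τ') - f τ)⁻¹ * (f - algebraMap ℂ _ (f τ)),
      mul_mem (algebraMap_mem _ _) (sub_mem hf (algebraMap_mem _ _)), ?_, ?_⟩
    · simp
    · exact inv_mul_cancel₀ hne'
  choose! f hf hf0 hf1 using hsep
  obtain ⟨S, hS, hrep⟩ := exists_finset_reps hN3 Γ
  -- `F` vanishes at `τ` and takes the value `1` on the orbit of `τ'`
  set F : ℍ → ℂ := 1 - ∏ δ ∈ S, (1 - f δ) with hF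
  have hFmem : F ∈ invFun (Gamma (3 * N)) :=
    sub_mem (one_mem _) (prod_mem fun δ hδ => sub_mem (one_mem _) (hf δ (hS δ hδ)))
  have hF0 : F τ = 0 := by
    simp only [hF, Pi.sub_apply, Pi.one_apply, Finset.prod_apply]
    rw [Finset.prod_eq_one, sub_self]
    intro δ hδ
    rw [hf0 δ (hS δ hδ), sub_zero]
  have hF1 : ∀ γ ∈ Γ, F (γ • τ') = 1 := by
    intro γ hγ
    obtain ⟨δ, hδ, ε, hε, rfl⟩ := hrep γ hγ
    rw [mul_smul, hFmem.2 ε hε]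
    simp only [hF, Pi.sub_apply, Pi.one_apply, Finset.prod_apply]
    rw [Finset.prod_eq_zero hδ, sub_zero]
    rw [hf1 δ (hS δ hδ), sub_self]
  obtain ⟨G, hG, hG0⟩ := exists_norm hFmem.1 Γ
  obtain ⟨g, hg, hgG⟩ := exists_isRegularFunction hG
  refine ⟨g, hg, ?_, ?_⟩
  · rw [hgG, hG0]
    exact ⟨1, one_mem _, by rwa [one_smul]⟩
  · rw [hgG, Ne, hG0]
    rintro ⟨γ, hγ, h⟩
    rw [hF1 γ hγ] at h
    exact one_ne_zero h

end

noncomputable section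

/-! ### The Zariski topology -/

variable {ι : Type*} {Γ : ι → Subgroup SL(2, ℤ)}

/-- The regular functions on a product of modular curves that only depend on the coordinates with
index in `I`. -/
def coordRingOn (Γ : ι → Subgroup SL(2, ℤ)) (I : Set ι) : Subalgebra ℂ (ModularProduct Γ → ℂ) :=
  Algebra.adjoin ℂ {F | ∃ i ∈ I, ∃ f : ModularCurve (Γ i) → ℂ,
    IsRegularFunction f ∧ F = fun x => f (x i)}

lemma coordRingOn_univ : coordRingOn Γ Set.univ = coordRing Γ := by
  simp [coordRingOn, coordRing]

lemma coordRingOn_mono {I J : Set ι} (h : I ⊆ J) : coordRingOn Γ I ≤ coordRingOn Γ J :=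
  Algebra.adjoin_mono fun _ ⟨i, hi, hf⟩ => ⟨i, h hi, hf⟩

lemma coordRingOn_le (I : Set ι) : coordRingOn Γ I ≤ coordRing Γ := by
  rw [← coordRingOn_univ]
  exact coordRingOn_mono (Set.subset_univ I)

lemma coord_mem {I : Set ι} {i : ι} (hi : i ∈ I) {f : ModularCurve (Γ i) → ℂ}
    (hf : IsRegularFunction f) : (fun x : ModularProduct Γ => f (x i)) ∈ coordRingOn Γ I :=
  Algebra.subset_adjoin ⟨i, hi, f, hf, rfl⟩

/-- Pulling back functions along a map, as a homomorphism of algebras. -/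
def pullback {X Y : Type*} (φ : Y → X) : (X → ℂ) →ₐ[ℂ] (Y → ℂ) where
  toFun F := fun y => F (φ y)
  map_one' := rfl
  map_mul' _ _ := rfl
  map_zero' := rfl
  map_add' _ _ := rfl
  commutes' _ := rfl

@[simp] lemma pullback_apply {X Y : Type*} (φ : Y → X) (F : X → ℂ) (y : Y) :
    pullback φ F y = F (φ y) := rfl

lemma pullback_mem {Y : Type*} {φ : Y → ModularProduct Γ} {I : Set ι} {R : Subalgebra ℂ (Y → ℂ)}
    (h : ∀ i ∈ I, ∀ f : ModularCurve (Γ i) → ℂ, IsRegularFunction f → (fun y => f (φ y i)) ∈ R)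
    {F : ModularProduct Γ → ℂ} (hF : F ∈ coordRingOn Γ I) : pullback φ F ∈ R := by
  have : coordRingOn Γ I ≤ R.comap (pullback φ) := by
    refine Algebra.adjoin_le ?_
    rintro _ ⟨i, hi, f, hf, rfl⟩
    exact h i hi f hf
  exact this hF

lemma isClosed_iff_exists_zeroSet {Z : Set (ModularProduct Γ)} :
    IsClosed Z ↔ ∃ A : Set (ModularProduct Γ → ℂ), A ⊆ (coordRing Γ : Set _) ∧ Z = zeroSet A := by
  rw [← isOpen_compl_iff]
  change Zᶜᶜ ∈ _ ↔ _
  rw [compl_compl]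
  rfl

lemma isClosed_zero {F : ModularProduct Γ → ℂ} (hF : F ∈ coordRing Γ) : IsClosed {x | F x = 0} :=
  isClosed_iff_exists_zeroSet.2 ⟨{F}, by simpa using hF, by simp [zeroSet]⟩

lemma isClosed_iff_exists_ne_zero {Z : Set (ModularProduct Γ)} :
    IsClosed Z ↔ ∀ x ∉ Z, ∃ F ∈ coordRing Γ, (∀ z ∈ Z, F z = 0) ∧ F x ≠ 0 := by
  constructor
  · intro h x hx
    obtain ⟨A, hA, rfl⟩ := isClosed_iff_exists_zeroSet.1 h
    simp only [zeroSet, Set.mem_ofPred_eq, not_forall] at hx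
    obtain ⟨F, hF, hFx⟩ := hx
    exact ⟨F, hA hF, fun z hz => hz F hF, hFx⟩
  · intro h
    refine isClosed_iff_exists_zeroSet.2
      ⟨{F | F ∈ coordRing Γ ∧ ∀ z ∈ Z, F z = 0}, fun F hF => hF.1, ?_⟩
    ext x
    refine ⟨fun hx F hF => hF.2 x hx, fun hx => ?_⟩
    by_contra hxZ
    obtain ⟨F, hF, hFZ, hFx⟩ := h x hxZ
    exact hFx (hx F ⟨hF, hFZ⟩)

lemma continuous_iff_isClosed_zero {Y : Type*} [TopologicalSpace Y] {φ : Y → ModularProduct Γ} :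
    Continuous φ ↔ ∀ F ∈ coordRing Γ, IsClosed {y | F (φ y) = 0} := by
  constructor
  · exact fun h F hF => (isClosed_zero hF).preimage h
  · intro h
    rw [continuous_iff_isClosed]
    intro Z hZ
    obtain ⟨A, hA, rfl⟩ := isClosed_iff_exists_zeroSet.1 hZ
    have : φ ⁻¹' zeroSet A = ⋂ F ∈ A, {y | F (φ y) = 0} := by
      ext y
      simp [zeroSet]
    rw [this]
    exact isClosed_biInter fun F hF => h F (hA hF)

lemma continuous_of_coord {ι' : Type*} {Γ' : ι' → Subgroup SL(2, ℤ)}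
    {φ : ModularProduct Γ' → ModularProduct Γ}
    (h : ∀ i, ∀ f : ModularCurve (Γ i) → ℂ, IsRegularFunction f →
      (fun y => f (φ y i)) ∈ coordRing Γ') : Continuous φ :=
  continuous_iff_isClosed_zero.2 fun _ hF => isClosed_zero
    (pullback_mem (I := Set.univ) (fun i _ => h i) (by rwa [coordRingOn_univ]))

lemma coord_mem_coordRing {i : ι} {f : ModularCurve (Γ i) → ℂ}
    (hf : IsRegularFunction f) : (fun x : ModularProduct Γ => f (x i)) ∈ coordRing Γ :=
  Algebra.subset_adjoin ⟨i, f, hf, rfl⟩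

lemma continuous_proj (I : Set ι) : Continuous (proj (Γ := Γ) I) :=
  continuous_of_coord fun _ _ hf => coord_mem_coordRing hf

lemma pullback_proj_mem {I : Set ι} {F : ModularProduct (fun i : I => Γ i) → ℂ}
    (hF : F ∈ coordRing (fun i : I => Γ i)) : pullback (proj I) F ∈ coordRingOn Γ I := by
  rw [← coordRingOn_univ] at hF
  exact pullback_mem (fun i _ f hf => coord_mem i.2 hf) hF

lemma exists_pullback_proj {I : Set ι} {F : ModularProduct Γ → ℂ} (hF : F ∈ coordRingOn Γ I) :
    ∃ G ∈ coordRing (fun i : I => Γ i), F = pullback (proj I) G := by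
  have : coordRingOn Γ I ≤ (coordRing fun i : I => Γ i).map (pullback (proj (Γ := Γ) I)) := by
    refine Algebra.adjoin_le ?_
    rintro _ ⟨i, hi, f, hf, rfl⟩
    exact ⟨fun y => f (y ⟨i, hi⟩), coord_mem_coordRing (i := (⟨i, hi⟩ : I)) hf, rfl⟩
  obtain ⟨G, hG, h⟩ := this hF
  exact ⟨G, hG, h.symm⟩

lemma eq_zero_or_eq_zero_of_isIrreducible {S : Set (ModularProduct Γ)} (hS : IsIrreducible S)
    {F G : ModularProduct Γ → ℂ} (hF : F ∈ coordRing Γ) (hG : G ∈ coordRing Γ)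
    (h : ∀ x ∈ S, F x * G x = 0) : (∀ x ∈ S, F x = 0) ∨ ∀ x ∈ S, G x = 0 :=
  isPreirreducible_iff_isClosed_union_isClosed.1 hS.isPreirreducible _ _ (isClosed_zero hF)
    (isClosed_zero hG) fun x hx => mul_eq_zero.1 (h x hx)

/-! ### Irreducible sets -/

open Function in
/-- A map on a finite product of irreducible spaces that is continuous in each variable has an
irreducible image. -/
lemma isPreirreducible_range_of_separately_continuous {κ : Type*} [Finite κ] {Y : κ → Type*}
    [DecidableEq κ] [∀ k, TopologicalSpace (Y k)] [∀ k, PreirreducibleSpace (Y k)] {X : Type*}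
    [TopologicalSpace X]
    {Φ : (∀ k, Y k) → X} (hΦ : ∀ k t, Continuous fun a : Y k => Φ (update t k a)) :
    IsPreirreducible (Set.range Φ) := by
  rw [isPreirreducible_iff_isClosed_union_isClosed]
  intro F₁ F₂ hF₁ hF₂ hcov
  have key (s : Finset κ) : ∀ t : ∀ k, Y k, (∀ y : ∀ k, Y k, (∀ k ∉ s, y k = t k) → Φ y ∈ F₁) ∨
      ∀ y : ∀ k, Y k, (∀ k ∉ s, y k = t k) → Φ y ∈ F₂ := by
    induction s using Finset.induction_on with
    | empty =>
      intro t
      rcases hcov ⟨t, rfl⟩ with h | h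
      · exact .inl fun y hy => by rwa [funext fun k => hy k (Finset.notMem_empty k)]
      · exact .inr fun y hy => by rwa [funext fun k => hy k (Finset.notMem_empty k)]
    | insert k s hk ih =>
      intro t
      let A (F : Set X) : Set (Y k) :=
        {a | ∀ y : ∀ k, Y k, (∀ l ∉ s, y l = update t k a l) → Φ y ∈ F}
      have hA (F : Set X) (hF : IsClosed F) : IsClosed (A F) := by
        have : A F = ⋂ (z : ∀ k, Y k) (_ : ∀ l ∉ insert k s, z l = t l),
            (fun a => Φ (update z k a)) ⁻¹' F := by
          ext a
          simp only [A, Set.mem_ofPred_eq, Set.mem_iInter, Set.mem_preimage]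
          constructor
          · intro h z hz
            refine h _ fun l hl => ?_
            by_cases hlk : l = k
            · subst hlk; simp
            · rw [update_of_ne hlk, update_of_ne hlk]
              exact hz l (by simp [hlk, hl])
          · intro h y hy
            have := h y fun l hl => ?_
            · rwa [show update y k a = y from ?_] at this
              rw [show a = y k from ?_, update_eq_self]
              simpa using (hy k hk).symm
            · rw [Finset.mem_insert, not_or] at hl
              rw [hy l hl.2, update_of_ne hl.1]
        rw [this]
        exact isClosed_biInter fun z _ => hF.preimage (hΦ k z)
      have hU : (Set.univ : Set (Y k)) ⊆ A F₁ ∪ A F₂ := fun a _ => ih (update t k a)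
      have := isPreirreducible_iff_isClosed_union_isClosed.1
        (PreirreducibleSpace.isPreirreducible_univ (X := Y k)) _ _ (hA F₁ hF₁) (hA F₂ hF₂) hU
      refine this.imp ?_ ?_ <;>
      · intro h y hy
        refine h (Set.mem_univ (y k)) y fun l hl => ?_
        by_cases hlk : l = k
        · subst hlk; simp
        · rw [update_of_ne hlk]
          exact hy l (by simp [hlk, hl])
  have := Fintype.ofFinite κ
  by_cases hne : Nonempty (∀ k, Y k)
  · obtain ⟨t⟩ := hne
    refine (key Finset.univ t).imp ?_ ?_ <;>
    · rintro h _ ⟨y, rfl⟩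
      exact h y fun k hk => absurd (Finset.mem_univ k) hk
  · left
    rintro _ ⟨y, rfl⟩
    exact absurd ⟨y⟩ hne

/-- The upper half plane with the topology whose closed sets are the zero sets of sets of
holomorphic functions. -/
def AnalyticHalfPlane : Type := ℍ

instance : TopologicalSpace AnalyticHalfPlane :=
  TopologicalSpace.ofClosed
    {Z | ∃ A : Set (ℍ → ℂ), (∀ f ∈ A, MDifferentiable 𝓘(ℂ) 𝓘(ℂ) f) ∧
      Z = {τ : ℍ | ∀ f ∈ A, f τ = 0}}
    ⟨{1}, by rintro _ rfl; exact mdifferentiable_const, by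
      ext x
      exact ⟨fun h => h.elim, fun h => absurd (h 1 rfl) one_ne_zero⟩⟩
    (by
      intro T hT
      refine ⟨{f | MDifferentiable 𝓘(ℂ) 𝓘(ℂ) f ∧ ∃ Z ∈ T, ∀ x ∈ Z, f x = 0},
        fun f hf => hf.1, ?_⟩
      ext x
      constructor
      · rintro hx f ⟨-, Z, hZ, hf⟩
        exact hf x (hx Z hZ)
      · intro hx Z hZ
        obtain ⟨A, hA, rfl⟩ := hT hZ
        exact fun f hf => hx f ⟨hA f hf, _, hZ, fun y hy => hy f hf⟩)
    (by
      rintro _ ⟨A, hA, rfl⟩ _ ⟨B, hB, rfl⟩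
      refine ⟨{h | ∃ f ∈ A, ∃ g ∈ B, h = f * g}, ?_, ?_⟩
      · rintro _ ⟨f, hf, g, hg, rfl⟩
        exact (hA f hf).mul (hB g hg)
      · ext x
        constructor
        · rintro (hx | hx) _ ⟨f, hf, g, hg, rfl⟩
          · exact mul_eq_zero.2 (.inl (hx f hf))
          · exact mul_eq_zero.2 (.inr (hx g hg))
        · intro hx
          by_contra hn
          have h1 : ¬ ∀ f ∈ A, f x = 0 := fun h => hn (.inl h)
          have h2 : ¬ ∀ g ∈ B, g x = 0 := fun h => hn (.inr h)
          push Not at h1 h2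
          obtain ⟨f, hf, hfx⟩ := h1
          obtain ⟨g, hg, hgx⟩ := h2
          exact mul_ne_zero hfx hgx (hx _ ⟨f, hf, g, hg, rfl⟩))

lemma AnalyticHalfPlane.isClosed_iff {Z : Set AnalyticHalfPlane} :
    IsClosed Z ↔ ∃ A : Set (ℍ → ℂ), (∀ f ∈ A, MDifferentiable 𝓘(ℂ) 𝓘(ℂ) f) ∧
      Z = {τ : ℍ | ∀ f ∈ A, f τ = 0} := by
  rw [← isOpen_compl_iff]
  change Zᶜᶜ ∈ _ ↔ _
  rw [compl_compl]
  rfl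

instance : PreirreducibleSpace AnalyticHalfPlane where
  isPreirreducible_univ := by
    rw [isPreirreducible_iff_isClosed_union_isClosed]
    intro Z₁ Z₂ h₁ h₂ hcov
    obtain ⟨A, hA, rfl⟩ := AnalyticHalfPlane.isClosed_iff.1 h₁
    obtain ⟨B, hB, rfl⟩ := AnalyticHalfPlane.isClosed_iff.1 h₂
    by_contra! hn
    obtain ⟨x, -, hx⟩ := Set.not_subset.1 hn.1
    obtain ⟨y, -, hy⟩ := Set.not_subset.1 hn.2
    replace hx : ¬ ∀ f ∈ A, f x = 0 := hx
    replace hy : ¬ ∀ g ∈ B, g y = 0 := hy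
    push Not at hx hy
    obtain ⟨f, hf, hfx⟩ := hx
    obtain ⟨g, hg, hgy⟩ := hy
    have hfg : f * g = 0 := by
      ext τ
      rcases hcov (Set.mem_univ (τ : AnalyticHalfPlane)) with h | h
      · exact mul_eq_zero.2 (.inl (h f hf))
      · exact mul_eq_zero.2 (.inr (h g hg))
    rcases (UpperHalfPlane.mul_eq_zero_iff (hA f hf) (hB g hg)).1 hfg with h | h
    · exact hfx (congrFun h x)
    · exact hgy (congrFun h y)

lemma continuous_of_forall_congFun {φ : ℍ → ModularProduct Γ}
    (h : ∀ i, ∀ f : ModularCurve (Γ i) → ℂ, IsRegularFunction f →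
      (fun τ => f (φ τ i)) ∈ congFun) : Continuous (fun τ : AnalyticHalfPlane => φ τ) := by
  refine continuous_iff_isClosed_zero.2 fun F hF => ?_
  rw [← coordRingOn_univ] at hF
  have := pullback_mem (fun i _ => h i) hF
  exact AnalyticHalfPlane.isClosed_iff.2 ⟨{pullback φ F}, by rintro _ rfl; exact this.1.1, by
    ext τ; simp; rfl⟩

end

noncomputable section

/-! ### Integrality -/

open Polynomial in
/-- A nonzero element `F` of a domain `R` that is integral over a subring `B` divides a nonzero
element of `B`: the constant term of an equation of minimal degree. -/
lemma exists_mul_mem_of_isIntegral {Y : Type*} {B R : Subalgebra ℂ (Y → ℂ)} (hBR : B ≤ R)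
    (hR : ∀ F ∈ R, ∀ G ∈ R, F * G = 0 → F = 0 ∨ G = 0) {F : Y → ℂ} (hF : F ∈ R) (hF0 : F ≠ 0)
    (hint : IsIntegral B F) : ∃ H ∈ R, F * H ∈ B ∧ F * H ≠ 0 := by
  have haeval (p : B[X]) : aeval F p ∈ R := by
    rw [aeval_eq_sum_range]
    refine sum_mem fun i _ => ?_
    rw [Algebra.smul_def]
    exact mul_mem (hBR (p.coeff i).2) (pow_mem hF i)
  have key : ∀ n, ∀ p : B[X], p.natDegree ≤ n → p ≠ 0 → aeval F p = 0 →
      ∃ H ∈ R, F * H ∈ B ∧ F * H ≠ 0 := by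
    intro n
    induction n with
    | zero =>
      intro p hp hp0 hpF
      rw [natDegree_eq_zero.1 (Nat.le_zero.1 hp) |>.choose_spec.symm] at hp0 hpF
      rw [aeval_C] at hpF
      refine absurd ?_ hp0
      rw [Subtype.ext (a1 := Exists.choose _) (a2 := (0 : B)) hpF, C_0]
    | succ n ih =>
      intro p hp hp0 hpF
      rw [← p.divX_mul_X_add, map_add, map_mul, aeval_X, aeval_C] at hpF
      by_cases h0 : p.coeff 0 = 0
      · rw [h0, map_zero, add_zero] at hpF
        refine ih p.divX (by rw [natDegree_divX_eq_natDegree_tsub_one]; omega) ?_ ?_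
        · intro h
          apply hp0
          rw [← p.divX_mul_X_add, h, h0]
          simp
        · exact (hR _ (haeval _) _ hF hpF).resolve_right hF0
      · have heq : F * -aeval F p.divX = (p.coeff 0 : Y → ℂ) := by
          rw [mul_neg, mul_comm]
          exact neg_eq_of_add_eq_zero_right hpF
        refine ⟨-aeval F p.divX, neg_mem (haeval _), heq ▸ (p.coeff 0).2, ?_⟩
        rw [heq]
        exact fun h => h0 (Subtype.ext h)
  obtain ⟨p, hp, hpF⟩ := hint
  by_cases hB : Nontrivial B
  · exact key _ p le_rfl hp.ne_zero hpF
  · refine absurd ?_ hF0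
    rw [not_nontrivial_iff_subsingleton] at hB
    have := congrArg Subtype.val (Subsingleton.elim (1 : B) 0)
    exact eq_zero_of_zero_eq_one this.symm F

/-- If an algebra of functions contains the pull-backs along `σ` of all modular functions of level
one, then the pull-backs of modular functions of higher level are integral over it. -/
lemma isIntegral_comp {Y : Type*} {B : Subalgebra ℂ (Y → ℂ)} {σ : Y → ℍ}
    (h : ∀ f ∈ invFun ⊤, (fun y => f (σ y)) ∈ B) {f : ℍ → ℂ} (hf : f ∈ congFun) :
    IsIntegral B (fun y => f (σ y)) := by
  have := isIntegral_invFun hf ⊤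
  exact this.map_of_comp_eq
    (((pullback σ).comp (invFun ⊤).val).codRestrict B fun f => h f f.2).toRingHom
    (pullback σ).toRingHom rfl

/-! ### Hecke correspondences are closed -/

variable {ι : Type*} {Γ : ι → Subgroup SL(2, ℤ)}

/-- The condition on the coordinates with index in `T` that they are the classes of `g i • τ` for
a common point `τ` of `ℍ`. -/
def heckeOn (Γ : ι → Subgroup SL(2, ℤ)) (T : Set ι) (g : ι → GL(2, ℚ)⁺) :
    Set (ModularProduct Γ) :=
  {x | ∃ τ : ℍ, ∀ i ∈ T, x i = quotMap (Γ i) (g i • τ)}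

lemma IsRegularFunction.comp_mem_congFun {Γ : Subgroup SL(2, ℤ)}
    (hΓ : IsCongruenceSubgroup Γ) {f : ModularCurve Γ → ℂ} (hf : IsRegularFunction f)
    (g : GL(2, ℚ)⁺) : (fun τ => f (quotMap Γ (g • τ))) ∈ congFun :=
  comp_smul_mem_congFun (hf.mem_congFun hΓ) g

open Polynomial in
lemma sum_coeff_eq_prod {Γ : Subgroup SL(2, ℤ)} {P : (invFun Γ)[X]} {S : Finset (ℍ → ℂ)}
    (hP : P.map (algebraMap (invFun Γ) (ℍ → ℂ)) = ∏ h ∈ S, (X - C h)) (τ : ℍ) (a : ℂ) :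
    ∑ k ∈ Finset.range (P.natDegree + 1), (P.coeff k : ℍ → ℂ) τ * a ^ k = ∏ h ∈ S, (a - h τ) := by
  have := congrArg (fun q : (ℍ → ℂ)[X] => (q.map (Pi.evalRingHom _ τ)).eval a) hP
  simp only [Polynomial.map_map] at this
  rw [eval_map, eval₂_eq_sum_range] at this
  rw [Polynomial.map_prod, eval_prod] at this
  simp only [Polynomial.map_sub, map_X, map_C, eval_sub, eval_X, eval_C] at this
  exact this

/-- Functions that vanish on a Hecke correspondence separate it from each point outside. With
`τ` the coordinate of index `i₀`, the Hecke correspondence is given by `x i = π (k i • τ)`; a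
function `h` of all coordinates satisfies a polynomial equation on it, whose coefficients only
depend on the class of `τ`. One chooses `h` to vanish at the given point and to be `1` at the points
of the Hecke correspondence with the same coordinate `i₀`. -/
lemma exists_separating_heckeOn [Finite ι] (hΓ : ∀ i, IsCongruenceSubgroup (Γ i)) {T : Set ι}
    {g : ι → GL(2, ℚ)⁺} {x : ModularProduct Γ} (hx : x ∉ heckeOn Γ T g) :
    ∃ F ∈ coordRingOn Γ T, (∀ y ∈ heckeOn Γ T g, F y = 0) ∧ F x ≠ 0 := by
  classical
  have := Fintype.ofFinite ι
  rcases T.eq_empty_or_nonempty with rfl | ⟨i₀, hi₀⟩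
  · exact absurd ⟨I, fun i hi => hi.elim⟩ hx
  obtain ⟨τ₀, hτ₀⟩ := quotMap_surjective (Γ i₀) (x i₀)
  set k : ι → GL(2, ℚ)⁺ := fun i => g i * (g i₀)⁻¹ with hk
  have hk0 (τ : ℍ) : k i₀ • τ = τ := by simp [hk]
  choose M hM hMle using hΓ
  choose N' hN' hconj using fun i => exists_Gamma_conj (k i) (hM i)
  set N := ∏ i, N' i with hNdef
  have hN : N ≠ 0 := Finset.prod_ne_zero_iff.2 fun i _ => hN' i
  have hinv (ε : SL(2, ℤ)) (hε : ε ∈ Gamma N) (i : ι) (τ : ℍ) :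
      quotMap (Γ i) (k i • ε • τ) = quotMap (Γ i) (k i • τ) := by
    obtain ⟨y, hy, h⟩ := hconj i ε (Gamma_le_of_dvd (Finset.dvd_prod_of_mem _ (Finset.mem_univ i)) hε)
    rw [← ofSL_smul ε, ← mul_smul, h, mul_smul, ofSL_smul, quotMap_smul (hMle i hy)]
  obtain ⟨S, hS, hrep⟩ := exists_finset_reps hN (Γ i₀)
  have hsep : ∀ δ : SL(2, ℤ), ∃ i ∈ T, ∃ f : ModularCurve (Γ i) → ℂ,
      IsRegularFunction f ∧ f (x i) = 0 ∧ f (quotMap (Γ i) (k i • δ • τ₀)) ≠ 0 := by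
    intro δ
    by_contra! hall
    refine hx ⟨(g i₀)⁻¹ • δ • τ₀, fun i hi => ?_⟩
    rw [← mul_smul]
    by_contra hne
    obtain ⟨f, hf, hf0, hf1⟩ :=
      exists_isRegularFunction_separating ⟨M i, hM i, hMle i⟩ hne
    exact hf1 (hall i hi f hf hf0)
  choose j hj f hf hf0 hf1 using hsep
  set h : ModularProduct Γ → ℂ := 1 - ∏ δ ∈ S, (1 - (f δ (quotMap _ (k (j δ) • δ • τ₀)))⁻¹ •
    fun y : ModularProduct Γ => f δ (y (j δ))) with hh
  have hhmem : h ∈ coordRingOn Γ T := sub_mem (one_mem _) (prod_mem fun δ _ =>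
    sub_mem (one_mem _) (Subalgebra.smul_mem _ (coord_mem (hj δ) (hf δ)) _))
  have happly (y : ModularProduct Γ) : h y = 1 - ∏ δ ∈ S,
      (1 - (f δ (quotMap _ (k (j δ) • δ • τ₀)))⁻¹ * f δ (y (j δ))) := by
    simp [hh, Finset.prod_apply]
  have hhx : h x = 0 := by
    rw [happly, Finset.prod_eq_one, sub_self]
    intro δ _
    rw [hf0, mul_zero, sub_zero]
  set φ : ℍ → ModularProduct Γ := fun τ i => quotMap (Γ i) (k i • τ) with hφ
  have hψ : (fun τ => h (φ τ)) ∈ congFun := pullback_mem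
    (fun i _ f hf => hf.comp_mem_congFun ⟨M i, hM i, hMle i⟩ (k i)) hhmem
  have hψ1 : ∀ γ ∈ Γ i₀, h (φ (γ • τ₀)) = 1 := by
    intro γ hγ
    obtain ⟨δ, hδ, ε, hε, rfl⟩ := hrep γ hγ
    have : φ ((ε * δ) • τ₀) = φ (δ • τ₀) := by
      funext i
      simp only [hφ, mul_smul]
      exact hinv ε hε i _
    rw [this, happly, Finset.prod_eq_zero hδ, sub_zero]
    rw [hφ, inv_mul_cancel₀ (hf1 δ), sub_self]
  obtain ⟨P, -, hP⟩ := exists_normPoly hψ (Γ i₀)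
  choose Fc hFc hFcval using fun k => exists_isRegularFunction (P.coeff k).2
  have hQmem : (∑ k ∈ Finset.range (P.natDegree + 1),
      (fun y : ModularProduct Γ => Fc k (y i₀)) * h ^ k) ∈ coordRingOn Γ T :=
    sum_mem fun k _ => mul_mem (coord_mem hi₀ (hFc k)) (pow_mem hhmem k)
  have hQ (y : ModularProduct Γ) (τ : ℍ) (hy : y i₀ = quotMap (Γ i₀) τ) :
      (∑ k ∈ Finset.range (P.natDegree + 1), (fun y : ModularProduct Γ => Fc k (y i₀)) * h ^ k) y =
        ∏ f ∈ (finite_orbit hψ (Γ i₀)).toFinset, (h y - f τ) := by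
    rw [← sum_coeff_eq_prod hP, Finset.sum_apply]
    refine Finset.sum_congr rfl fun k _ => ?_
    rw [Pi.mul_apply, Pi.pow_apply, hy, hFcval]
  refine ⟨_, hQmem, ?_, ?_⟩
  · rintro y ⟨τ, hτ⟩
    have hyφ : ∀ i ∈ T, y i = φ (g i₀ • τ) i := by
      intro i hi
      rw [hτ i hi]
      simp [hφ, hk, mul_smul]
    rw [hQ y (g i₀ • τ) (by rw [hyφ i₀ hi₀]; simp only [hφ, hk0])]
    refine Finset.prod_eq_zero (i := fun τ => h (φ τ))
      (by simpa using ⟨1, one_mem _, by simp⟩) ?_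
    change h y - h (φ (g i₀ • τ)) = 0
    rw [sub_eq_zero, happly, happly]
    congr 1
    refine Finset.prod_congr rfl fun δ _ => ?_
    rw [hyφ _ (hj δ)]
  · rw [hQ x τ₀ hτ₀.symm, hhx, Finset.prod_ne_zero_iff]
    intro f hf
    obtain ⟨γ, hγ, rfl⟩ : ∃ γ ∈ Γ i₀, f = fun τ => h (φ (γ • τ)) := by simpa using hf
    simp only
    rw [hψ1 γ hγ]
    norm_num

lemma isClosed_heckeOn [Finite ι] (hΓ : ∀ i, IsCongruenceSubgroup (Γ i)) (T : Set ι)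
    (g : ι → GL(2, ℚ)⁺) : IsClosed (heckeOn Γ T g) :=
  isClosed_iff_exists_ne_zero.2 fun _ hx =>
    (exists_separating_heckeOn hΓ hx).imp fun _ h => ⟨coordRingOn_le T h.1, h.2⟩

lemma isClosed_coord_eq (hΓ : ∀ i, IsCongruenceSubgroup (Γ i)) (i : ι)
    (c : ModularCurve (Γ i)) : IsClosed {x : ModularProduct Γ | x i = c} := by
  refine isClosed_iff_exists_ne_zero.2 fun x hx => ?_
  obtain ⟨f, hf, hf0, hf1⟩ := exists_isRegularFunction_separating (hΓ i) (Ne.symm hx)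
  exact ⟨_, coord_mem_coordRing hf, fun z hz => by rw [hz, hf0], hf1⟩

/-- Products of points and Hecke correspondences: the coordinates with index in `A` are those of
`c`, and the other coordinates are `g i • t k` with a variable `t k` in `ℍ` for each `k`, where
`k = b i`. -/
def heckeSet {κ : Type*} (A : Set ι) (c : ModularProduct Γ) (b : ι → κ) (g : ι → GL(2, ℚ)⁺) :
    Set (ModularProduct Γ) :=
  {x | (∀ i ∈ A, x i = c i) ∧ ∃ t : κ → ℍ, ∀ i ∉ A, x i = quotMap (Γ i) (g i • t (b i))}

variable {κ : Type*} {A : Set ι} {c : ModularProduct Γ} {b : ι → κ} {g : ι → GL(2, ℚ)⁺}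

lemma mem_heckeSet_iff {x : ModularProduct Γ} : x ∈ heckeSet A c b g ↔
    (∀ i ∈ A, x i = c i) ∧ ∀ k, x ∈ heckeOn Γ {i | i ∉ A ∧ b i = k} g := by
  refine and_congr_right fun _ => ⟨?_, ?_⟩
  · rintro ⟨t, ht⟩ k
    refine ⟨t k, ?_⟩
    rintro i ⟨hi, rfl⟩
    exact ht i hi
  · intro h
    choose t ht using h
    exact ⟨t, fun i hi => ht _ i ⟨hi, rfl⟩⟩

lemma isClosed_heckeSet [Finite ι] (hΓ : ∀ i, IsCongruenceSubgroup (Γ i)) :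
    IsClosed (heckeSet A c b g) := by
  have : heckeSet A c b g = (⋂ i ∈ A, {x | x i = c i}) ∩
      ⋂ k, heckeOn Γ {i | i ∉ A ∧ b i = k} g := by
    ext x
    rw [mem_heckeSet_iff]
    simp
  rw [this]
  exact (isClosed_biInter fun i _ => isClosed_coord_eq hΓ i _).inter
    (isClosed_iInter fun k => isClosed_heckeOn hΓ _ g)

open Classical in
/-- The parametrization of a product of points and Hecke correspondences by a power of `ℍ`. -/
def heckeMap (A : Set ι) (c : ModularProduct Γ) (b : ι → κ) (g : ι → GL(2, ℚ)⁺) (t : κ → ℍ) :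
    ModularProduct Γ :=
  fun i => if i ∈ A then c i else quotMap (Γ i) (g i • t (b i))

lemma heckeMap_mem (t : κ → ℍ) : heckeMap A c b g t ∈ heckeSet A c b g :=
  ⟨fun i hi => by simp [heckeMap, hi], t, fun i hi => by simp [heckeMap, hi]⟩

lemma heckeSet_eq_range : heckeSet A c b g = Set.range (heckeMap A c b g) := by
  ext x
  constructor
  · rintro ⟨h, t, ht⟩
    refine ⟨t, funext fun i => ?_⟩
    by_cases hi : i ∈ A
    · simp [heckeMap, hi, h i hi]
    · simp [heckeMap, hi, ht i hi]
  · rintro ⟨t, rfl⟩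
    exact heckeMap_mem t

lemma heckeSet_nonempty : (heckeSet A c b g).Nonempty :=
  ⟨_, heckeMap_mem fun _ => I⟩

lemma isIrreducible_heckeSet [Finite κ] (hΓ : ∀ i, IsCongruenceSubgroup (Γ i)) :
    IsIrreducible (heckeSet A c b g) := by
  classical
  have hmem (k : κ) (t : κ → ℍ) (i : ι) (f : ModularCurve (Γ i) → ℂ) (hf : IsRegularFunction f) :
      (fun τ : ℍ => f (heckeMap A c b g (Function.update t k τ) i)) ∈ congFun := by
    by_cases hi : i ∈ A
    · simp only [heckeMap, hi, if_true]
      exact algebraMap_mem congFun (f (c i))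
    · by_cases hk : b i = k
      · subst hk
        simp only [heckeMap, hi, if_false, Function.update_self]
        exact hf.comp_mem_congFun (hΓ i) (g i)
      · simp only [heckeMap, hi, if_false, Function.update_of_ne hk]
        exact algebraMap_mem congFun (f (quotMap (Γ i) (g i • t (b i))))
  refine ⟨heckeSet_nonempty, ?_⟩
  rw [heckeSet_eq_range]
  refine isPreirreducible_range_of_separately_continuous (Y := fun _ : κ => AnalyticHalfPlane)
    (Φ := heckeMap A c b g) fun k t => ?_
  exact continuous_of_forall_congFun (φ := fun τ : ℍ => heckeMap A c b g (Function.update t k τ))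
    fun i f hf => hmem k t i f hf

end

noncomputable section

/-! ### Special subvarieties as products of points and Hecke correspondences -/

variable {ι : Type*} {Γ : ι → Subgroup SL(2, ℤ)}
variable {κ : Type*} {A : Set ι} {c : ModularProduct Γ} {b : ι → κ} {g : ι → GL(2, ℚ)⁺}

lemma IsHeckeFactor.exists_eq {V : Set (ModularProduct Γ)} (h : IsHeckeFactor Γ V) :
    ∃ g : ι → GL(2, ℚ)⁺, V = Set.range fun (τ : ℍ) (i : ι) => quotMap (Γ i) (g i • τ) := by
  obtain ⟨g, hg, rfl⟩ := h
  exact ⟨fun i => ⟨g i, hg i⟩, rfl⟩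

lemma IsSpecial.exists_eq_heckeSet {Z : Set (ModularProduct Γ)} (hZ : IsSpecial Z) :
    ∃ (A : Set ι) (c : ModularProduct Γ) (b : ι → Set ι) (g : ι → GL(2, ℚ)⁺),
      (∀ i ∈ A, IsCMPoint (c i)) ∧ Z = heckeSet A c b g := by
  obtain ⟨-, -, P, ⟨hP0, hP⟩, V, hV, rfl⟩ := hZ
  choose B hB hBuniq using hP
  simp only at hB hBuniq
  have hc : ∀ i, ∃ c : ModularCurve (Γ i), IsCMFactor (fun j : B i => Γ j) (V (B i)) →
      IsCMPoint c ∧ B i = {i} ∧ V (B i) = {y | y ⟨i, (hB i).2⟩ = c} := by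
    intro i
    by_cases h : IsCMFactor (fun j : B i => Γ j) (V (B i))
    · obtain ⟨j, hj, x, hx, hVx⟩ := h
      obtain rfl := hj ⟨i, (hB i).2⟩
      refine ⟨x ⟨i, (hB i).2⟩, fun _ => ⟨hx, ?_, ?_⟩⟩
      · ext k
        constructor
        · exact fun hk => congrArg Subtype.val (hj ⟨k, hk⟩)
        · rintro rfl
          exact (hB _).2
      · rw [hVx]
        ext y
        constructor
        · rintro rfl
          rfl
        · intro hy
          funext k
          obtain rfl := hj k
          exact hy
    · exact ⟨quotMap _ I, fun h' => absurd h' h⟩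
  choose c hc using hc
  have hg : ∀ T : Set ι, ∃ g : ι → GL(2, ℚ)⁺, IsHeckeFactor (fun i : T => Γ i) (V T) →
      V T = Set.range fun (τ : ℍ) (i : T) => quotMap (Γ i) (g i • τ) := by
    classical
    intro T
    by_cases h : IsHeckeFactor (fun i : T => Γ i) (V T)
    · obtain ⟨g, hg⟩ := h.exists_eq
      exact ⟨fun i => if hi : i ∈ T then g ⟨i, hi⟩ else 1, fun _ => by simpa using hg⟩
    · exact ⟨1, fun h' => absurd h' h⟩
  choose G hG using hg
  set A := {i | IsCMFactor (fun j : B i => Γ j) (V (B i))} with hA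
  have hH (i : ι) (hi : i ∉ A) := hG (B i) ((hV (B i) (hB i).1).resolve_left hi)
  have hBi {i j : ι} (h : i ∈ B j) : B i = B j :=
    (hBuniq i (B j) ⟨(hB j).1, h⟩).symm
  have hmemA {i j : ι} (h : B i = B j) : i ∈ A ↔ j ∈ A := by
    change IsCMFactor (fun k : B i => Γ k) (V (B i)) ↔ IsCMFactor (fun k : B j => Γ k) (V (B j))
    rw [h]
  refine ⟨A, c, B, fun i => G (B i) i, fun i hi => (hc i hi).1, ?_⟩
  ext x
  refine Iff.trans ?_ mem_heckeSet_iff.symm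
  constructor
  · intro hx
    refine ⟨fun i hi => ?_, fun k => ?_⟩
    · have := hx (B i) (hB i).1
      rw [(hc i hi).2.2] at this
      exact this
    · by_cases hk : ∃ i, i ∉ A ∧ B i = k
      · obtain ⟨i, hi, rfl⟩ := hk
        have := hx (B i) (hB i).1
        rw [hH i hi] at this
        obtain ⟨τ, hτ⟩ := this
        refine ⟨τ, fun j hj => ?_⟩
        have hji : j ∈ B i := hj.2 ▸ (hB j).2
        have := congrFun hτ ⟨j, hji⟩
        change x j = quotMap (Γ j) (G (B j) j • τ)
        rw [hj.2]
        exact this.symm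
      · exact ⟨I, fun i hi => absurd ⟨i, hi⟩ hk⟩
  · rintro ⟨h1, h2⟩ T hT
    obtain ⟨i, hi⟩ : T.Nonempty := Set.nonempty_iff_ne_empty.2 fun h => hP0 (h ▸ hT)
    obtain rfl := hBuniq i T ⟨hT, hi⟩
    by_cases hiA : i ∈ A
    · rw [(hc i hiA).2.2]
      exact h1 i hiA
    · rw [hH i hiA]
      obtain ⟨τ, hτ⟩ := h2 (B i)
      refine ⟨τ, funext fun j => ?_⟩
      have := hτ j ⟨fun h => hiA ((hmemA (hBi j.2)).1 h), hBi j.2⟩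
      change x j = quotMap (Γ j) (G (B j) j • τ) at this
      rw [hBi j.2] at this
      exact this.symm

lemma isSpecial_heckeSet [Finite ι] [Finite κ] (hΓ : ∀ i, IsCongruenceSubgroup (Γ i))
    (hc : ∀ i ∈ A, IsCMPoint (c i)) : IsSpecial (heckeSet A c b g) := by
  classical
  refine ⟨isClosed_heckeSet hΓ, isIrreducible_heckeSet hΓ, ?_⟩
  set f : ι → ι ⊕ κ := fun i => if i ∈ A then .inl i else .inr (b i) with hf
  have hfA {i j : ι} (hj : j ∈ A) : f i = f j ↔ i = j := by
    by_cases hi : i ∈ A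
    · simp [hf, hi, hj]
    · simp only [hf, hi, hj, if_true, if_false, reduceCtorEq, false_iff]
      rintro rfl
      exact hi hj
  have hA' {i j : ι} (hj : j ∈ A) (h : f i = f j) : i ∈ A := by
    rwa [(hfA hj).1 h]
  have hfnA {i j : ι} (hj : j ∉ A) : f i = f j ↔ i ∉ A ∧ b i = b j := by
    by_cases hi : i ∈ A
    · simp [hf, hi, hj]
    · simp [hf, hi, hj]
  refine ⟨(Setoid.ker f).classes, Setoid.isPartition_classes _, fun T =>
    {y | ∃ τ : ℍ, ∀ i : T, ((i : ι) ∈ A → y i = c i) ∧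
      ((i : ι) ∉ A → y i = quotMap (Γ i) (g i • τ))}, ?_, ?_⟩
  · rintro _ ⟨j, rfl⟩
    by_cases hj : j ∈ A
    · left
      refine ⟨⟨j, rfl⟩, fun k => Subtype.ext ((hfA hj).1 k.2), fun k => c k, hc j hj, ?_⟩
      ext y
      constructor
      · rintro ⟨τ, h⟩
        funext k
        exact (h k).1 (hA' hj k.2)
      · rintro rfl
        exact ⟨I, fun k => ⟨fun _ => rfl, fun hk => absurd (hA' hj k.2) hk⟩⟩
    · right
      refine ⟨fun k => (g k : GL (Fin 2) ℚ), fun k => (g k).2, ?_⟩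
      ext y
      constructor
      · rintro ⟨τ, h⟩
        exact ⟨τ, funext fun k => ((h k).2 ((hfnA hj).1 k.2).1).symm⟩
      · rintro ⟨τ, rfl⟩
        exact ⟨τ, fun k => ⟨fun hk => absurd hk ((hfnA hj).1 k.2).1, fun _ => rfl⟩⟩
  · ext x
    rw [mem_heckeSet_iff]
    constructor
    · rintro ⟨h1, h2⟩ _ ⟨j, rfl⟩
      by_cases hj : j ∈ A
      · refine ⟨I, fun k => ⟨h1 k, fun hk => absurd (hA' hj k.2) hk⟩⟩
      · obtain ⟨τ, hτ⟩ := h2 (b j)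
        exact ⟨τ, fun k => ⟨h1 k, fun _ => hτ k ((hfnA hj).1 k.2)⟩⟩
    · intro h
      refine ⟨fun i hi => ?_, fun k => ?_⟩
      · obtain ⟨τ, hτ⟩ := h _ ⟨i, rfl⟩
        exact (hτ ⟨i, rfl⟩).1 hi
      · by_cases hk : ∃ i, i ∉ A ∧ b i = k
        · obtain ⟨i, hi, rfl⟩ := hk
          obtain ⟨τ, hτ⟩ := h _ ⟨i, rfl⟩
          exact ⟨τ, fun j hj => (hτ ⟨j, (hfnA hi).2 hj⟩).2 hj.1⟩
        · exact ⟨I, fun i hi => absurd ⟨i, hi⟩ hk⟩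

lemma proj_image_heckeSet (I : Set ι) : proj I '' heckeSet A c b g =
    heckeSet (Γ := fun i : I => Γ i) {i | (i : ι) ∈ A} (proj I c) (fun i => b i) fun i => g i := by
  rw [heckeSet_eq_range, heckeSet_eq_range, ← Set.range_comp]
  rfl

/-! ### Dominance -/

/-- The functions on a product of points and Hecke correspondences are integral over those that only
depend on a set `T` of coordinates, if `T` meets all the Hecke correspondences. Hence a subset that
is dense for the latter functions is dense. -/
lemma eq_zero_of_dominant [Finite κ] (hΓ : ∀ i, IsCongruenceSubgroup (Γ i))
    {J T : Set ι} (hT : ∀ i ∈ J, i ∉ A → ∃ i' ∈ T, i' ∉ A ∧ b i' = b i)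
    {Z : Set (ModularProduct Γ)} (hZ : Z ⊆ heckeSet A c b g)
    (hdom : ∀ G ∈ coordRingOn Γ T, (∀ z ∈ Z, G z = 0) → ∀ z ∈ heckeSet A c b g, G z = 0)
    {F : ModularProduct Γ → ℂ} (hF : F ∈ coordRingOn Γ J) (hFZ : ∀ z ∈ Z, F z = 0) :
    ∀ z ∈ heckeSet A c b g, F z = 0 := by
  set φ := heckeMap A c b g with hφ
  set R := (coordRing Γ).map (pullback φ)
  set B := (coordRingOn Γ T).map (pullback φ)
  have hrange : heckeSet A c b g = Set.range φ := heckeSet_eq_range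
  have hR : ∀ F ∈ R, ∀ G ∈ R, F * G = 0 → F = 0 ∨ G = 0 := by
    rintro _ ⟨F, hF, rfl⟩ _ ⟨G, hG, rfl⟩ h
    refine (eq_zero_or_eq_zero_of_isIrreducible
      (isIrreducible_heckeSet (A := A) (c := c) (b := b) (g := g) hΓ) hF hG ?_).imp ?_ ?_
    · rw [hrange]
      rintro _ ⟨t, rfl⟩
      exact congrFun h t
    all_goals exact fun h => funext fun t => h _ (heckeMap_mem t)
  have hint : IsIntegral B (pullback φ F) := by
    refine pullback_mem (R := (integralClosure B ((κ → ℍ) → ℂ)).restrictScalars ℂ) ?_ hF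
    intro i hi f hf
    change IsIntegral B _
    by_cases hiA : i ∈ A
    · simp only [hφ, heckeMap, hiA, if_true]
      exact isIntegral_algebraMap (x := algebraMap ℂ B (f (c i)))
    · obtain ⟨i', hi', hi'A, hb⟩ := hT i hi hiA
      have := isIntegral_comp (B := B) (σ := fun t : κ → ℍ => g i' • t (b i)) ?_
        (hf.comp_mem_congFun (hΓ i) (g i * (g i')⁻¹))
      · convert this using 2 with t
        simp [hφ, heckeMap, hiA, mul_smul]
      · intro a ha
        obtain ⟨f', hf', h⟩ := exists_isRegularFunction (Γ := Γ i') (f := a)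
          ⟨ha.1, fun γ _ => ha.2 γ (Subgroup.mem_top γ)⟩
        refine ⟨_, coord_mem hi' hf', funext fun t => ?_⟩
        simp [hφ, heckeMap, hi'A, h, hb]
  by_contra! hne
  obtain ⟨z, hz, hFz⟩ := hne
  obtain ⟨t, rfl⟩ := hrange ▸ hz
  obtain ⟨H, -, ⟨G, hG, hGF⟩, hFH⟩ := exists_mul_mem_of_isIntegral (B := B) (R := R)
    (Subalgebra.map_mono (coordRingOn_le T)) hR ⟨F, coordRingOn_le J hF, rfl⟩
    (fun h => hFz (congrFun h t)) hint
  apply hFH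
  rw [← hGF]
  refine funext fun s => hdom G hG (fun z hz => ?_) _ (heckeMap_mem s)
  obtain ⟨s, rfl⟩ := hrange ▸ hZ hz
  have := congrFun hGF s
  refine this.trans ?_
  simp [hFZ _ hz]

end

noncomputable section

/-! ### Dimension -/

variable {ι : Type*} {Γ : ι → Subgroup SL(2, ℤ)}

/-- The function on `Γ \ ℍ` given by the modular invariant. -/
def jCoord (Γ : Subgroup SL(2, ℤ)) : ModularCurve Γ → ℂ :=
  (exists_isRegularFunction (Γ := Γ) (f := jFun)
    ⟨jFun_mem.1, fun γ _ => jFun_mem.2 γ (Subgroup.mem_top γ)⟩).choose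

lemma isRegularFunction_jCoord (Γ : Subgroup SL(2, ℤ)) : IsRegularFunction (jCoord Γ) :=
  (exists_isRegularFunction (Γ := Γ) (f := jFun)
    ⟨jFun_mem.1, fun γ _ => jFun_mem.2 γ (Subgroup.mem_top γ)⟩).choose_spec.1

lemma jCoord_quotMap (Γ : Subgroup SL(2, ℤ)) (τ : ℍ) : jCoord Γ (quotMap Γ τ) = jFun τ :=
  (exists_isRegularFunction (Γ := Γ) (f := jFun)
    ⟨jFun_mem.1, fun γ _ => jFun_mem.2 γ (Subgroup.mem_top γ)⟩).choose_spec.2 τ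

/-- Polynomials in the modular invariants of the coordinates, as functions on the product. -/
def jPoly (Γ : ι → Subgroup SL(2, ℤ)) : MvPolynomial ι ℂ →ₐ[ℂ] (ModularProduct Γ → ℂ) :=
  MvPolynomial.aeval fun i x => jCoord (Γ i) (x i)

lemma jPoly_mem (p : MvPolynomial ι ℂ) : jPoly Γ p ∈ coordRing Γ := by
  have : (jPoly Γ).range ≤ coordRing Γ := by
    rw [jPoly, ← Algebra.adjoin_range_eq_range_aeval]
    refine Algebra.adjoin_le ?_
    rintro _ ⟨i, rfl⟩
    exact coord_mem_coordRing (isRegularFunction_jCoord (Γ i))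
  exact this ⟨p, rfl⟩

/-- The ideal of the polynomials in the modular invariants that vanish on an irreducible set. -/
def vanishingPrime (Z : Set (ModularProduct Γ)) (hZ : IsIrreducible Z) :
    PrimeSpectrum (MvPolynomial ι ℂ) where
  asIdeal :=
    { carrier := {p | ∀ x ∈ Z, jPoly Γ p x = 0}
      add_mem' := fun {p q} hp hq x hx => by rw [map_add, Pi.add_apply, hp x hx, hq x hx, add_zero]
      zero_mem' := fun x _ => by rw [map_zero, Pi.zero_apply]
      smul_mem' := fun p q hq x hx => by
        rw [smul_eq_mul, map_mul, Pi.mul_apply, hq x hx, mul_zero] }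
  isPrime := by
    refine Ideal.isPrime_iff.2 ⟨?_, ?_⟩
    · rw [Ideal.ne_top_iff_one]
      intro h
      obtain ⟨x, hx⟩ := hZ.nonempty
      have := h x hx
      rw [map_one] at this
      exact one_ne_zero this
    · intro p q hpq
      refine eq_zero_or_eq_zero_of_isIrreducible hZ (jPoly_mem p) (jPoly_mem q) fun x hx => ?_
      have := hpq x hx
      rwa [map_mul] at this

/-- The coordinate ring is integral over the ring of polynomials in the modular invariants of the
coordinates. Hence strict inclusions of irreducible closed sets give strict inclusions of prime
ideals of the polynomial ring. -/
lemma vanishingPrime_lt (hΓ : ∀ i, IsCongruenceSubgroup (Γ i)) {Z W : Set (ModularProduct Γ)}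
    (hZ : IsIrreducible Z) (hW : IsIrreducible W) (hZc : IsClosed Z) (h : Z ⊂ W) :
    vanishingPrime W hW < vanishingPrime Z hZ := by
  have hle : vanishingPrime W hW ≤ vanishingPrime Z hZ := fun p hp x hx => hp x (h.1 hx)
  refine lt_of_le_not_ge hle fun hge => ?_
  obtain ⟨w, hw, hwZ⟩ := Set.exists_of_ssubset h
  obtain ⟨F, hF, hFZ, hFw⟩ := isClosed_iff_exists_ne_zero.1 hZc w hwZ
  set R := (coordRing Γ).map (pullback (Subtype.val : W → ModularProduct Γ)) with hRdef
  set B := (jPoly Γ).range.map (pullback (Subtype.val : W → ModularProduct Γ)) with hBdef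
  have hR : ∀ F ∈ R, ∀ G ∈ R, F * G = 0 → F = 0 ∨ G = 0 := by
    rintro _ ⟨F, hF, rfl⟩ _ ⟨G, hG, rfl⟩ h
    refine (eq_zero_or_eq_zero_of_isIrreducible hW hF hG fun x hx => congrFun h ⟨x, hx⟩).imp
      ?_ ?_
    all_goals exact fun h => funext fun x => h x x.2
  have hint : IsIntegral B (pullback (Subtype.val : W → ModularProduct Γ) F) := by
    refine pullback_mem (R := (integralClosure B (W → ℂ)).restrictScalars ℂ) (I := Set.univ) ?_
      (by rwa [coordRingOn_univ])
    intro i _ f hf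
    change IsIntegral B _
    choose σ hσ using fun x : W => quotMap_surjective (Γ i) (x.1 i)
    simp only [← hσ]
    refine isIntegral_comp (B := B) (σ := σ) ?_ (hf.mem_congFun (hΓ i))
    have hle : Algebra.adjoin ℂ {jFun} ≤ B.comap (pullback σ) := by
      refine Algebra.adjoin_le ?_
      rintro _ rfl
      refine ⟨_, ⟨MvPolynomial.X i, rfl⟩, funext fun x => ?_⟩
      change jPoly Γ (MvPolynomial.X i) x = jFun (σ x)
      rw [jPoly, MvPolynomial.aeval_X, ← hσ, jCoord_quotMap]
    exact fun a ha => hle (invFun_top_le ha)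
  obtain ⟨H, -, ⟨_, ⟨p, rfl⟩, hp⟩, hFH⟩ := exists_mul_mem_of_isIntegral (B := B) (R := R)
    (Subalgebra.map_mono (by rintro _ ⟨p, rfl⟩; exact jPoly_mem p)) hR ⟨F, hF, rfl⟩
    (fun h => hFw (congrFun h ⟨w, hw⟩)) hint
  apply hFH
  rw [← hp]
  refine funext fun x => hge (show p ∈ (vanishingPrime Z hZ).asIdeal from fun z hz => ?_) x x.2
  refine (congrFun hp ⟨z, h.1 hz⟩).trans ?_
  simp [hFZ z hz]

lemma isIrreducible_univ [Finite ι] (hΓ : ∀ i, IsCongruenceSubgroup (Γ i)) :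
    IsIrreducible (Set.univ : Set (ModularProduct Γ)) := by
  have : heckeSet (Γ := Γ) ∅ (fun i => quotMap _ I) id 1 = Set.univ := by
    refine Set.eq_univ_of_forall fun x => ⟨fun i hi => hi.elim, ?_⟩
    choose t ht using fun i => quotMap_surjective (Γ i) (x i)
    exact ⟨t, fun i _ => by simp [ht]⟩
  rw [← this]
  exact isIrreducible_heckeSet hΓ

lemma countable_fiber_quotMap (Γ : Subgroup SL(2, ℤ)) (x : ModularCurve Γ) :
    {τ : ℍ | quotMap Γ τ = x}.Countable := by
  have hcount : Countable SL(2, ℤ) :=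
    Function.Injective.countable (f := fun (γ : SL(2, ℤ)) (p : Fin 2 × Fin 2) => γ p.1 p.2)
      fun γ γ' h => by ext i j; exact congrFun h (i, j)
  obtain ⟨τ₀, rfl⟩ := quotMap_surjective Γ x
  refine (Set.countable_range fun γ : SL(2, ℤ) => γ • τ₀).mono fun τ hτ => ?_
  obtain ⟨γ, -, hγ⟩ := quotMap_eq_iff.1 hτ
  exact ⟨γ, hγ⟩

instance (Γ : Subgroup SL(2, ℤ)) : Uncountable (ModularCurve Γ) := by
  rw [← not_countable_iff]
  intro h
  have h1 : (Set.univ : Set ℍ).Countable := by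
    have : (Set.univ : Set ℍ) = ⋃ x : ModularCurve Γ, {τ | quotMap Γ τ = x} := by
      ext τ
      simp
    rw [this]
    exact Set.countable_iUnion fun x => countable_fiber_quotMap Γ x
  have h2 : (UpperHalfPlane.re '' Set.univ).Countable := h1.image _
  rw [Set.image_univ, Set.range_eq_univ.2 fun x => ⟨⟨⟨x, 1⟩, one_pos⟩, rfl⟩] at h2
  exact Set.not_countable_univ h2

lemma topologicalKrullDim_modularProduct [Finite ι] (hΓ : ∀ i, IsCongruenceSubgroup (Γ i)) :
    topologicalKrullDim (ModularProduct Γ) = Nat.card ι := by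
  apply le_antisymm
  · have : topologicalKrullDim (ModularProduct Γ) ≤
        Order.krullDim (PrimeSpectrum (MvPolynomial ι ℂ))ᵒᵈ :=
      Order.krullDim_le_of_strictMono
        (fun Z : TopologicalSpace.IrreducibleCloseds (ModularProduct Γ) =>
          OrderDual.toDual (vanishingPrime (Z : Set (ModularProduct Γ)) Z.isIrreducible))
        fun Z W h => vanishingPrime_lt hΓ Z.isIrreducible W.isIrreducible Z.isClosed h
    rw [Order.krullDim_orderDual] at this
    refine this.trans_eq ?_
    change ringKrullDim (MvPolynomial ι ℂ) = _
    rw [MvPolynomial.ringKrullDim_of_isNoetherianRing, ringKrullDim_eq_zero_of_field, zero_add]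
  · have e := Finite.equivFin ι
    have hxy : ∀ i, ∃ x y : ModularCurve (Γ i), x ≠ y := fun i => exists_pair_ne _
    choose c c' hcc' using hxy
    choose t ht using fun i => quotMap_surjective (Γ i) (c i)
    choose t' ht' using fun i => quotMap_surjective (Γ i) (c' i)
    let f (k : Fin (Nat.card ι + 1)) : TopologicalSpace.IrreducibleCloseds (ModularProduct Γ) :=
      ⟨heckeSet {i | k ≤ (e i).castSucc} c id 1, isIrreducible_heckeSet hΓ, isClosed_heckeSet hΓ⟩
    have hf : StrictMono f := by
      intro k l hkl
      refine lt_of_le_not_ge ?_ fun hle => ?_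
      · rintro x ⟨h1, s, hs⟩
        refine ⟨fun i hi => h1 i (hkl.le.trans hi), ?_⟩
        choose u hu using fun i => quotMap_surjective (Γ i) (x i)
        exact ⟨u, fun i _ => by simp [hu]⟩
      · have hk : (k : ℕ) < Nat.card ι := by have := Fin.lt_def.1 hkl; omega
        have hmem : heckeMap (Γ := Γ) {i | l ≤ (e i).castSucc} c id 1 t' ∈ f l := heckeMap_mem t'
        have := (hle hmem).1 (e.symm ⟨k, hk⟩) (by simp [Fin.le_def])
        have hn : e.symm ⟨k, hk⟩ ∉ ({i | l ≤ (e i).castSucc} : Set ι) := by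
          change ¬ l ≤ (e (e.symm ⟨k, hk⟩)).castSucc
          rw [Equiv.apply_symm_apply]
          exact not_le.2 (Fin.lt_def.2 (Fin.lt_def.1 hkl))
        simp only [heckeMap, hn, if_false, Pi.one_apply, one_smul, id, ht'] at this
        exact hcc' _ this.symm
    exact Order.LTSeries.length_le_krullDim (LTSeries.mk (Nat.card ι) f hf)

lemma topologicalKrullDim_lt_of_ne_univ [Finite ι] (hΓ : ∀ i, IsCongruenceSubgroup (Γ i))
    {W : Set (ModularProduct Γ)} (hW : IsClosed W) (hne : W ≠ Set.univ) :
    topologicalKrullDim W < Nat.card ι := by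
  by_contra! h
  obtain ⟨l, hl⟩ := Order.le_krullDim_iff.1 h
  set l' := l.map _ (TopologicalSpace.IrreducibleCloseds.map_strictMono_of_isInducing
    (Topology.IsInducing.subtypeVal (t := W)))
  set top : TopologicalSpace.IrreducibleCloseds (ModularProduct Γ) :=
    ⟨Set.univ, isIrreducible_univ hΓ, isClosed_univ⟩
  have hlt : l'.last < top := by
    refine lt_of_le_not_ge (fun x _ => Set.mem_univ x) fun hle => hne ?_
    refine Set.eq_univ_of_forall fun x => ?_
    have hx := hle (Set.mem_univ x)
    have hsub : closure ((Subtype.val : W → ModularProduct Γ) '' (l.last : Set W)) ⊆ W :=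
      closure_minimal (by rintro _ ⟨y, -, rfl⟩; exact y.2) hW
    exact hsub hx
  have := Order.LTSeries.length_le_krullDim (l'.snoc top hlt)
  rw [← topologicalKrullDim, topologicalKrullDim_modularProduct hΓ] at this
  have h2 : l.length + 1 ≤ Nat.card ι := by exact_mod_cast this
  omega

variable {I : Set ι} {Z : Set (ModularProduct Γ)}

lemma dimProj_lt_iff [Finite ι] (hΓ : ∀ i, IsCongruenceSubgroup (Γ i)) :
    dimProj I Z < (I.ncard : WithBot ℕ∞) ↔ closure (proj I '' Z) ≠ Set.univ := by
  constructor
  · intro h hu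
    have := topologicalKrullDim_modularProduct (Γ := fun i : I => Γ i) fun i => hΓ i
    rw [dimProj, hu, (Homeomorph.Set.univ _).isHomeomorph.topologicalKrullDim_eq, this] at h
    exact lt_irrefl _ h
  · exact topologicalKrullDim_lt_of_ne_univ (Γ := fun i : I => Γ i) (fun i => hΓ i) isClosed_closure

lemma dimProj_eq_iff [Finite ι] (hΓ : ∀ i, IsCongruenceSubgroup (Γ i)) :
    dimProj I Z = (I.ncard : WithBot ℕ∞) ↔ closure (proj I '' Z) = Set.univ := by
  constructor
  · intro h
    by_contra hne
    exact ((dimProj_lt_iff hΓ).2 hne).ne h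
  · intro hu
    have := topologicalKrullDim_modularProduct (Γ := fun i : I => Γ i) fun i => hΓ i
    rw [dimProj, hu, (Homeomorph.Set.univ _).isHomeomorph.topologicalKrullDim_eq, this]
    rfl

/-- Density of the projection in terms of functions. -/
lemma closure_proj_eq_univ_iff : closure (proj I '' Z) = Set.univ ↔
    ∀ G ∈ coordRingOn Γ I, (∀ z ∈ Z, G z = 0) → G = 0 := by
  constructor
  · intro h G hG hGZ
    obtain ⟨G', hG', rfl⟩ := exists_pullback_proj hG
    have : closure (proj I '' Z) ⊆ {x | G' x = 0} :=
      closure_minimal (by rintro _ ⟨z, hz, rfl⟩; exact hGZ z hz) (isClosed_zero hG')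
    rw [h] at this
    exact funext fun x => this (Set.mem_univ (proj I x))
  · intro h
    by_contra hne
    obtain ⟨y, hy⟩ := (Set.ne_univ_iff_exists_notMem _).1 hne
    obtain ⟨F, hF, hFZ, hFy⟩ := isClosed_iff_exists_ne_zero.1 isClosed_closure y hy
    have h0 := h _ (pullback_proj_mem hF) fun z hz => hFZ _ (subset_closure ⟨z, hz, rfl⟩)
    classical
    let x : ModularProduct Γ := fun i => if hi : i ∈ I then y ⟨i, hi⟩ else quotMap _ UpperHalfPlane.I
    have hx : proj I x = y := funext fun i => by simp [x, proj]
    have := congrFun h0 x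
    rw [pullback_apply, hx] at this
    exact hFy this

end

noncomputable section

/-! ### Isogenies -/

/-- An integral matrix of positive determinant as a rational matrix. -/
def ofInt (M : Matrix (Fin 2) (Fin 2) ℤ) (hM : 0 < M.det) : GL(2, ℚ)⁺ :=
  ⟨GeneralLinearGroup.mkOfDetNeZero (M.map (Int.castRingHom ℚ))
    (by rw [← RingHom.mapMatrix_apply, ← RingHom.map_det]; exact Int.cast_ne_zero.2 hM.ne'), by
    change (0 : ℚ) < (M.map (Int.castRingHom ℚ)).det
    rw [← RingHom.mapMatrix_apply, ← RingHom.map_det]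
    exact Int.cast_pos.2 hM⟩

lemma ofInt_apply (M : Matrix (Fin 2) (Fin 2) ℤ) (hM : 0 < M.det) (i j : Fin 2) :
    (ofInt M hM : GL (Fin 2) ℚ) i j = (M i j : ℚ) := rfl

lemma coe_ofInt_smul (M : Matrix (Fin 2) (Fin 2) ℤ) (hM : 0 < M.det) (τ : ℍ) :
    ((ofInt M hM • τ : ℍ) : ℂ) = (M 0 0 * (τ : ℂ) + M 0 1) / (M 1 0 * (τ : ℂ) + M 1 1) := by
  rw [coe_glPos_smul]
  simp [ofInt_apply]

lemma ofInt_mul {M M' : Matrix (Fin 2) (Fin 2) ℤ} (hM : 0 < M.det) (hM' : 0 < M'.det)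
    (h : 0 < (M * M').det) : ofInt (M * M') h = ofInt M hM * ofInt M' hM' := by
  apply Subtype.ext
  ext i j
  rw [Subgroup.coe_mul, Units.val_mul, Matrix.mul_apply]
  simp only [ofInt_apply, Matrix.mul_apply, Int.cast_sum, Int.cast_mul]

lemma ofInt_coe_SL (γ : SL(2, ℤ)) :
    ofInt (γ : Matrix (Fin 2) (Fin 2) ℤ) (by rw [γ.det_coe]; exact one_pos) = ofSL γ := by
  apply Subtype.ext
  ext i j
  rfl

/-- Up to scalars, rational matrices are integral. -/
lemma exists_ofInt_smul_eq (g : GL(2, ℚ)⁺) :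
    ∃ (M : Matrix (Fin 2) (Fin 2) ℤ) (hM : 0 < M.det), ∀ τ : ℍ, ofInt M hM • τ = g • τ := by
  set n : ℕ := ∏ p : Fin 2 × Fin 2, ((g : GL (Fin 2) ℚ) p.1 p.2).den with hn
  have hn0 : n ≠ 0 := Finset.prod_ne_zero_iff.2 fun p _ => Rat.den_nz _
  have hint : ∀ i j, ∃ m : ℤ, (m : ℚ) = n * (g : GL (Fin 2) ℚ) i j := by
    intro i j
    obtain ⟨k, hk⟩ : ((g : GL (Fin 2) ℚ) i j).den ∣ n :=
      Finset.dvd_prod_of_mem (fun p : Fin 2 × Fin 2 => ((g : GL (Fin 2) ℚ) p.1 p.2).den)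
        (Finset.mem_univ (i, j))
    refine ⟨k * ((g : GL (Fin 2) ℚ) i j).num, ?_⟩
    rw [hk]
    push_cast
    rw [mul_comm (_ : ℚ) (k : ℚ), mul_assoc, Rat.den_mul_eq_num]
  choose m hm using hint
  have hdet : 0 < (Matrix.of m).det := by
    have h : (0 : ℚ) < (g : GL (Fin 2) ℚ).val.det := g.2
    rw [Matrix.det_fin_two] at h
    have h2 : (((Matrix.of m).det : ℤ) : ℚ) = n ^ 2 *
        ((g : GL (Fin 2) ℚ) 0 0 * (g : GL (Fin 2) ℚ) 1 1 -
          (g : GL (Fin 2) ℚ) 0 1 * (g : GL (Fin 2) ℚ) 1 0) := by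
      rw [Matrix.det_fin_two]
      simp only [Matrix.of_apply]
      push_cast
      rw [hm, hm, hm, hm]
      ring
    have h3 : (0 : ℚ) < ((Matrix.of m).det : ℤ) := by
      rw [h2]
      positivity
    exact_mod_cast h3
  refine ⟨Matrix.of m, hdet, fun τ => ?_⟩
  apply UpperHalfPlane.ext
  rw [coe_ofInt_smul, coe_glPos_smul]
  have hc (i j : Fin 2) : ((m i j : ℤ) : ℂ) = n * (((g : GL (Fin 2) ℚ) i j : ℚ) : ℂ) := by
    have := congrArg (fun q : ℚ => (q : ℂ)) (hm i j)
    simpa using this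
  simp only [Matrix.of_apply, hc]
  have hnC : (n : ℂ) ≠ 0 := Nat.cast_ne_zero.2 hn0
  rw [mul_assoc, mul_assoc, ← mul_add, ← mul_add, mul_div_mul_left _ _ hnC]

/-- The parametrization of the lattice `ℤ + ℤ τ` by `ℤ²`. -/
def latticeMap (τ : ℍ) : (Fin 2 → ℤ) →+ ℂ where
  toFun v := v 0 * (τ : ℂ) + v 1
  map_zero' := by simp
  map_add' v w := by
    simp only [Pi.add_apply]
    push_cast
    ring

lemma latticeMap_apply (τ : ℍ) (v : Fin 2 → ℤ) : latticeMap τ v = v 0 * (τ : ℂ) + v 1 := rfl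

lemma range_latticeMap (τ : ℍ) : (latticeMap τ).range = lattice τ := by
  ext z
  rw [lattice, AddSubgroup.mem_closure_pair]
  constructor
  · rintro ⟨v, rfl⟩
    exact ⟨v 1, v 0, by rw [latticeMap_apply]; simp [add_comm]⟩
  · rintro ⟨m, n, rfl⟩
    exact ⟨![n, m], by rw [latticeMap_apply]; simp [add_comm]⟩

lemma mem_lattice_iff {τ : ℍ} {z : ℂ} : z ∈ lattice τ ↔ ∃ m n : ℤ, z = m * (τ : ℂ) + n := by
  rw [← range_latticeMap]
  constructor
  · rintro ⟨v, rfl⟩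
    exact ⟨v 0, v 1, rfl⟩
  · rintro ⟨m, n, rfl⟩
    exact ⟨![m, n], rfl⟩

lemma index_range_toLin' (M : Matrix (Fin 2) (Fin 2) ℤ) (hM : M.det ≠ 0) :
    (LinearMap.range (Matrix.toLin' M)).toAddSubgroup.index = M.det.natAbs := by
  have hinj : Function.Injective (Matrix.toLin' M) := by
    rw [Matrix.toLin'_apply', Matrix.coe_mulVecLin]
    exact Matrix.mulVec_injective_of_det_ne_zero hM
  refine (Submodule.natAbs_det_equiv _ (LinearEquiv.ofInjective _ hinj)).symm.trans ?_
  rw [← LinearMap.det_toLin']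
  rfl

/-- The homothety by `a` maps one lattice to a sublattice of the other, of index the determinant of
the matrix that describes it. -/
lemma relIndex_lattice {τ τ' : ℍ} {a : ℂ} {M : Matrix (Fin 2) (Fin 2) ℤ} (hM : M.det ≠ 0)
    (h0 : a * τ = M 0 0 * (τ' : ℂ) + M 0 1) (h1 : a = M 1 0 * (τ' : ℂ) + M 1 1) :
    (lattice τ).map (AddMonoidHom.mulLeft a) ≤ lattice τ' ∧
      ((lattice τ).map (AddMonoidHom.mulLeft a)).relIndex (lattice τ') = M.det.natAbs := by
  have hmap : (lattice τ).map (AddMonoidHom.mulLeft a) =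
      (LinearMap.range (Matrix.toLin' Mᵀ)).toAddSubgroup.map (latticeMap τ') := by
    have key (v : Fin 2 → ℤ) : a * latticeMap τ v = latticeMap τ' (Matrix.toLin' Mᵀ v) := by
      simp only [latticeMap_apply, Matrix.toLin'_apply, Matrix.mulVec, dotProduct,
        Fin.sum_univ_two, Matrix.transpose_apply]
      push_cast
      rw [mul_add, mul_left_comm, h0, h1]
      ring
    rw [← range_latticeMap]
    ext z
    constructor
    · rintro ⟨_, ⟨v, rfl⟩, rfl⟩
      exact ⟨_, ⟨v, rfl⟩, (key v).symm⟩
    · rintro ⟨_, ⟨v, rfl⟩, rfl⟩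
      exact ⟨_, ⟨v, rfl⟩, key v⟩
  rw [hmap, ← range_latticeMap, AddMonoidHom.range_eq_map]
  refine ⟨AddSubgroup.map_mono le_top, ?_⟩
  rw [AddSubgroup.relIndex_map_map_of_injective _ _ (linear_injective τ'),
    AddSubgroup.relIndex_top_right, index_range_toLin' _ (by rwa [Matrix.det_transpose]),
    Matrix.det_transpose]

lemma linear_ne_zero (τ : ℍ) {m n : ℤ} (h : m ≠ 0 ∨ n ≠ 0) : (m : ℂ) * τ + n ≠ 0 := by
  intro h0
  have := linear_injective τ (a₁ := ![m, n]) (a₂ := 0) (by simpa using h0)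
  have h1 := congrFun this 0
  have h2 := congrFun this 1
  simp at h1 h2
  tauto

/-- A matrix that maps a point of `ℍ` to a point of `ℍ` has positive determinant. -/
lemma det_pos_of_smul_eq {τ τ' : ℍ} {a : ℂ} {M : Matrix (Fin 2) (Fin 2) ℤ} (ha : a ≠ 0)
    (h0 : a * τ = M 0 0 * (τ' : ℂ) + M 0 1) (h1 : a = M 1 0 * (τ' : ℂ) + M 1 1) :
    0 < M.det := by
  have hre0 := congrArg Complex.re h0
  have him0 := congrArg Complex.im h0
  have hre1 := congrArg Complex.re h1
  have him1 := congrArg Complex.im h1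
  simp only [Complex.mul_re, Complex.mul_im, Complex.add_re, Complex.add_im, Complex.intCast_re,
    Complex.intCast_im, UpperHalfPlane.coe_re, UpperHalfPlane.coe_im, zero_mul, sub_zero,
    add_zero] at hre0 him0 hre1 him1
  have hna : 0 < a.re ^ 2 + a.im ^ 2 := by
    rw [← Complex.normSq_add_mul_I, Complex.re_add_im]
    exact Complex.normSq_pos.2 ha
  have key : (M 0 0 * M 1 1 - M 0 1 * M 1 0 : ℝ) * τ'.im = (a.re ^ 2 + a.im ^ 2) * τ.im := by
    linear_combination (-a.re) * him0 + a.im * hre0 -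
      (M 0 0 * τ'.im : ℝ) * hre1 + (M 0 0 * τ'.re + M 0 1 : ℝ) * him1
  have hpos : (0 : ℝ) < M 0 0 * M 1 1 - M 0 1 * M 1 0 := by
    have := mul_pos hna τ.im_pos
    rw [← key] at this
    exact pos_of_mul_pos_left this τ'.im_pos.le
  rw [Matrix.det_fin_two]
  exact_mod_cast hpos

lemma existsIsogeny_iff {d : ℕ} {τ τ' : ℍ} : ExistsIsogeny d τ τ' ↔
    ∃ (M : Matrix (Fin 2) (Fin 2) ℤ) (hM : 0 < M.det), M.det = d ∧ τ = ofInt M hM • τ' := by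
  constructor
  · rintro ⟨a, ha, hle, hind⟩
    obtain ⟨r, s, h1⟩ := mem_lattice_iff.1 (hle ⟨1, mem_lattice_iff.2 ⟨0, 1, by simp⟩, rfl⟩)
    obtain ⟨p, q, h0⟩ := mem_lattice_iff.1 (hle ⟨τ, mem_lattice_iff.2 ⟨1, 0, by simp⟩, rfl⟩)
    simp only [AddMonoidHom.coe_mulLeft, mul_one] at h0 h1
    have hM : 0 < (!![p, q; r, s]).det := det_pos_of_smul_eq (M := !![p, q; r, s]) ha h0 h1
    refine ⟨!![p, q; r, s], hM, ?_, ?_⟩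
    · rw [(relIndex_lattice (M := !![p, q; r, s]) hM.ne' h0 h1).2] at hind
      rw [← hind, Int.natAbs_of_nonneg hM.le]
    · apply UpperHalfPlane.ext
      rw [coe_ofInt_smul, eq_div_iff (by simpa [← h1] using ha), mul_comm]
      simpa [← h1] using h0
  · rintro ⟨M, hM, hd, rfl⟩
    have ha : (M 1 0 : ℂ) * τ' + M 1 1 ≠ 0 := by
      refine linear_ne_zero τ' ?_
      by_contra! h
      rw [Matrix.det_fin_two, h.1, h.2] at hM
      simp at hM
    have h0 : ((M 1 0 : ℂ) * τ' + M 1 1) * (ofInt M hM • τ' : ℍ) = M 0 0 * (τ' : ℂ) + M 0 1 := by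
      rw [coe_ofInt_smul, mul_div_cancel₀ _ ha]
    refine ⟨_, ha, ?_⟩
    have := relIndex_lattice hM.ne' h0 rfl
    refine ⟨this.1, ?_⟩
    rw [this.2, hd, Int.natAbs_natCast]

lemma areIsogenous_iff {Γ Γ' : Subgroup SL(2, ℤ)} {d : ℕ} {x : ModularCurve Γ}
    {y : ModularCurve Γ'} : AreIsogenous d x y ↔
      ∃ (M : Matrix (Fin 2) (Fin 2) ℤ) (hM : 0 < M.det) (τ : ℍ), M.det = d ∧
        x = quotMap Γ (ofInt M hM • τ) ∧ y = quotMap Γ' τ := by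
  constructor
  · rintro ⟨τ, τ', rfl, rfl, h⟩
    obtain ⟨M, hM, hd, rfl⟩ := existsIsogeny_iff.1 h
    exact ⟨M, hM, τ', hd, rfl, rfl⟩
  · rintro ⟨M, hM, τ, hd, rfl, rfl⟩
    exact ⟨_, _, rfl, rfl, existsIsogeny_iff.2 ⟨M, hM, hd, rfl⟩⟩

variable {Γ Γ' Γ'' : Subgroup SL(2, ℤ)}

lemma AreIsogenous.refl (x : ModularCurve Γ) : AreIsogenous 1 x x := by
  obtain ⟨τ, rfl⟩ := quotMap_surjective Γ x
  refine areIsogenous_iff.2 ⟨1, by simp, τ, by simp, ?_, rfl⟩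
  have : ofInt 1 (by simp) = 1 := by simpa using ofInt_coe_SL 1
  rw [this, one_smul]

lemma AreIsogenous.symm {d : ℕ} {x : ModularCurve Γ} {y : ModularCurve Γ'}
    (h : AreIsogenous d x y) : AreIsogenous d y x := by
  obtain ⟨M, hM, τ, hd, rfl, rfl⟩ := areIsogenous_iff.1 h
  have hadj : M.adjugate.det = M.det := by
    rw [Matrix.det_adjugate]
    simp
  have hM' : 0 < M.adjugate.det := hadj ▸ hM
  refine areIsogenous_iff.2 ⟨M.adjugate, hM', ofInt M hM • τ, hadj.trans hd, ?_, rfl⟩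
  congr 1
  apply UpperHalfPlane.ext
  rw [← mul_smul, ← ofInt_mul hM' hM (by rw [Matrix.det_mul]; positivity), coe_ofInt_smul,
    Matrix.adjugate_mul]
  have : (M.det : ℂ) ≠ 0 := Int.cast_ne_zero.2 hM.ne'
  simp only [Matrix.smul_apply, Matrix.one_apply, smul_eq_mul]
  simp [this]

lemma AreIsogenous.trans {d e : ℕ} {x : ModularCurve Γ} {y : ModularCurve Γ'}
    {z : ModularCurve Γ''} (h : AreIsogenous d x y) (h' : AreIsogenous e y z) :
    AreIsogenous (d * e) x z := by
  obtain ⟨M, hM, τ, hd, rfl, rfl⟩ := areIsogenous_iff.1 h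
  obtain ⟨M', hM', τ', hd', hy, rfl⟩ := areIsogenous_iff.1 h'
  obtain ⟨γ, -, rfl⟩ := quotMap_eq_iff.1 hy
  have hγ : 0 < (γ : Matrix (Fin 2) (Fin 2) ℤ).det := by rw [γ.det_coe]; exact one_pos
  have h1 : 0 < (M * (γ : Matrix (Fin 2) (Fin 2) ℤ)).det := by rw [Matrix.det_mul]; positivity
  have h2 : 0 < (M * (γ : Matrix (Fin 2) (Fin 2) ℤ) * M').det := by rw [Matrix.det_mul]; positivity
  refine areIsogenous_iff.2 ⟨M * γ * M', h2, τ', ?_, ?_, rfl⟩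
  · rw [Matrix.det_mul, Matrix.det_mul, γ.det_coe, hd, hd']
    push_cast
    ring
  · rw [ofInt_mul h1 hM', ofInt_mul hM hγ, ofInt_coe_SL, mul_smul, mul_smul, ofSL_smul]

/-- Points on a Hecke correspondence are isogenous, of constant degree. -/
lemma exists_areIsogenous (g h : GL(2, ℚ)⁺) : ∃ d : ℕ, 1 ≤ d ∧ ∀ τ : ℍ,
    AreIsogenous d (quotMap Γ (g • τ)) (quotMap Γ' (h • τ)) := by
  obtain ⟨M, hM, hMg⟩ := exists_ofInt_smul_eq (g * h⁻¹)
  obtain ⟨d, hd⟩ := Int.eq_ofNat_of_zero_le hM.le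
  refine ⟨d, by omega, fun τ => areIsogenous_iff.2 ⟨M, hM, h • τ, hd, ?_, rfl⟩⟩
  rw [hMg, ← mul_smul, inv_mul_cancel_right]

/-- There are finitely many classes of integral matrices of determinant `d` modulo a congruence
subgroup. -/
lemma exists_finset_ofInt (hΓ : IsCongruenceSubgroup Γ) (d : ℕ) :
    ∃ S : Finset GL(2, ℚ)⁺, ∀ (M : Matrix (Fin 2) (Fin 2) ℤ) (hM : 0 < M.det), M.det = d →
      ∃ s ∈ S, ∃ δ ∈ Γ, ofInt M hM = ofSL δ * s := by
  classical
  obtain ⟨N, hN, hle⟩ := hΓ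
  rcases Nat.eq_zero_or_pos d with rfl | hd0
  · exact ⟨∅, fun M hM h => absurd (h ▸ hM) (by simp)⟩
  have : NeZero (d * N) := ⟨Nat.mul_ne_zero hd0.ne' hN⟩
  let red (M : Matrix (Fin 2) (Fin 2) ℤ) : Matrix (Fin 2) (Fin 2) (ZMod (d * N)) :=
    M.map (Int.cast : ℤ → ZMod (d * N))
  choose! pre hpre using fun (q : Matrix (Fin 2) (Fin 2) (ZMod (d * N)))
    (hq : ∃ M : Matrix (Fin 2) (Fin 2) ℤ, M.det = d ∧ red M = q) => hq
  let mk (M : Matrix (Fin 2) (Fin 2) ℤ) : GL(2, ℚ)⁺ := if h : 0 < M.det then ofInt M h else 1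
  refine ⟨Finset.univ.image fun q => mk (pre q), fun M hM hMd => ?_⟩
  obtain ⟨hP, hPM⟩ := hpre (red M) ⟨M, hMd, rfl⟩
  set P := pre (red M) with hPdef
  have hPpos : 0 < P.det := by rw [hP]; exact_mod_cast hd0
  refine ⟨mk P, Finset.mem_image.2 ⟨red M, Finset.mem_univ _, rfl⟩, ?_⟩
  have hmk : mk P = ofInt P hPpos := dif_pos hPpos
  have hdiv : ∀ i j, ∃ k : ℤ, M i j = P i j + d * N * k := by
    intro i j
    have h : ((P i j : ℤ) : ZMod (d * N)) = (M i j : ℤ) := congrFun (congrFun hPM i) j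
    rw [ZMod.intCast_eq_intCast_iff_dvd_sub] at h
    obtain ⟨k, hk⟩ := h
    exact ⟨k, by push_cast at hk; linarith⟩
  choose K hK using hdiv
  have hMK : M = P + (d * N : ℤ) • Matrix.of K := by
    ext i j
    simp [hK i j]
  set D : Matrix (Fin 2) (Fin 2) ℤ := 1 + (N : ℤ) • (Matrix.of K * P.adjugate) with hD
  have hDP : D * P = M := by
    rw [hD, add_mul, one_mul, Matrix.smul_mul, Matrix.mul_assoc, Matrix.adjugate_mul, hP, hMK,
      Matrix.mul_smul, Matrix.mul_one, smul_smul, mul_comm (N : ℤ)]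
  have hDdet : D.det = 1 := by
    have := congrArg Matrix.det hDP
    rw [Matrix.det_mul, hP, hMd] at this
    exact mul_right_cancel₀ (b := (d : ℤ)) (by exact_mod_cast hd0.ne') (by rw [this, one_mul])
  obtain ⟨δ, hδ⟩ : ∃ δ : SL(2, ℤ), (δ : Matrix (Fin 2) (Fin 2) ℤ) = D := ⟨⟨D, hDdet⟩, rfl⟩
  refine ⟨δ, hle ?_, ?_⟩
  · rw [Gamma_mem]
    have h (i j : Fin 2) : ((δ i j : ℤ) : ZMod N) = (1 : Matrix (Fin 2) (Fin 2) ℤ) i j := by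
      rw [hδ, hD, Matrix.add_apply, Matrix.smul_apply, smul_eq_mul]
      push_cast
      simp
    simp [h]
  · have hδP : (δ : Matrix (Fin 2) (Fin 2) ℤ) * P = M := by rw [hδ, hDP]
    rw [hmk, ← ofInt_coe_SL δ, ← ofInt_mul _ hPpos (by rwa [hδP])]
    congr 1
    exact hδP.symm

/-- The points isogenous of degree `d` to a given one are given by finitely many matrices. -/
lemma exists_finset_areIsogenous (hΓ : IsCongruenceSubgroup Γ) (Γ' : Subgroup SL(2, ℤ)) (d : ℕ) :
    ∃ S : Finset GL(2, ℚ)⁺,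
      (∀ s ∈ S, ∀ τ, AreIsogenous d (quotMap Γ (s • τ)) (quotMap Γ' τ)) ∧
      ∀ (x : ModularCurve Γ) (τ : ℍ), AreIsogenous d x (quotMap Γ' τ) →
        ∃ s ∈ S, x = quotMap Γ (s • τ) := by
  classical
  obtain ⟨S, hS⟩ := exists_finset_ofInt hΓ d
  refine ⟨S.filter fun s => ∀ τ, AreIsogenous d (quotMap Γ (s • τ)) (quotMap Γ' τ),
    fun s hs => (Finset.mem_filter.1 hs).2, fun x τ h => ?_⟩
  obtain ⟨M, hM, τ', hd, rfl, hτ⟩ := areIsogenous_iff.1 h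
  obtain ⟨γ, -, rfl⟩ := quotMap_eq_iff.1 hτ.symm
  have hγ : 0 < (γ : Matrix (Fin 2) (Fin 2) ℤ).det := by rw [γ.det_coe]; exact one_pos
  have h1 : 0 < (M * (γ : Matrix (Fin 2) (Fin 2) ℤ)).det := by rw [Matrix.det_mul]; positivity
  have hd1 : (M * (γ : Matrix (Fin 2) (Fin 2) ℤ)).det = d := by
    rw [Matrix.det_mul, hd, γ.det_coe, mul_one]
  obtain ⟨s, hs, δ, hδ, h⟩ := hS _ h1 hd1
  have hsδ (σ : ℍ) : quotMap Γ (s • σ) = quotMap Γ (ofInt _ h1 • σ) := by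
    rw [h, mul_smul, ofSL_smul, quotMap_smul hδ]
  refine ⟨s, Finset.mem_filter.2 ⟨hs, fun σ => areIsogenous_iff.2 ⟨_, h1, σ, hd1, hsδ σ, rfl⟩⟩, ?_⟩
  rw [← ofSL_smul γ, ← ofInt_coe_SL, ← mul_smul, ← ofInt_mul hM hγ h1, hsδ]

/-! ### Complex multiplication -/

/-- Complex multiplication means that some rational matrix that acts non-trivially on `ℍ` fixes
the point. -/
lemma endRing_ne_bot_iff {τ : ℍ} :
    endRing τ ≠ ⊥ ↔ ∃ h : GL(2, ℚ)⁺, h • τ = τ ∧ ∃ σ : ℍ, h • σ ≠ σ := by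
  constructor
  · intro hne
    obtain ⟨a, ha, hab⟩ := SetLike.exists_of_lt (bot_lt_iff_ne_bot.2 hne)
    obtain ⟨r, s, h1⟩ := mem_lattice_iff.1 (ha 1 (mem_lattice_iff.2 ⟨0, 1, by simp⟩))
    obtain ⟨p, q, h0⟩ := mem_lattice_iff.1 (ha τ (mem_lattice_iff.2 ⟨1, 0, by simp⟩))
    rw [mul_one] at h1
    have hr : r ≠ 0 := by
      rintro rfl
      exact hab (Subring.mem_bot.2 ⟨s, by rw [h1]; simp⟩)
    have ha0 : a ≠ 0 := h1 ▸ linear_ne_zero τ (.inl hr)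
    have hM : 0 < (!![p, q; r, s]).det := det_pos_of_smul_eq (M := !![p, q; r, s]) ha0 h0 h1
    refine ⟨ofInt _ hM, ?_, (1 : ℝ) +ᵥ τ, fun h => ?_⟩
    · apply UpperHalfPlane.ext
      rw [coe_ofInt_smul, div_eq_iff (by simpa [← h1] using ha0), mul_comm _ (_ + _)]
      simpa [← h1] using h0.symm
    · have h := congrArg ((↑) : ℍ → ℂ) h
      have hden : (r : ℂ) * ((1 : ℝ) +ᵥ τ : ℍ) + s ≠ 0 := linear_ne_zero _ (.inl hr)
      rw [coe_ofInt_smul, div_eq_iff (by simpa using hden)] at h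
      simp only [coe_vadd, Matrix.of_apply, Matrix.cons_val', Matrix.cons_val_zero,
        Matrix.cons_val_one, Matrix.cons_val_fin_one] at h
      rw [h1] at h0
      -- the point and its translate cannot be roots of the same real quadratic polynomial
      have h2 : (r : ℂ) * (2 * τ + 1) + s - p = 0 := by
        push_cast at h
        linear_combination -h - h0
      have him := congrArg Complex.im h2
      simp at him
      rcases him with h | h
      · exact hr h
      · exact τ.im_pos.ne' h
  · rintro ⟨h, hτ, σ, hσ⟩ hbot
    obtain ⟨M, hM, hMh⟩ := exists_ofInt_smul_eq h
    have ha : (M 1 0 : ℂ) * τ + M 1 1 ≠ 0 := by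
      refine linear_ne_zero τ ?_
      by_contra! h
      rw [Matrix.det_fin_two, h.1, h.2] at hM
      simp at hM
    have hfix : ((M 1 0 : ℂ) * τ + M 1 1) * τ = M 0 0 * (τ : ℂ) + M 0 1 := by
      have := congrArg ((↑) : ℍ → ℂ) ((hMh τ).trans hτ)
      rw [coe_ofInt_smul, div_eq_iff ha] at this
      rw [mul_comm, this]
    have hmem : (M 1 0 : ℂ) * τ + M 1 1 ∈ endRing τ := by
      intro z hz
      obtain ⟨m, n, rfl⟩ := mem_lattice_iff.1 hz
      refine mem_lattice_iff.2 ⟨m * M 0 0 + n * M 1 0, m * M 0 1 + n * M 1 1, ?_⟩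
      push_cast
      linear_combination (m : ℂ) * hfix
    rw [hbot] at hmem
    obtain ⟨k, hk⟩ := Subring.mem_bot.1 hmem
    have h1 := linear_injective τ (a₁ := ![M 1 0, M 1 1]) (a₂ := ![0, k]) (by simp [hk])
    have h10 : M 1 0 = 0 := congrFun h1 0
    have h11 : M 1 1 = k := congrFun h1 1
    have h2 := linear_injective τ (a₁ := ![M 0 0, M 0 1]) (a₂ := ![k, 0])
      (by simp [← hfix, hk])
    have h00 : M 0 0 = k := congrFun h2 0
    have h01 : M 0 1 = 0 := congrFun h2 1
    apply hσ
    rw [← hMh σ]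
    apply UpperHalfPlane.ext
    have hk0 : (k : ℂ) ≠ 0 := by
      rw [h10, h11] at ha
      simpa using ha
    rw [coe_ofInt_smul, h00, h01, h10, h11]
    simp [hk0]

lemma endRing_smul_ne_bot (g : GL(2, ℚ)⁺) {τ : ℍ} (h : endRing τ ≠ ⊥) : endRing (g • τ) ≠ ⊥ := by
  obtain ⟨h, hτ, σ, hσ⟩ := endRing_ne_bot_iff.1 h
  refine endRing_ne_bot_iff.2 ⟨g * h * g⁻¹, ?_, g • σ, ?_⟩
  · simp [mul_smul, hτ]
  · simpa [mul_smul] using hσ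

lemma endRing_smul_ne_bot_iff (g : GL(2, ℚ)⁺) {τ : ℍ} : endRing (g • τ) ≠ ⊥ ↔ endRing τ ≠ ⊥ :=
  ⟨fun h => by simpa using endRing_smul_ne_bot g⁻¹ h, endRing_smul_ne_bot g⟩

lemma isCMPoint_quotMap_iff {τ : ℍ} : IsCMPoint (quotMap Γ τ) ↔ endRing τ ≠ ⊥ := by
  constructor
  · rintro ⟨τ', h, hτ'⟩
    obtain ⟨γ, -, rfl⟩ := quotMap_eq_iff.1 h
    rwa [← ofSL_smul, endRing_smul_ne_bot_iff] at hτ'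
  · exact fun h => ⟨τ, rfl, h⟩

/-- Two rational matrices that agree at a point without complex multiplication act in the same
way. -/
lemma smul_eq_smul_of_endRing_eq_bot {τ : ℍ} (hτ : endRing τ = ⊥) {g h : GL(2, ℚ)⁺}
    (hgh : g • τ = h • τ) (σ : ℍ) : g • σ = h • σ := by
  by_contra hne
  refine endRing_ne_bot_iff.2 ⟨h⁻¹ * g, ?_, σ, ?_⟩ hτ
  · rw [mul_smul, hgh, inv_smul_smul]
  · rw [mul_smul, Ne, inv_smul_eq_iff]
    exact hne

end

noncomputable section

/-! ### Irreducible sets with constant or isogenous coordinates -/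

variable {ι : Type*} {Γ : ι → Subgroup SL(2, ℤ)} {κ : Type*} {A : Set ι}
  {c : ModularProduct Γ} {b : ι → κ} {g : ι → GL(2, ℚ)⁺} {Z : Set (ModularProduct Γ)}

lemma exists_subset_of_subset_biUnion {X α : Type*} [TopologicalSpace X] {Z : Set X}
    (hZ : _root_.IsIrreducible Z) {s : Set α} (hs : s.Finite) {F : α → Set X}
    (hF : ∀ a ∈ s, IsClosed (F a)) (h : Z ⊆ ⋃ a ∈ s, F a) : ∃ a ∈ s, Z ⊆ F a := by
  classical
  obtain ⟨W, hW, hZW⟩ := isIrreducible_iff_sUnion_isClosed.1 hZ (hs.toFinset.image F)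
    (by simpa using hF) (by simpa using h)
  obtain ⟨a, ha, rfl⟩ := Finset.mem_image.1 hW
  exact ⟨a, by simpa using ha, hZW⟩

/-- If coordinates with the same value of `b` are isogenous of bounded degree on an irreducible
set, then this set is contained in a single product of Hecke correspondences: isogenies of
degree `d` give finitely many Hecke correspondences. -/
lemma exists_subset_heckeSet [Finite ι] (hΓ : ∀ i, IsCongruenceSubgroup (Γ i))
    (hZ : _root_.IsIrreducible Z) (hc : ∀ x ∈ Z, ∀ i ∈ A, x i = c i)
    (hb : ∀ i ∉ A, ∀ j ∉ A, b i = b j → ∃ d, ∀ x ∈ Z, AreIsogenous d (x i) (x j)) :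
    ∃ g : ι → GL(2, ℚ)⁺, Z ⊆ heckeSet A c b g := by
  rcases isEmpty_or_nonempty ι with hι | hι
  · exact ⟨1, fun x hx => ⟨hc x hx, fun _ => I, fun i => isEmptyElim i⟩⟩
  choose! r hrA hrb using fun (k : κ) (hk : ∃ i, i ∉ A ∧ b i = k) => hk
  have hS : ∀ i, ∃ S : Finset GL(2, ℚ)⁺, (i ∈ A → 1 ∈ S) ∧ (i ∉ A → ∀ x ∈ Z, ∀ τ,
      x (r (b i)) = quotMap _ τ → ∃ s ∈ S, x i = quotMap _ (s • τ)) := by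
    intro i
    by_cases hi : i ∈ A
    · exact ⟨{1}, fun _ => Finset.mem_singleton_self 1, fun h => absurd hi h⟩
    · obtain ⟨d, hd⟩ := hb i hi (r (b i)) (hrA _ ⟨i, hi, rfl⟩) (hrb _ ⟨i, hi, rfl⟩).symm
      obtain ⟨S, -, hS⟩ := exists_finset_areIsogenous (hΓ i) (Γ (r (b i))) d
      exact ⟨S, fun h => absurd h hi, fun _ x hx τ hτ => hS _ _ (hτ ▸ hd x hx)⟩
  choose S hS1 hS2 using hS
  obtain ⟨g, -, hg⟩ := exists_subset_of_subset_biUnion hZ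
    (Set.Finite.pi' fun i => (S i).finite_toSet) (F := heckeSet A c b)
    (fun g _ => isClosed_heckeSet hΓ) (fun x hx => by
      choose τ hτ using fun k => quotMap_surjective (Γ (r k)) (x (r k))
      have : ∀ i, ∃ s ∈ S i, i ∉ A → x i = quotMap _ (s • τ (b i)) := by
        intro i
        by_cases hi : i ∈ A
        · exact ⟨1, hS1 i hi, fun h => absurd hi h⟩
        · obtain ⟨s, hs, h⟩ := hS2 i hi x hx _ (hτ (b i)).symm
          exact ⟨s, hs, fun _ => h⟩
      choose s hs hxs using this
      exact Set.mem_iUnion₂.2 ⟨s, hs, hc x hx, τ, hxs⟩)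
  exact ⟨g, hg⟩

/-- Coordinates that are isogenous to a constant coordinate are constant. -/
lemma coord_eq_of_areIsogenous (hΓ : ∀ i, IsCongruenceSubgroup (Γ i))
    (hZ : _root_.IsIrreducible Z) {i j : ι} {d : ℕ} {a : ModularCurve (Γ i)}
    (ha : ∀ x ∈ Z, x i = a) (h : ∀ x ∈ Z, AreIsogenous d (x j) (x i)) :
    ∃ a' : ModularCurve (Γ j), ∀ x ∈ Z, x j = a' := by
  obtain ⟨τ, rfl⟩ := quotMap_surjective (Γ i) a
  obtain ⟨S, -, hS⟩ := exists_finset_areIsogenous (hΓ j) (Γ i) d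
  obtain ⟨s, -, hs⟩ := exists_subset_of_subset_biUnion hZ S.finite_toSet
    (F := fun s => {x | x j = quotMap (Γ j) (s • τ)}) (fun s _ => isClosed_coord_eq hΓ j _)
    (fun x hx => by
      obtain ⟨s, hs, h⟩ := hS _ _ (ha x hx ▸ h x hx)
      exact Set.mem_iUnion₂.2 ⟨s, hs, h⟩)
  exact ⟨_, hs⟩

/-- The relation between coordinates of being isogenous, of constant degree, on a given set. -/
def isogenySetoid (Z : Set (ModularProduct Γ)) : Setoid ι where
  r i j := ∃ d, 1 ≤ d ∧ ∀ x ∈ Z, AreIsogenous d (x i) (x j)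
  iseqv :=
    { refl := fun i => ⟨1, le_rfl, fun x _ => AreIsogenous.refl (x i)⟩
      symm := fun ⟨d, hd, h⟩ => ⟨d, hd, fun x hx => (h x hx).symm⟩
      trans := fun ⟨d, hd, h⟩ ⟨e, he, h'⟩ =>
        ⟨d * e, Nat.mul_pos hd he, fun x hx => (h x hx).trans (h' x hx)⟩ }

/-- The class of a coordinate for the isogeny relation. -/
def isogenyClass (Z : Set (ModularProduct Γ)) (i : ι) : Quotient (isogenySetoid Z) :=
  Quotient.mk _ i

lemma isogenyClass_eq_iff {i j : ι} : isogenyClass Z i = isogenyClass Z j ↔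
    ∃ d, 1 ≤ d ∧ ∀ x ∈ Z, AreIsogenous d (x i) (x j) :=
  Quotient.eq

/-! ### Dense projections -/

/-- The projection of `Z` to the coordinates in `T` is Zariski dense. -/
def IsDominant (Z : Set (ModularProduct Γ)) (T : Set ι) : Prop :=
  closure (proj T '' Z) = Set.univ

lemma isDominant_iff {T : Set ι} :
    IsDominant Z T ↔ ∀ G ∈ coordRingOn Γ T, (∀ z ∈ Z, G z = 0) → G = 0 :=
  closure_proj_eq_univ_iff

lemma isDominant_empty (hZ : Z.Nonempty) : IsDominant Z (∅ : Set ι) := by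
  obtain ⟨z, hz⟩ := hZ
  refine Set.eq_univ_of_forall fun y => subset_closure ⟨z, hz, funext fun i => i.2.elim⟩

lemma not_isDominant_of_coord_eq (hΓ : ∀ i, IsCongruenceSubgroup (Γ i)) {i : ι}
    {a : ModularCurve (Γ i)} (h : ∀ x ∈ Z, x i = a) : ¬ IsDominant Z {i} := by
  intro hd
  obtain ⟨a', ha'⟩ := exists_ne a
  obtain ⟨f, hf, hf0, hf1⟩ := exists_isRegularFunction_separating (hΓ i) ha'.symm
  classical
  have := isDominant_iff.1 hd _ (coord_mem (Set.mem_singleton i) hf)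
    fun x hx => by simp only [h x hx, hf0]
  have h1 := congrFun this (Function.update (fun i => quotMap (Γ i) I) i a')
  simp only [Function.update_self] at h1
  exact hf1 h1

lemma isClosed_singleton_modularProduct (hΓ : ∀ i, IsCongruenceSubgroup (Γ i))
    (x : ModularProduct Γ) : IsClosed ({x} : Set (ModularProduct Γ)) := by
  have : ({x} : Set (ModularProduct Γ)) = ⋂ i, {y | y i = x i} := by
    ext y
    simp only [Set.mem_singleton_iff, Set.mem_iInter, Set.mem_ofPred_eq]
    exact ⟨fun h i => h ▸ rfl, fun h => funext h⟩
  rw [this]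
  exact isClosed_iInter fun i => isClosed_coord_eq hΓ i _

/-- Irreducible proper closed subsets of a curve are points. -/
lemma exists_coord_eq_of_not_isDominant (hΓ : ∀ i, IsCongruenceSubgroup (Γ i))
    (hZ : _root_.IsIrreducible Z) {i : ι} (h : ¬ IsDominant Z {i}) :
    ∃ a : ModularCurve (Γ i), ∀ x ∈ Z, x i = a := by
  obtain ⟨z, hz⟩ := hZ.nonempty
  refine ⟨z i, fun x hx => ?_⟩
  by_contra hne
  set X := ModularProduct fun j : ({i} : Set ι) => Γ j
  have hΓ' : ∀ j : ({i} : Set ι), IsCongruenceSubgroup (Γ j) := fun j => hΓ j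
  let F₀ : TopologicalSpace.IrreducibleCloseds X :=
    ⟨{proj {i} z}, isIrreducible_singleton, isClosed_singleton_modularProduct hΓ' _⟩
  let F₁ : TopologicalSpace.IrreducibleCloseds X :=
    ⟨closure (proj {i} '' Z), (hZ.image _ (continuous_proj _).continuousOn).closure,
      isClosed_closure⟩
  let F₂ : TopologicalSpace.IrreducibleCloseds X :=
    ⟨Set.univ, isIrreducible_univ hΓ', isClosed_univ⟩
  have h01 : F₀ < F₁ := by
    refine lt_of_le_not_ge ?_ fun hle => hne ?_
    · rintro _ rfl
      exact subset_closure ⟨z, hz, rfl⟩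
    · have : proj {i} x ∈ F₀ := hle (subset_closure ⟨x, hx, rfl⟩)
      exact congrFun (show proj {i} x = proj {i} z from this) ⟨i, rfl⟩
  have h12 : F₁ < F₂ := by
    refine lt_of_le_not_ge (fun x _ => Set.mem_univ x) fun hle => h ?_
    exact Set.eq_univ_of_forall fun x => hle (Set.mem_univ x)
  have hmono : StrictMono ![F₀, F₁, F₂] := by
    refine Fin.strictMono_iff_lt_succ.2 fun k => ?_
    fin_cases k
    · exact h01
    · exact h12
  have := Order.LTSeries.length_le_krullDim (LTSeries.mk 2 _ hmono)
  rw [← topologicalKrullDim, topologicalKrullDim_modularProduct hΓ'] at this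
  simp at this

/-- If `Z` has dense projection to the coordinates in `T`, then equations for `Z` in the coordinates
with index in `J` hold on the whole product of points and Hecke correspondences, provided that each
Hecke correspondence that involves a coordinate in `J` also involves one in `T`. -/
lemma eq_zero_of_isDominant [Finite κ] (hΓ : ∀ i, IsCongruenceSubgroup (Γ i)) {J T : Set ι}
    (hT : ∀ i ∈ J, i ∉ A → ∃ i' ∈ T, i' ∉ A ∧ b i' = b i) (hZ : Z ⊆ heckeSet A c b g)
    (hd : IsDominant Z T) {F : ModularProduct Γ → ℂ} (hF : F ∈ coordRingOn Γ J)
    (hFZ : ∀ z ∈ Z, F z = 0) : ∀ z ∈ heckeSet A c b g, F z = 0 :=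
  eq_zero_of_dominant hΓ hT hZ
    (fun G hG h z _ => congrFun (isDominant_iff.1 hd G hG h) z) hF hFZ

lemma heckeSet_subset_of_isDominant [Finite κ] (hΓ : ∀ i, IsCongruenceSubgroup (Γ i)) {T : Set ι}
    (hT : ∀ i ∉ A, ∃ i' ∈ T, i' ∉ A ∧ b i' = b i) (hZ : Z ⊆ heckeSet A c b g)
    (hd : IsDominant Z T) (hZc : IsClosed Z) : heckeSet A c b g ⊆ Z := by
  intro x hx
  by_contra hxZ
  obtain ⟨F, hF, hFZ, hFx⟩ := isClosed_iff_exists_ne_zero.1 hZc x hxZ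
  rw [← coordRingOn_univ] at hF
  exact hFx (eq_zero_of_isDominant hΓ (fun i _ => hT i) hZ hd hF hFZ x hx)

lemma proj_heckeSet_eq_univ {T : Set ι} (hTA : ∀ i ∈ T, i ∉ A) (hTb : Set.InjOn b T) :
    proj T '' heckeSet A c b g = Set.univ := by
  classical
  refine Set.eq_univ_of_forall fun y => ?_
  choose τ hτ using fun i : T => quotMap_surjective (Γ i) (y i)
  let t : κ → ℍ := fun k => if h : ∃ i : T, b i = k then (g h.choose)⁻¹ • τ h.choose else I
  refine ⟨heckeMap A c b g t, heckeMap_mem t, funext fun i => ?_⟩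
  have h : ∃ i' : T, b i' = b i := ⟨i, rfl⟩
  have hi : h.choose = i := Subtype.ext (hTb h.choose.2 i.2 h.choose_spec)
  have ht : t (b i) = (g i)⁻¹ • τ i := by
    simp only [t, dif_pos h]
    rw [hi]
  change heckeMap A c b g t i = y i
  simp only [heckeMap, hTA i i.2, if_false, ht, smul_inv_smul, hτ]

lemma isDominant_heckeSet {T : Set ι} (hTA : ∀ i ∈ T, i ∉ A) (hTb : Set.InjOn b T) :
    IsDominant (heckeSet A c b g) T := by
  rw [IsDominant, proj_heckeSet_eq_univ hTA hTb, closure_univ]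

/-- A set of representatives, not in `A`, of the Hecke correspondences. -/
lemma exists_transversal (A : Set ι) (b : ι → κ) : ∃ T : Set ι, (∀ i ∈ T, i ∉ A) ∧
    Set.InjOn b T ∧ ∀ i ∉ A, ∃ i' ∈ T, i' ∉ A ∧ b i' = b i := by
  rcases isEmpty_or_nonempty ι with hι | hι
  · exact ⟨∅, fun i => isEmptyElim i, Set.injOn_empty b, fun i => isEmptyElim i⟩
  choose! r hrA hrb using fun (k : κ) (hk : ∃ i, i ∉ A ∧ b i = k) => hk
  refine ⟨{i | i ∉ A ∧ r (b i) = i}, fun i hi => hi.1, fun i hi j hj h => ?_, fun i hi => ?_⟩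
  · rw [← hi.2, h, hj.2]
  · have hb := hrb _ ⟨i, hi, rfl⟩
    have hA := hrA _ ⟨i, hi, rfl⟩
    exact ⟨r (b i), ⟨hA, by rw [hb]⟩, hA, hb⟩

/-- Products of Hecke correspondences of the same shape do not strictly contain each other. -/
lemma heckeSet_subset_of_subset [Finite ι] [Finite κ] (hΓ : ∀ i, IsCongruenceSubgroup (Γ i))
    {g' : ι → GL(2, ℚ)⁺} (h : heckeSet A c b g ⊆ heckeSet A c b g') :
    heckeSet A c b g' ⊆ heckeSet A c b g := by
  obtain ⟨T, hTA, hTb, hT⟩ := exists_transversal A b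
  exact heckeSet_subset_of_isDominant hΓ hT h (isDominant_heckeSet hTA hTb) (isClosed_heckeSet hΓ)

/-- Two coordinates on one Hecke correspondence are algebraically dependent. -/
lemma not_isDominant_pair [Finite ι] (hΓ : ∀ i, IsCongruenceSubgroup (Γ i)) {i j : ι}
    (hij : i ≠ j) (hi : i ∉ A) (hj : j ∉ A) (hb : b i = b j) :
    ¬ IsDominant (heckeSet A c b g) {i, j} := by
  classical
  intro hd
  -- for a fixed coordinate `j`, only countably many points are on the Hecke correspondence
  have hcount : ((fun τ => quotMap (Γ i) (g i • (g j)⁻¹ • τ)) ''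
      {τ : ℍ | quotMap (Γ j) τ = quotMap (Γ j) I}).Countable :=
    (countable_fiber_quotMap _ _).image _
  have hne : ((fun τ => quotMap (Γ i) (g i • (g j)⁻¹ • τ)) ''
      {τ : ℍ | quotMap (Γ j) τ = quotMap (Γ j) I}) ≠ Set.univ := fun h =>
    Set.not_countable_univ (by rwa [h] at hcount)
  obtain ⟨a, ha⟩ := (Set.ne_univ_iff_exists_notMem _).1 hne
  have hx : Function.update (fun i => quotMap (Γ i) I) i a ∉ heckeOn Γ {i, j} g := by
    rintro ⟨τ, hτ⟩
    have h1 := hτ i (by simp)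
    have h2 := hτ j (by simp)
    rw [Function.update_self] at h1
    rw [Function.update_of_ne hij.symm] at h2
    exact ha ⟨g j • τ, h2.symm, by simp [h1]⟩
  obtain ⟨F, hF, hFS, hFx⟩ := exists_separating_heckeOn hΓ hx
  refine hFx (congrFun (isDominant_iff.1 hd F hF ?_) _)
  rintro y ⟨-, t, ht⟩
  refine hFS y ⟨t (b i), ?_⟩
  rintro k (rfl | rfl)
  · exact ht _ hi
  · rw [hb]
    exact ht _ hj

lemma exists_isMinimalFor [Finite ι] (hΓ : ∀ i, IsCongruenceSubgroup (Γ i)) {T : Set ι}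
    (h : ¬ IsDominant Z T) : ∃ J ⊆ T, IsMinimalFor J Z ∧ ¬ IsDominant Z J := by
  obtain ⟨J, hJT, hJ⟩ := exists_minimal_le_of_wellFoundedLT (fun J => ¬ IsDominant Z J) T h
  refine ⟨J, hJT, ⟨(dimProj_lt_iff hΓ).2 hJ.prop, fun J' hJ' => (dimProj_eq_iff hΓ).2 ?_⟩, hJ.prop⟩
  by_contra hn
  exact hJ.not_lt hn hJ'

/-! ### Projections of special subvarieties -/

lemma isSpecial_proj [Finite ι] (hΓ : ∀ i, IsCongruenceSubgroup (Γ i)) (hZ : IsSpecial Z)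
    (T : Set ι) : IsSpecial (proj T '' Z) := by
  obtain ⟨A, c, b, g, hc, rfl⟩ := hZ.exists_eq_heckeSet
  rw [proj_image_heckeSet]
  exact isSpecial_heckeSet (fun i => hΓ i) fun i hi => hc i hi

/-- Constant coordinates on special subvarieties are CM points. -/
lemma IsSpecial.isCMPoint (hZ : IsSpecial Z) {i : ι} {a : ModularCurve (Γ i)}
    (h : ∀ x ∈ Z, x i = a) : IsCMPoint a := by
  obtain ⟨A, c, b, g, hc, rfl⟩ := hZ.exists_eq_heckeSet
  by_cases hi : i ∈ A
  · obtain ⟨x, hx⟩ := heckeSet_nonempty (A := A) (c := c) (b := b) (g := g)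
    rw [← h x hx, hx.1 i hi]
    exact hc i hi
  · obtain ⟨a', ha'⟩ := exists_ne a
    obtain ⟨τ, rfl⟩ := quotMap_surjective (Γ i) a'
    refine absurd ?_ ha'
    rw [← h _ (heckeMap_mem fun _ => (g i)⁻¹ • τ)]
    simp [heckeMap, hi]

/-- Two non-constant coordinates that satisfy an equation, for which the closure of the projection
is special, are isogenous. -/
lemma isogenyClass_eq_of_isSpecial (hΓ : ∀ i, IsCongruenceSubgroup (Γ i))
    {i j : ι} (hi : IsDominant Z {i}) (hj : IsDominant Z {j})
    (hs : IsSpecial (closure (proj {i, j} '' Z))) (hij : ¬ IsDominant Z {i, j}) :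
    isogenyClass Z i = isogenyClass Z j := by
  obtain ⟨A, c, b, g, -, h⟩ := hs.exists_eq_heckeSet
  have hmem (x) (hx : x ∈ Z) : proj {i, j} x ∈ heckeSet A c b g := h ▸ subset_closure ⟨x, hx, rfl⟩
  set i' : ({i, j} : Set ι) := ⟨i, by simp⟩
  set j' : ({i, j} : Set ι) := ⟨j, by simp⟩
  have hiA : i' ∉ A := fun hA => not_isDominant_of_coord_eq hΓ
    (fun x hx => (hmem x hx).1 i' hA) hi
  have hjA : j' ∉ A := fun hA => not_isDominant_of_coord_eq hΓ
    (fun x hx => (hmem x hx).1 j' hA) hj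
  by_cases hb : b i' = b j'
  · obtain ⟨d, hd1, hd⟩ := exists_areIsogenous (Γ := Γ i) (Γ' := Γ j) (g i') (g j')
    refine isogenyClass_eq_iff.2 ⟨d, hd1, fun x hx => ?_⟩
    obtain ⟨-, t, ht⟩ := hmem x hx
    have h1 : x i = _ := ht i' hiA
    have h2 : x j = _ := ht j' hjA
    rw [h1, h2, hb]
    exact hd _
  · refine absurd ?_ hij
    have hcases : ∀ k : ({i, j} : Set ι), k = i' ∨ k = j' := by
      rintro ⟨k, rfl | rfl⟩
      · exact .inl rfl
      · exact .inr rfl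
    have hA (k) : k ∉ A := by
      rcases hcases k with rfl | rfl
      · exact hiA
      · exact hjA
    have hinj : Function.Injective b := by
      intro k l hkl
      rcases hcases k with rfl | rfl <;> rcases hcases l with rfl | rfl
      · rfl
      · exact absurd hkl hb
      · exact absurd hkl.symm hb
      · rfl
    rw [IsDominant, h]
    refine Set.eq_univ_of_forall fun y => ?_
    have hy : proj Set.univ y ∈ proj Set.univ '' heckeSet A c b g := by
      rw [proj_heckeSet_eq_univ (fun k _ => hA k) hinj.injOn]
      exact Set.mem_univ _
    obtain ⟨y', hy', h'⟩ := hy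
    have : y' = y := funext fun k => congrFun h' ⟨k, Set.mem_univ k⟩
    exact this ▸ hy'

end

noncomputable section

/-! ### Characterizations of special subvarieties -/

variable {ι : Type*} {Γ : ι → Subgroup SL(2, ℤ)} {Z : Set (ModularProduct Γ)}

lemma IsMinimalFor.not_isDominant [Finite ι] (hΓ : ∀ i, IsCongruenceSubgroup (Γ i)) {J : Set ι}
    (h : IsMinimalFor J Z) : ¬ IsDominant Z J :=
  (dimProj_lt_iff hΓ).1 h.1

lemma IsMinimalFor.isDominant [Finite ι] (hΓ : ∀ i, IsCongruenceSubgroup (Γ i)) {J J' : Set ι}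
    (h : IsMinimalFor J Z) (hJ : J' ⊂ J) : IsDominant Z J' :=
  (dimProj_eq_iff hΓ).1 (h.2 J' hJ)

lemma IsMinimalFor.eq_of_subset [Finite ι] (hΓ : ∀ i, IsCongruenceSubgroup (Γ i)) {J J' : Set ι}
    (h : IsMinimalFor J Z) (hJ : J' ⊆ J) (h' : ¬ IsDominant Z J') : J' = J := by
  by_contra hne
  exact h' (h.isDominant hΓ (hJ.ssubset_of_ne hne))

/-- The equations of a special subvariety are generated by equations in at most two coordinates. -/
lemma IsSpecial.ncard_le_two [Finite ι] (hΓ : ∀ i, IsCongruenceSubgroup (Γ i)) (hZ : IsSpecial Z)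
    {J : Set ι} (hJ : IsMinimalFor J Z) : J.ncard ≤ 2 := by
  obtain ⟨A, c, b, g, hc, rfl⟩ := hZ.exists_eq_heckeSet
  by_cases hA : ∃ i ∈ J, i ∈ A
  · obtain ⟨i, hi, hiA⟩ := hA
    rw [← hJ.eq_of_subset hΓ (Set.singleton_subset_iff.2 hi)
      (not_isDominant_of_coord_eq hΓ fun x hx => hx.1 i hiA), Set.ncard_singleton]
    exact one_le_two
  push Not at hA
  by_cases hb : Set.InjOn b J
  · exact absurd (isDominant_heckeSet hA hb) (hJ.not_isDominant hΓ)
  · simp only [Set.InjOn, not_forall] at hb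
    obtain ⟨i, hi, j, hj, hij, hne⟩ := hb
    rw [← hJ.eq_of_subset hΓ (Set.insert_subset hi (Set.singleton_subset_iff.2 hj))
      (not_isDominant_pair hΓ hne (hA i hi) (hA j hj) hij)]
    exact Set.ncard_pair hne |>.le

/-- The coordinates that are constant on an irreducible set and their values. -/
lemma exists_const_coords (hΓ : ∀ i, IsCongruenceSubgroup (Γ i)) (hZ : _root_.IsIrreducible Z) :
    ∃ c : ModularProduct Γ, ∀ x ∈ Z, ∀ i ∈ {i | ¬ IsDominant Z {i}}, x i = c i := by
  obtain ⟨z, hz⟩ := hZ.nonempty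
  refine ⟨z, fun x hx i hi => ?_⟩
  obtain ⟨a, ha⟩ := exists_coord_eq_of_not_isDominant hΓ hZ hi
  rw [ha x hx, ha z hz]

/-- An irreducible set lies in the product of points and Hecke correspondences that is defined by
its constant coordinates and the isogenies between its coordinates. -/
lemma exists_subset_heckeSet_isogenyClass [Finite ι] (hΓ : ∀ i, IsCongruenceSubgroup (Γ i))
    (hZ : _root_.IsIrreducible Z) : ∃ (c : ModularProduct Γ) (g : ι → GL(2, ℚ)⁺),
      Z ⊆ heckeSet {i | ¬ IsDominant Z {i}} c (isogenyClass Z) g := by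
  obtain ⟨c, hc⟩ := exists_const_coords hΓ hZ
  refine ⟨c, exists_subset_heckeSet hΓ hZ hc fun i _ j _ h => ?_⟩
  obtain ⟨d, -, hd⟩ := isogenyClass_eq_iff.1 h
  exact ⟨d, hd⟩

/-- If all minimal sets of coordinates are as stated, then `Z` has dense projection to a set of
representatives of the isogeny classes of its non-constant coordinates: a minimal set among them
would be a pair of isogenous coordinates. -/
theorem isSpecial_iff_forall_isMinimalFor [Finite ι] (hΓ : ∀ i, IsCongruenceSubgroup (Γ i))
    (hZc : IsClosed Z) (hZ : _root_.IsIrreducible Z) : IsSpecial Z ↔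
      ∀ J : Set ι, IsMinimalFor J Z → J.ncard ≤ 2 ∧ IsSpecial (closure (proj J '' Z)) := by
  constructor
  · intro h J hJ
    refine ⟨h.ncard_le_two hΓ hJ, ?_⟩
    have := isSpecial_proj hΓ h J
    rwa [this.1.closure_eq]
  · intro h
    obtain ⟨c, g, hsub⟩ := exists_subset_heckeSet_isogenyClass hΓ hZ
    obtain ⟨T, hTA, hTb, hT⟩ := exists_transversal {i | ¬ IsDominant Z {i}} (isogenyClass Z)
    have hdom : IsDominant Z T := by
      by_contra hn
      obtain ⟨J, hJT, hJ, hJd⟩ := exists_isMinimalFor hΓ hn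
      obtain ⟨hcard, hspec⟩ := h J hJ
      have hne : J.ncard ≠ 0 := by
        rw [Ne, Set.ncard_eq_zero]
        rintro rfl
        exact hJd (isDominant_empty hZ.nonempty)
      rcases (by omega : J.ncard = 1 ∨ J.ncard = 2) with h1 | h2
      · obtain ⟨i, rfl⟩ := Set.ncard_eq_one.1 h1
        exact hTA i (hJT rfl) hJd
      · obtain ⟨i, j, hij, rfl⟩ := Set.ncard_eq_two.1 h2
        have hi := hJT (Set.mem_insert i {j})
        have hj := hJT (Set.mem_insert_of_mem i (Set.mem_singleton j))
        exact hij (hTb hi hj (isogenyClass_eq_of_isSpecial hΓ (not_not.1 (hTA i hi))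
          (not_not.1 (hTA j hj)) hspec hJd))
    rw [hsub.antisymm (heckeSet_subset_of_isDominant hΓ hT hsub hdom hZc)]
    refine isSpecial_heckeSet hΓ fun i hi => ?_
    obtain ⟨J, hJi, hJ, hJd⟩ := exists_isMinimalFor hΓ hi
    have hJne : J ≠ ∅ := by
      rintro rfl
      exact hJd (isDominant_empty hZ.nonempty)
    obtain rfl := (Set.subset_singleton_iff_eq.1 hJi).resolve_left hJne
    refine (h _ hJ).2.isCMPoint (i := (⟨i, rfl⟩ : ({i} : Set ι))) fun x hx => ?_
    have hcl := isClosed_coord_eq (Γ := fun k : ({i} : Set ι) => Γ k) (fun k => hΓ k) ⟨i, rfl⟩ (c i)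
    exact closure_minimal (by rintro _ ⟨z, hz, rfl⟩; exact (hsub hz).1 i hi) hcl hx

/-- A product of CM points and Hecke correspondences is a component of each locus on which its
coordinates with index in `A` have the given values and its coordinates on the same Hecke
correspondence are isogenous of constant degree. -/
lemma isIrredComponentOf_heckeSet [Finite ι] (hΓ : ∀ i, IsCongruenceSubgroup (Γ i)) {κ : Type*}
    [Finite κ] {A : Set ι} {c : ModularProduct Γ} {b : ι → κ} {g : ι → GL(2, ℚ)⁺}
    {W : Set (ModularProduct Γ)} (hW : heckeSet A c b g ⊆ W)
    (hWA : ∀ x ∈ W, ∀ i ∈ A, x i = c i)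
    (hWb : ∀ i ∉ A, ∀ j ∉ A, i ≠ j → b i = b j → ∃ d, ∀ x ∈ W, AreIsogenous d (x i) (x j)) :
    IsIrredComponentOf (heckeSet A c b g) W := by
  refine ⟨⟨isIrreducible_heckeSet hΓ, hW⟩, fun V ⟨hV, hVW⟩ hle => ?_⟩
  obtain ⟨g', hg'⟩ := exists_subset_heckeSet (A := A) (c := c) (b := b) hΓ hV
    (fun x hx => hWA x (hVW hx)) (fun i hi j hj h => by
      by_cases hij : i = j
      · subst hij
        exact ⟨1, fun x _ => AreIsogenous.refl _⟩
      · obtain ⟨d, hd⟩ := hWb i hi j hj hij h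
        exact ⟨d, fun x hx => hd x (hVW hx)⟩)
  exact hg'.trans (heckeSet_subset_of_subset hΓ (Set.Subset.trans hle hg'))

/-- By integrality, the equations in at most two coordinates that hold on `Z` hold on the smallest
product of points and Hecke correspondences that contains `Z`. -/
theorem isSpecial_iff_isIrredComponentOf_iInter [Finite ι] (hΓ : ∀ i, IsCongruenceSubgroup (Γ i))
    (hZ : _root_.IsIrreducible Z) : IsSpecial Z ↔
      (∀ J : Set ι, J.ncard = 1 ∨ J.ncard = 2 → IsSpecial (proj J '' Z)) ∧
        IsIrredComponentOf Z
          (⋂ J ∈ {J : Set ι | J.ncard = 1 ∨ J.ncard = 2}, proj J ⁻¹' (proj J '' Z)) := by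
  constructor
  · intro h
    refine ⟨fun J _ => isSpecial_proj hΓ h J, ?_⟩
    obtain ⟨A, c, b, g, hc, rfl⟩ := h.exists_eq_heckeSet
    refine isIrredComponentOf_heckeSet hΓ ?_ ?_ ?_
    · exact fun x hx => Set.mem_iInter₂.2 fun J _ => ⟨x, hx, rfl⟩
    · intro x hx i hi
      obtain ⟨z, hz, hzx⟩ := Set.mem_iInter₂.1 hx {i} (.inl (Set.ncard_singleton i))
      have : z i = x i := congrFun hzx ⟨i, rfl⟩
      rw [← this, hz.1 i hi]
    · intro i hi j hj hij hb
      obtain ⟨d, -, hd⟩ := exists_areIsogenous (Γ := Γ i) (Γ' := Γ j) (g i) (g j)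
      refine ⟨d, fun x hx => ?_⟩
      obtain ⟨z, ⟨-, t, ht⟩, hzx⟩ := Set.mem_iInter₂.1 hx {i, j} (.inr (Set.ncard_pair hij))
      have h1 : z i = x i := congrFun hzx ⟨i, by simp⟩
      have h2 : z j = x j := congrFun hzx ⟨j, by simp⟩
      rw [← h1, ← h2, ht i hi, ht j hj, hb]
      exact hd _
  · rintro ⟨hspec, hcomp⟩
    obtain ⟨c, g, hsub⟩ := exists_subset_heckeSet_isogenyClass hΓ hZ
    set A := {i | ¬ IsDominant Z {i}}
    have hS := isIrreducible_heckeSet (A := A) (c := c) (b := isogenyClass Z) (g := g) hΓ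
    have hsubW (J : Set ι) (hJ : J.ncard = 1 ∨ J.ncard = 2) {T : Set ι} (hd : IsDominant Z T)
        (hT : ∀ i ∈ J, i ∉ A → ∃ i' ∈ T, i' ∉ A ∧ isogenyClass Z i' = isogenyClass Z i) :
        ∀ y ∈ heckeSet A c (isogenyClass Z) g, proj J y ∈ proj J '' Z := by
      intro y hy
      by_contra hn
      obtain ⟨F, hF, hF0, hFy⟩ := isClosed_iff_exists_ne_zero.1 (hspec J hJ).1 _ hn
      exact hFy (eq_zero_of_isDominant hΓ hT hsub hd (pullback_proj_mem hF)
        (fun z hz => hF0 _ ⟨z, hz, rfl⟩) y hy)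
    have hW : heckeSet A c (isogenyClass Z) g ⊆
        ⋂ J ∈ {J : Set ι | J.ncard = 1 ∨ J.ncard = 2}, proj J ⁻¹' (proj J '' Z) := by
      refine fun y hy => Set.mem_iInter₂.2 fun J hJ => ?_
      obtain ⟨i, j, rfl⟩ : ∃ i j, J = {i, j} := by
        rcases hJ with h | h
        · obtain ⟨i, rfl⟩ := Set.ncard_eq_one.1 h
          exact ⟨i, i, by simp⟩
        · obtain ⟨i, j, -, rfl⟩ := Set.ncard_eq_two.1 h
          exact ⟨i, j, rfl⟩
      -- choose a subset of the non-constant coordinates in `{i, j}` on which `Z` is dominant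
      by_cases hi : i ∈ A
      · by_cases hj : j ∈ A
        · refine hsubW _ hJ (isDominant_empty hZ.nonempty) ?_ y hy
          rintro k (rfl | rfl) hk
          · exact absurd hi hk
          · exact absurd hj hk
        · refine hsubW _ hJ (T := {j}) (not_not.1 hj) ?_ y hy
          rintro k (rfl | rfl) hk
          · exact absurd hi hk
          · exact ⟨k, rfl, hj, rfl⟩
      · by_cases hj : j ∈ A
        · refine hsubW _ hJ (T := {i}) (not_not.1 hi) ?_ y hy
          rintro k (rfl | rfl) hk
          · exact ⟨k, rfl, hi, rfl⟩
          · exact absurd hj hk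
        · by_cases hb : isogenyClass Z i = isogenyClass Z j
          · refine hsubW _ hJ (T := {i}) (not_not.1 hi) ?_ y hy
            rintro k (rfl | rfl) hk
            · exact ⟨k, rfl, hi, rfl⟩
            · exact ⟨i, rfl, hi, hb⟩
          · have hd : IsDominant Z {i, j} := by
              by_contra hd
              refine hb (isogenyClass_eq_of_isSpecial hΓ (not_not.1 hi) (not_not.1 hj) ?_ hd)
              rw [(hspec _ hJ).1.closure_eq]
              exact hspec _ hJ
            exact hsubW _ hJ hd (fun k hk hkA => ⟨k, hk, hkA, rfl⟩) y hy
    rw [hsub.antisymm (hcomp.2 ⟨hS, hW⟩ hsub)]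
    refine isSpecial_heckeSet hΓ fun i hi => ?_
    refine (hspec {i} (.inl (Set.ncard_singleton i))).isCMPoint
      (i := (⟨i, rfl⟩ : ({i} : Set ι))) ?_
    rintro _ ⟨z, hz, rfl⟩
    exact (hsub hz).1 i hi

/-- A map on a product of two irreducible spaces that is continuous in each variable has an
irreducible image. -/
lemma isPreirreducible_range_two {P Q X : Type*} [TopologicalSpace P] [TopologicalSpace Q]
    [TopologicalSpace X] [PreirreducibleSpace P] [PreirreducibleSpace Q] {Φ : P → Q → X}
    (h1 : ∀ q, Continuous fun p => Φ p q) (h2 : ∀ p, Continuous (Φ p)) :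
    IsPreirreducible (Set.range fun x : P × Q => Φ x.1 x.2) := by
  rw [isPreirreducible_iff_isClosed_union_isClosed]
  intro F₁ F₂ hF₁ hF₂ hcov
  have hcl (F : Set X) (hF : IsClosed F) : IsClosed {p | ∀ q, Φ p q ∈ F} := by
    simp only [Set.ofPred_forall]
    exact isClosed_iInter fun q => hF.preimage (h1 q)
  have hU : (Set.univ : Set P) ⊆ {p | ∀ q, Φ p q ∈ F₁} ∪ {p | ∀ q, Φ p q ∈ F₂} := by
    intro p _
    have := isPreirreducible_iff_isClosed_union_isClosed.1
      (PreirreducibleSpace.isPreirreducible_univ (X := Q)) _ _ (hF₁.preimage (h2 p))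
      (hF₂.preimage (h2 p)) fun q _ => hcov ⟨(p, q), rfl⟩
    exact this.imp (fun h q => h (Set.mem_univ q)) fun h q => h (Set.mem_univ q)
  refine (isPreirreducible_iff_isClosed_union_isClosed.1
    (PreirreducibleSpace.isPreirreducible_univ (X := P)) _ _ (hcl F₁ hF₁) (hcl F₂ hF₂) hU).imp
    ?_ ?_ <;>
  · rintro h _ ⟨⟨p, q⟩, rfl⟩
    exact h (Set.mem_univ p) q

/-- Constant coordinates on components of loci defined by isogenies and CM points are CM points:
otherwise, all coordinates isogenous to the given one could be deformed simultaneously. -/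
lemma isCMPoint_of_isIrredComponentOf (hΓ : ∀ i, IsCongruenceSubgroup (Γ i))
    {C : Set (Σ i, ModularCurve (Γ i))} {D : Set (ι × ι × ℕ)} (hC : ∀ c ∈ C, IsCMPoint c.2)
    (hZ : IsIrredComponentOf Z (conditionLocus C D)) {i₀ : ι} {a : ModularCurve (Γ i₀)}
    (ha : ∀ x ∈ Z, x i₀ = a) : IsCMPoint a := by
  classical
  obtain ⟨τ₀, rfl⟩ := quotMap_surjective _ a
  rw [isCMPoint_quotMap_iff]
  intro hτ₀
  obtain ⟨⟨hirr, hZW⟩, hmax⟩ := hZ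
  set T : Set ι := {i | ∃ g : GL(2, ℚ)⁺, ∀ x ∈ Z, x i = quotMap (Γ i) (g • τ₀)} with hT
  choose! g hg using fun i (hi : i ∈ T) => hi
  let Φ (τ : ℍ) (z : ModularProduct Γ) : ModularProduct Γ :=
    fun i => if i ∈ T then quotMap (Γ i) (g i • τ) else z i
  have hΦT {τ z i} (hi : i ∈ T) : Φ τ z i = quotMap (Γ i) (g i • τ) := if_pos hi
  have hΦn {τ z i} (hi : i ∉ T) : Φ τ z i = z i := if_neg hi
  have : PreirreducibleSpace Z := Subtype.preirreducibleSpace hirr.isPreirreducible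
  have hτ (z : ModularProduct Γ) (i : ι) (f : ModularCurve (Γ i) → ℂ) (hf : IsRegularFunction f) :
      (fun τ => f (Φ τ z i)) ∈ congFun := by
    by_cases hi : i ∈ T
    · simp only [hΦT hi]
      exact hf.comp_mem_congFun (hΓ i) (g i)
    · simp only [hΦn hi]
      exact algebraMap_mem congFun (f (z i))
  have hz (τ : ℍ) (i : ι) (f : ModularCurve (Γ i) → ℂ) (hf : IsRegularFunction f) :
      (fun z => f (Φ τ z i)) ∈ coordRing Γ := by
    by_cases hi : i ∈ T
    · simp only [hΦT hi]
      exact algebraMap_mem (coordRing Γ) (f (quotMap (Γ i) (g i • τ)))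
    · simp only [hΦn hi]
      exact coord_mem_coordRing hf
  have hpre : IsPreirreducible
      (Set.range fun x : AnalyticHalfPlane × Z => Φ x.1 x.2) :=
    isPreirreducible_range_two (Φ := fun (τ : AnalyticHalfPlane) (z : Z) => Φ τ z)
      (fun z => continuous_of_forall_congFun (hτ z))
      fun τ => (continuous_of_coord (hz τ)).comp continuous_subtype_val
  obtain ⟨z₀, hz₀⟩ := hirr.nonempty
  have hne : (Set.range fun x : AnalyticHalfPlane × Z => Φ x.1 x.2).Nonempty :=
    ⟨_, (τ₀, ⟨z₀, hz₀⟩), rfl⟩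
  have hsub : Z ⊆ Set.range fun x : AnalyticHalfPlane × Z => Φ x.1 x.2 := by
    intro z hz
    refine ⟨(τ₀, ⟨z, hz⟩), funext fun i => ?_⟩
    by_cases hi : i ∈ T
    · exact (hΦT hi).trans (hg i hi z hz).symm
    · exact hΦn hi
  -- coordinates isogenous to a coordinate in `T` are in `T`
  have hTiso {i j : ι} {d : ℕ} (hi : i ∈ T) (h : ∀ x ∈ Z, AreIsogenous d (x j) (x i)) :
      j ∈ T := by
    obtain ⟨a', ha'⟩ := coord_eq_of_areIsogenous hΓ hirr (hg i hi) h
    obtain ⟨M, hM, τ, -, h1, h2⟩ := areIsogenous_iff.1 (h z₀ hz₀)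
    rw [hg i hi z₀ hz₀] at h2
    obtain ⟨γ, -, rfl⟩ := quotMap_eq_iff.1 h2.symm
    refine ⟨ofInt M hM * (ofSL γ * g i), fun x hx => ?_⟩
    rw [ha' x hx, ← ha' z₀ hz₀, h1, mul_smul, mul_smul, ofSL_smul]
  have hlocus : (Set.range fun x : AnalyticHalfPlane × Z => Φ x.1 x.2) ⊆ conditionLocus C D := by
    suffices ∀ (τ : ℍ), ∀ z ∈ Z, Φ τ z ∈ conditionLocus C D by
      rintro _ ⟨⟨τ, z⟩, rfl⟩
      exact this τ z z.2
    intro τ z hz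
    obtain ⟨hzC, hzD⟩ := hZW hz
    refine ⟨fun c hc => ?_, fun e he => ?_⟩
    · rw [hΦn, hzC c hc]
      intro hi
      have hcm := hC c hc
      rw [← hzC c hc, hg _ hi z hz, isCMPoint_quotMap_iff, endRing_smul_ne_bot_iff] at hcm
      exact hcm hτ₀
    · have hiso : ∀ x ∈ Z, AreIsogenous e.2.2 (x e.1) (x e.2.1) := fun x hx => (hZW hx).2 e he
      by_cases hi : e.2.1 ∈ T
      · have hj : e.1 ∈ T := hTiso hi hiso
        rw [hΦT hi, hΦT hj]
        obtain ⟨M, hM, σ, hd, h1, h2⟩ := areIsogenous_iff.1 (hiso z hz)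
        rw [hg _ hj z hz] at h1
        rw [hg _ hi z hz] at h2
        obtain ⟨γ, hγ, h1⟩ := quotMap_eq_iff.1 h1
        obtain ⟨δ, hδ, rfl⟩ := quotMap_eq_iff.1 h2.symm
        have h3 : (ofSL γ * ofInt M hM * ofSL δ * g e.2.1) • τ₀ = g e.1 • τ₀ := by
          rw [← h1]
          simp only [mul_smul, ofSL_smul]
        have h4 := smul_eq_smul_of_endRing_eq_bot hτ₀ h3 τ
        refine areIsogenous_iff.2 ⟨M, hM, δ • g e.2.1 • τ, hd, ?_, (quotMap_smul hδ _).symm⟩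
        rw [← h4]
        simp only [mul_smul, ofSL_smul]
        rw [quotMap_smul hγ]
      · have hj : e.1 ∉ T := fun hj => hi (hTiso hj fun x hx => (hiso x hx).symm)
        rw [hΦn hi, hΦn hj]
        exact hzD e he
  have hle := hmax ⟨⟨hne, hpre⟩, hlocus⟩ hsub
  have hi₀ : i₀ ∈ T := ⟨1, fun x hx => by rw [ha x hx, one_smul]⟩
  obtain ⟨a', ha'⟩ := exists_ne (quotMap (Γ i₀) τ₀)
  obtain ⟨σ, rfl⟩ := quotMap_surjective _ a'
  have hmem : Φ ((g i₀)⁻¹ • σ) z₀ ∈ Z := hle ⟨((g i₀)⁻¹ • σ, ⟨z₀, hz₀⟩), rfl⟩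
  have := ha _ hmem
  rw [hΦT hi₀, smul_inv_smul] at this
  exact ha' this

/-- The conditions that define the locus hold on the whole product of points and Hecke
correspondences that is defined by the constant coordinates of `Z` and the isogenies between its
coordinates. -/
theorem isSpecial_iff_isIrredComponentOf_conditionLocus [Finite ι]
    (hΓ : ∀ i, IsCongruenceSubgroup (Γ i)) : IsSpecial Z ↔
      ∃ (C : Set (Σ i, ModularCurve (Γ i))) (D : Set (ι × ι × ℕ)),
        (∀ c ∈ C, IsCMPoint c.2) ∧ (∀ e ∈ D, e.1 ≠ e.2.1 ∧ 1 ≤ e.2.2) ∧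
          IsIrredComponentOf Z (conditionLocus C D) := by
  constructor
  · intro h
    obtain ⟨A, c, b, g, hc, rfl⟩ := h.exists_eq_heckeSet
    refine ⟨{p | p.1 ∈ A ∧ p.2 = c p.1}, {e | (e.1 ≠ e.2.1 ∧ 1 ≤ e.2.2) ∧
      e.1 ∉ A ∧ e.2.1 ∉ A ∧ b e.1 = b e.2.1 ∧ ∀ τ,
        AreIsogenous e.2.2 (quotMap (Γ e.1) (g e.1 • τ)) (quotMap (Γ e.2.1) (g e.2.1 • τ))},
      ?_, fun e he => he.1, ?_⟩
    · rintro p ⟨hi, hp⟩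
      rw [hp]
      exact hc p.1 hi
    · refine isIrredComponentOf_heckeSet hΓ ?_ ?_ ?_
      · rintro x ⟨h1, t, ht⟩
        refine ⟨?_, ?_⟩
        · rintro p ⟨hi, hp⟩
          rw [hp]
          exact h1 p.1 hi
        · rintro ⟨i, j, d⟩ ⟨-, hi, hj, hb, hd⟩
          change AreIsogenous d (x i) (x j)
          rw [ht i hi, ht j hj, hb]
          exact hd _
      · exact fun x hx i hi => hx.1 ⟨i, c i⟩ ⟨hi, rfl⟩
      · intro i hi j hj hij hb
        obtain ⟨d, hd1, hd⟩ := exists_areIsogenous (Γ := Γ i) (Γ' := Γ j) (g i) (g j)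
        exact ⟨d, fun x hx => hx.2 (i, j, d) ⟨⟨hij, hd1⟩, hi, hj, hb, hd⟩⟩
  · rintro ⟨C, D, hC, hD, hcomp⟩
    have hZ := hcomp.1.1
    have hZW := hcomp.1.2
    obtain ⟨c, g, hsub⟩ := exists_subset_heckeSet_isogenyClass hΓ hZ
    set A := {i | ¬ IsDominant Z {i}}
    obtain ⟨z₀, hz₀⟩ := hZ.nonempty
    have hS := isIrreducible_heckeSet (A := A) (c := c) (b := isogenyClass Z) (g := g) hΓ
    have hlocus : heckeSet A c (isogenyClass Z) g ⊆ conditionLocus C D := by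
      intro y hy
      refine ⟨fun p hp => ?_, ?_⟩
      · have hi : p.1 ∈ A := not_isDominant_of_coord_eq hΓ fun x hx => (hZW hx).1 p hp
        rw [hy.1 _ hi, ← (hsub hz₀).1 _ hi]
        exact (hZW hz₀).1 p hp
      · rintro ⟨i, j, d⟩ he
        change AreIsogenous d (y i) (y j)
        have hiso : ∀ x ∈ Z, AreIsogenous d (x i) (x j) := fun x hx => (hZW hx).2 _ he
        have hA : i ∈ A ↔ j ∈ A := by
          constructor <;> intro hk
          · obtain ⟨a, ha⟩ := coord_eq_of_areIsogenous hΓ hZ (fun x hx => (hsub hx).1 i hk)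
              fun x hx => (hiso x hx).symm
            exact not_isDominant_of_coord_eq hΓ ha
          · obtain ⟨a, ha⟩ := coord_eq_of_areIsogenous hΓ hZ (fun x hx => (hsub hx).1 j hk) hiso
            exact not_isDominant_of_coord_eq hΓ ha
        by_cases hi : i ∈ A
        · have hj := hA.1 hi
          rw [hy.1 i hi, hy.1 j hj, ← (hsub hz₀).1 i hi, ← (hsub hz₀).1 j hj]
          exact hiso z₀ hz₀
        · have hij : i ≠ j := (hD _ he).1
          obtain ⟨S, hSd, hS⟩ := exists_finset_areIsogenous (hΓ i) (Γ j) d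
          classical
          obtain ⟨s, hs, hZs⟩ := exists_subset_of_subset_biUnion hZ S.finite_toSet
            (F := fun s => heckeOn Γ {i, j} (Function.update 1 i s))
            (fun s _ => isClosed_heckeOn hΓ _ _) (fun x hx => by
              obtain ⟨τ, hτ⟩ := quotMap_surjective (Γ j) (x j)
              obtain ⟨s, hs, hxs⟩ := hS (x i) τ (hτ ▸ hiso x hx)
              refine Set.mem_iUnion₂.2 ⟨s, hs, τ, ?_⟩
              rintro k (rfl | rfl)
              · rw [Function.update_self, hxs]
              · rw [Function.update_of_ne hij.symm, Pi.one_apply, one_smul, hτ])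
          have hmem : y ∈ heckeOn Γ {i, j} (Function.update 1 i s) := by
            by_contra hn
            obtain ⟨F, hF, hF0, hFy⟩ := exists_separating_heckeOn hΓ hn
            refine hFy (eq_zero_of_isDominant hΓ (T := {i}) ?_ hsub (not_not.1 hi) hF
              (fun z hz => hF0 z (hZs hz)) y hy)
            rintro k (rfl | rfl) hk
            · exact ⟨k, rfl, hi, rfl⟩
            · exact ⟨i, rfl, hi, isogenyClass_eq_iff.2 ⟨d, (hD _ he).2, hiso⟩⟩
          obtain ⟨τ, hτ⟩ := hmem
          have h1 := hτ i (by simp)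
          have h2 := hτ j (by simp)
          rw [Function.update_self] at h1
          rw [Function.update_of_ne hij.symm, Pi.one_apply, one_smul] at h2
          rw [h1, h2]
          exact hSd s hs τ
    rw [hsub.antisymm (hcomp.2 ⟨hS, hlocus⟩ hsub)]
    exact isSpecial_heckeSet hΓ fun i hi =>
      isCMPoint_of_isIrredComponentOf hΓ hC hcomp fun x hx => (hsub hx).1 i hi

end

end ModularProducts

theorem proposition3p6 (n : ℕ) (Γ : Fin n → Subgroup SL(2, ℤ))
    (hΓ : ∀ i, CongruenceSubgroup.IsCongruenceSubgroup (Γ i)) :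
    (∀ Z : Set (ModularProduct Γ), IsClosed Z → IsIrreducible Z →
      (IsSpecial Z ↔
        ∀ I : Set (Fin n), IsMinimalFor I Z → I.ncard ≤ 2 ∧ IsSpecial (closure (proj I '' Z)))) ∧
    (∀ Z : Set (ModularProduct Γ), IsClosed Z → IsIrreducible Z →
      (IsSpecial Z ↔
        (∀ I : Set (Fin n), I.ncard = 1 ∨ I.ncard = 2 → IsSpecial (proj I '' Z)) ∧
          IsIrredComponentOf Z
            (⋂ I ∈ {I : Set (Fin n) | I.ncard = 1 ∨ I.ncard = 2}, proj I ⁻¹' (proj I '' Z)))) ∧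
    (∀ Z : Set (ModularProduct Γ),
      IsSpecial Z ↔
        ∃ (C : Set (Σ i, ModularCurve (Γ i))) (D : Set (Fin n × Fin n × ℕ)),
          (∀ c ∈ C, IsCMPoint c.2) ∧ (∀ e ∈ D, e.1 ≠ e.2.1 ∧ 1 ≤ e.2.2) ∧
            IsIrredComponentOf Z (conditionLocus C D)) :=
  ⟨fun _ hZc hZ => isSpecial_iff_forall_isMinimalFor hΓ hZc hZ,
    fun _ _ hZ => isSpecial_iff_isIrredComponentOf_iInter hΓ hZ,
    fun _ => isSpecial_iff_isIrredComponentOf_conditionLocus hΓ⟩
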